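/- Consider the problem $k$-Clustering with Column Outliers. The input is a finite alphabet $\Sigma$ of non-negative integers, an $m\times n$ matrix ($m,n\ge 1$) with columns $\mathbf a^1,\dots,\mathbf a^n\in\Sigma^m$, a positive integer $k$, and non-negative integers $B$ and $\ell$. The task is to decide whether there are a set $O\subseteq\{1,\dots,n\}$ of size at most $\ell$, a partition of $\{1,\dots,n\}\setminus O$ into $k$ non-empty clusters $I_1,\dots,I_k$, and vectors $\mathbf c_1,\dots,\mathbf c_k\in\Sigma^m$ such that $$\sum_{i=1}^{k}\sum_{j\in I_i} d_H(\mathbf a^j,\mathbf c_i)\le B,$$ where $d_H$ is the Hamming distance. This problem is solvable in time $2^{O(B\log B)}\,|\Sigma|^{B}\,(nm)^{O(1)}$: there are a deterministic algorithm and an absolute constant $C$ (so, in particular, $C$ is independent of $k$, $\ell$ and $\Sigma$) such that the algorithm decides every instance correctly in at most $C\cdot 2^{C B\log_2 B}\cdot|\Sigma|^{B}\cdot(nm)^{C}$ steps (with $0\log_2 0=0$). Steps are counted on a word RAM whose words have $O(\log(N+M))$ bits, where $N$ is the number of words of the input, given as a list of numbers in memory, and $M$ is the largest of them. -/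

import Mathlib

/-! ### The word RAM

A word RAM has registers `0, 1, 2, …` (a program mentions finitely many of them) and a random access
memory with cells `0, 1, 2, …`. Registers and cells hold words, that is, natural numbers below a
bound `W` (words of `⌈log₂ W⌉` bits). Every elementary instruction and every test costs one step.
Programs are written with structured control flow. A program is a finite object that does not
depend on the input or on `W`, and a run in which some instruction would produce a number `≥ W` is
stuck (it has no result). -/

namespace WordRAM

/-- Registers and memory. -/
structure State where
  reg : ℕ → ℕ
  mem : ℕ → ℕ

/-- The elementary instructions. The arguments `d`, `a`, `b` are register numbers. -/
inductive Instr where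
  /-- `reg d := v` for a constant `v` -/
  | const (d v : ℕ)
  /-- `reg d := reg a + reg b` -/
  | add (d a b : ℕ)
  /-- `reg d := max (reg a - reg b) 0` -/
  | sub (d a b : ℕ)
  /-- `reg d := reg a * reg b` -/
  | mul (d a b : ℕ)
  /-- `reg d := ⌊reg a / reg b⌋`, and `0` if `reg b = 0` -/
  | div (d a b : ℕ)
  /-- `reg d := mem (reg a)` -/
  | load (d a : ℕ)
  /-- `mem (reg d) := reg a` -/
  | store (d a : ℕ)

/-- Write `v` into register `d`, if `v` fits into a word. -/
def State.write (W : ℕ) (s : State) (d v : ℕ) : Option State :=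
  if v < W then some { s with reg := Function.update s.reg d v } else none

/-- The effect of one elementary instruction, with word bound `W`; `none` is an overflow. -/
def Instr.exec (W : ℕ) : Instr → State → Option State
  | const d v, s => s.write W d v
  | add d a b, s => s.write W d (s.reg a + s.reg b)
  | sub d a b, s => s.write W d (s.reg a - s.reg b)
  | mul d a b, s => s.write W d (s.reg a * s.reg b)
  | div d a b, s => s.write W d (s.reg a / s.reg b)
  | load d a, s => s.write W d (s.mem (s.reg a))
  | store d a, s => some { s with mem := Function.update s.mem (s.reg d) (s.reg a) }

/-- Programs. A test asks whether a register is nonzero. -/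
inductive Program where
  | skip
  | instr (i : Instr)
  | seq (p q : Program)
  | ite (r : ℕ) (p q : Program)
  | while (r : ℕ) (p : Program)

/-- `Runs W p s t s'`: with word bound `W`, the program `p` started in the state `s` halts after
exactly `t` steps in the state `s'`. -/
inductive Runs (W : ℕ) : Program → State → ℕ → State → Prop where
  | skip (s : State) : Runs W .skip s 0 s
  | instr {i : Instr} {s s' : State} (h : i.exec W s = some s') : Runs W (.instr i) s 1 s'
  | seq {p q : Program} {s s' s'' : State} {t u : ℕ}
      (hp : Runs W p s t s') (hq : Runs W q s' u s'') : Runs W (.seq p q) s (t + u) s''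
  | ite_true {r : ℕ} {p q : Program} {s s' : State} {t : ℕ}
      (hr : s.reg r ≠ 0) (hp : Runs W p s t s') : Runs W (.ite r p q) s (t + 1) s'
  | ite_false {r : ℕ} {p q : Program} {s s' : State} {t : ℕ}
      (hr : s.reg r = 0) (hq : Runs W q s t s') : Runs W (.ite r p q) s (t + 1) s'
  | while_true {r : ℕ} {p : Program} {s s' s'' : State} {t u : ℕ}
      (hr : s.reg r ≠ 0) (hp : Runs W p s t s') (hw : Runs W (.while r p) s' u s'') :
      Runs W (.while r p) s (t + u + 1) s''
  | while_false {r : ℕ} {p : Program} {s : State}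
      (hr : s.reg r = 0) : Runs W (.while r p) s 1 s

/-- The initial state: the input stands in the memory cells `0, …, x.length - 1`, its length in
register `0`, and everything else is zero. -/
def init (x : List ℕ) : State where
  reg := fun r => if r = 0 then x.length else 0
  mem := fun a => x.getD a 0

/-- The word bound for words of `O(log (N + M))` bits, where `N` is the number of words of the input
`x` and `M` is the largest of them. The constant hidden in the `O` is `c`. -/
def wordBound (c : ℕ) (x : List ℕ) : ℕ := (x.length + x.foldr max 0 + 2) ^ c

end WordRAM

/-! ### `k`-Clustering with Column Outliers -/

namespace ColumnOutliers

/-- An instance: an alphabet (a finite set of non-negative integers), an `m × n` matrix over it, a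
positive number `k` of clusters, a budget `B` and a number `l` of outliers. -/
structure Instance where
  alphabet : Finset ℕ
  m : ℕ
  n : ℕ
  m_pos : 0 < m
  n_pos : 0 < n
  A : Matrix (Fin m) (Fin n) ℕ
  A_mem : ∀ i j, A i j ∈ alphabet
  k : ℕ
  k_pos : 0 < k
  B : ℕ
  l : ℕ

/-- The yes-instances: there are a set `O` of at most `l` columns, a partition of the other columns
into `k` nonempty clusters `I 1, …, I k`, and centers `c 1, …, c k` over the alphabet, such that the
sum of the Hamming distances from the columns to the centers of their clusters is at most `B`. -/
def Instance.IsYes (x : Instance) : Prop :=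
  ∃ (O : Finset (Fin x.n)) (I : Fin x.k → Finset (Fin x.n)) (c : Fin x.k → Fin x.m → ℕ),
    O.card ≤ x.l ∧
    (∀ i, (I i).Nonempty) ∧
    (∀ i i', i ≠ i' → Disjoint (I i) (I i')) ∧
    Finset.univ.biUnion I = Finset.univ \ O ∧
    (∀ i h, c i h ∈ x.alphabet) ∧
    ∑ i, ∑ j ∈ I i, hammingDist (fun h => x.A h j) (c i) ≤ x.B

/-- The instance as a list of words: `m, n, k, B, l, |Σ|`, the entries of the matrix column by
column, and the elements of the alphabet in increasing order. -/
def Instance.encode (x : Instance) : List ℕ :=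
  [x.m, x.n, x.k, x.B, x.l, x.alphabet.card] ++
    (List.finRange x.n).flatMap (fun j => (List.finRange x.m).map (fun i => x.A i j)) ++
    x.alphabet.sort (· ≤ ·)

end ColumnOutliers

/-! ### Terms with bounded sums, and their compilation to the word RAM -/

namespace WordRAM

/-! Call a class of equal columns a kind. Nonemptiness of the clusters only adds the condition `k ≤
n` (`Instance.isYes_iff`), so the question is whether all but `l` columns can be assigned to at most
`k` centers at cost at most `B`. In an optimal assignment at most `B` columns have positive distance
to their center. Hence at most `B` centers serve such columns, and the columns served by these
centers form at most `2 * B` kinds, since a column at distance zero is a copy of its center. Every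
other covered kind is its own center and costs nothing, so these kinds may be exchanged for the most
frequent kinds that remain (`exists_plan`, `exists_threshold`, `sum_le_sum_threshold`).

The algorithm guesses the shape of the expensive part: which of `2 * B` slots form a cluster, the
multiplicity and the distance of each slot, its color, and whether its kind is frequent. The colors
come from a hash function that separates the special kinds (`exists_hash_injOn`). Slots of different
colors never receive the same kind, so each slot can be filled greedily. A guess has `O(B)` digits
that are polynomial in `B` and three digits that are polynomial in `n`, which gives `2 ^ O(B log B)`
times a polynomial in `n`.

For a fixed guess the centers are found cluster by cluster. A center is given by a leading column of
the cluster, one nearest to the center, and by at most `B` changes, each consisting of a row and a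
letter. The letters account for the power of `|Σ|`, but the naive number of choices of rows, `m ^
B`, is too large. Optimality helps: in a row where the center differs from the leading column, at
least half of the weight of the cluster differs from the leading column (`majority_of_optimal`). The
guess records which slot deviates at which change, so the deviation sets of the slots cover every
change with at least half of the weight. A single column within distance `2 * B` of the leading
column leaves at most `(2 * B) ^ B` possibilities for the rows of the changes at which it deviates.
By Shearer's inequality (`card_le_sq_of_half_cover`) the number of row sequences is at most `(n * (2
* B) ^ B) ^ 2` (`card_good_le`). The test is applied to every prefix, so the bound holds on every
level of a backtracking search (`nodes_good_le`). Accepted guesses give clusterings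
(`core_of_accepts`), and every clustering gives an accepted guess (`exists_guess`).

On the machine, every test is a fixed term built from arithmetic and sums over ranges of length `n`,
`m`, `B`, `2 * B` or `2 * n + 1`. Terms are compiled once and for all (`Term.computes`). Their time
is polynomial in these loop bounds, their values are polynomial in the size of the words, and `k`,
`l` and `|Σ|` never bound the loop of a term. Both searches are instances of one backtracking
program (`BacktrackSpec.ends_backtrack`). -/

/-- Set register `d` to `v`. -/
def State.set (s : State) (d v : ℕ) : State := { s with reg := Function.update s.reg d v }

/-- Set memory cell `a` to `v`. -/
def State.poke (s : State) (a v : ℕ) : State := { s with mem := Function.update s.mem a v }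

@[simp] theorem State.set_reg (s : State) (d v : ℕ) :
    (s.set d v).reg = Function.update s.reg d v := rfl
@[simp] theorem State.set_mem (s : State) (d v : ℕ) : (s.set d v).mem = s.mem := rfl
@[simp] theorem State.poke_reg (s : State) (d v : ℕ) : (s.poke d v).reg = s.reg := rfl
@[simp] theorem State.poke_mem (s : State) (d v : ℕ) :
    (s.poke d v).mem = Function.update s.mem d v := rfl

/-! ### Single instructions as updates of the state. -/

theorem runs_const {W d v : ℕ} (s : State) (h : v < W) :
    Runs W (.instr (.const d v)) s 1 (s.set d v) :=
  .instr (by simp [Instr.exec, State.write, h, State.set])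

theorem runs_add {W d a b : ℕ} (s : State) (h : s.reg a + s.reg b < W) :
    Runs W (.instr (.add d a b)) s 1 (s.set d (s.reg a + s.reg b)) :=
  .instr (by simp [Instr.exec, State.write, h, State.set])

theorem runs_sub {W d a b : ℕ} (s : State) (h : s.reg a - s.reg b < W) :
    Runs W (.instr (.sub d a b)) s 1 (s.set d (s.reg a - s.reg b)) :=
  .instr (by simp [Instr.exec, State.write, h, State.set])

theorem runs_mul {W d a b : ℕ} (s : State) (h : s.reg a * s.reg b < W) :
    Runs W (.instr (.mul d a b)) s 1 (s.set d (s.reg a * s.reg b)) :=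
  .instr (by simp [Instr.exec, State.write, h, State.set])

theorem runs_div {W d a b : ℕ} (s : State) (h : s.reg a / s.reg b < W) :
    Runs W (.instr (.div d a b)) s 1 (s.set d (s.reg a / s.reg b)) :=
  .instr (by simp [Instr.exec, State.write, h, State.set])

theorem runs_load {W d a : ℕ} (s : State) (h : s.mem (s.reg a) < W) :
    Runs W (.instr (.load d a)) s 1 (s.set d (s.mem (s.reg a))) :=
  .instr (by simp [Instr.exec, State.write, h, State.set])

theorem runs_store {W d a : ℕ} (s : State) :
    Runs W (.instr (.store d a)) s 1 (s.poke (s.reg d) (s.reg a)) :=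
  .instr (by simp [Instr.exec, State.poke])

/-- Copy register `a` to a different register `d`. -/
def copy (d a : ℕ) : Program := .seq (.instr (.const d 0)) (.instr (.add d d a))

theorem runs_copy {W d a : ℕ} (s : State) (hda : a ≠ d) (h : s.reg a < W) :
    Runs W (copy d a) s 2 (s.set d (s.reg a)) := by
  have h1 : Runs W (.instr (.const d 0)) s 1 (s.set d 0) := runs_const s (by omega)
  have h2 : Runs W (.instr (.add d d a)) (s.set d 0) 1 _ := runs_add (d := d) (s.set d 0)
    (by simpa [Function.update_of_ne hda] using h)
  have h3 := Runs.seq h1 h2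
  have e : (s.set d 0).set d ((s.set d 0).reg d + (s.set d 0).reg a) = s.set d (s.reg a) := by
    simp [State.set, Function.update_of_ne hda]
  rw [e] at h3
  exact h3

/-- The term language: arithmetic, memory access, and sums `∑ r < g, t` over a bound variable. The
variables are the registers below `64`; the bound of a sum is one of the registers `1, …, 6`. -/
inductive Term where
  | reg (r : ℕ)
  | const (v : ℕ)
  | add (a b : Term)
  | sub (a b : Term)
  | mul (a b : Term)
  | div (a b : Term)
  | load (a : Term)
  | sum (r g : ℕ) (t : Term)

namespace Term

/-- The value of a term in the memory `μ` and the register assignment `ρ`. -/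
def eval (μ : ℕ → ℕ) : Term → (ℕ → ℕ) → ℕ
  | reg r, ρ => ρ r
  | const v, _ => v
  | add a b, ρ => a.eval μ ρ + b.eval μ ρ
  | sub a b, ρ => a.eval μ ρ - b.eval μ ρ
  | mul a b, ρ => a.eval μ ρ * b.eval μ ρ
  | div a b, ρ => a.eval μ ρ / b.eval μ ρ
  | load a, ρ => μ (a.eval μ ρ)
  | sum r g t, ρ => ∑ i ∈ Finset.range (ρ g), t.eval μ (Function.update ρ r i)

/-- Well-formed terms. -/
def WF : Term → Bool
  | reg r => decide (r < 64)
  | const _ => true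
  | add a b => a.WF && b.WF
  | sub a b => a.WF && b.WF
  | mul a b => a.WF && b.WF
  | div a b => a.WF && b.WF
  | load a => a.WF
  | sum r g t => decide (7 ≤ r) && decide (r < 64) && decide (1 ≤ g) && decide (g ≤ 6) && t.WF

/-- The program that writes the value of a term into register `d`, using the registers from `d`. -/
def compile : Term → ℕ → Program
  | reg r, d => copy d r
  | const v, d => .instr (.const d v)
  | add a b, d => .seq (a.compile d) (.seq (b.compile (d + 1)) (.instr (.add d d (d + 1))))
  | sub a b, d => .seq (a.compile d) (.seq (b.compile (d + 1)) (.instr (.sub d d (d + 1))))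
  | mul a b, d => .seq (a.compile d) (.seq (b.compile (d + 1)) (.instr (.mul d d (d + 1))))
  | div a b, d => .seq (a.compile d) (.seq (b.compile (d + 1)) (.instr (.div d d (d + 1))))
  | load a, d => .seq (a.compile d) (.instr (.load d d))
  -- Register `d` accumulates, `d + 1` saves the old value of the bound variable `r`, and `d + 2`
  -- holds the number `g - r` of remaining rounds, which is also the loop test. The variable is
  -- restored at the end, so that a term leaves all variables unchanged.
  | sum r g t, d =>
      .seq (.instr (.const d 0)) <| .seq (copy (d + 1) r) <| .seq (.instr (.const r 0)) <|
      .seq (.instr (.sub (d + 2) g r)) <|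
      .seq (.while (d + 2) <|
        .seq (t.compile (d + 3)) <| .seq (.instr (.add d d (d + 3))) <|
        .seq (.instr (.const (d + 3) 1)) <| .seq (.instr (.add r r (d + 3)))
          (.instr (.sub (d + 2) g r)))
      (copy r (d + 1))

/-- Every value occurring in the evaluation is at most `X ^ deg` if the registers and the memory are
bounded by `X`. -/
def deg : Term → ℕ
  | reg _ => 1
  -- `v ≤ 2 ^ v ≤ X ^ v`; the additional one makes all degrees positive, which the case of a sum `a
  -- + b` needs.
  | const v => v + 1
  | add a b => a.deg + b.deg
  | sub a b => a.deg + b.deg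
  | mul a b => a.deg + b.deg
  | div a b => a.deg + b.deg
  | load a => a.deg
  | sum _ _ t => t.deg + 1

/-- A bound on the evaluation time if the loop bounds are at most `R`. -/
def time (R : ℕ) : Term → ℕ
  | reg _ => 2
  | const _ => 1
  | add a b => a.time R + b.time R + 1
  | sub a b => a.time R + b.time R + 1
  | mul a b => a.time R + b.time R + 1
  | div a b => a.time R + b.time R + 1
  | load a => a.time R + 1
  | sum _ _ t => R * (t.time R + 5) + 8

theorem deg_pos (t : Term) : 1 ≤ t.deg := by
  induction t <;> simp [deg] <;> omega

/-- The nesting depth of the loops in a fixed term is fixed. So the time is polynomial in the loop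
bound, with an exponent that depends on the term alone. -/
theorem exists_time_le (t : Term) : ∃ e, ∀ R, 2 ≤ R → t.time R ≤ R ^ e := by
  have key : ∀ {a b R : ℕ} (e f : ℕ), 2 ≤ R → a ≤ R ^ e → b ≤ R ^ f →
      a + b + 1 ≤ R ^ (e + f + 2) := by
    intro a b R e f hR ha hb
    have h1 : 1 ≤ R ^ e := Nat.one_le_pow _ _ (by omega)
    have h2 : 1 ≤ R ^ f := Nat.one_le_pow _ _ (by omega)
    have h3 : R ^ e + R ^ f ≤ 2 * (R ^ e * R ^ f) := by nlinarith
    have h4 : 4 ≤ R ^ 2 := by nlinarith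
    calc a + b + 1 ≤ 4 * (R ^ e * R ^ f) := by nlinarith
      _ ≤ R ^ 2 * (R ^ e * R ^ f) := Nat.mul_le_mul_right _ h4
      _ = R ^ (e + f + 2) := by ring
  have bin : ∀ {p q : ℕ → ℕ}, (∃ e, ∀ R, 2 ≤ R → p R ≤ R ^ e) →
      (∃ e, ∀ R, 2 ≤ R → q R ≤ R ^ e) → ∃ e, ∀ R, 2 ≤ R → p R + q R + 1 ≤ R ^ e := by
    rintro p q ⟨e, he⟩ ⟨f, hf⟩
    exact ⟨e + f + 2, fun R hR => key e f hR (he R hR) (hf R hR)⟩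
  induction t with
  | reg r => exact ⟨1, fun R hR => by simpa [time] using hR⟩
  | const v => exact ⟨0, fun R hR => by simp [time]⟩
  | add a b iha ihb => exact bin iha ihb
  | sub a b iha ihb => exact bin iha ihb
  | mul a b iha ihb => exact bin iha ihb
  | div a b iha ihb => exact bin iha ihb
  | load a iha =>
    obtain ⟨e, he⟩ := iha
    refine ⟨e + 0 + 2, fun R hR => ?_⟩
    have := key (b := 0) e 0 hR (he R hR) (by simp)
    simpa [time] using this
  | sum r g t ih =>
    obtain ⟨e, he⟩ := ih
    refine ⟨e + 7, fun R hR => ?_⟩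
    have h1 : 1 ≤ R ^ e := Nat.one_le_pow _ _ (by omega)
    have h2 : 64 ≤ R ^ 6 := by
      calc 64 = 2 ^ 6 := by norm_num
        _ ≤ R ^ 6 := Nat.pow_le_pow_left hR 6
    calc time R (sum r g t) = R * (t.time R + 5) + 8 := rfl
      _ ≤ R * (R ^ e + 5) + 8 := by gcongr; exact he R hR
      _ ≤ 64 * (R * R ^ e) := by nlinarith
      _ ≤ R ^ 6 * (R * R ^ e) := Nat.mul_le_mul_right _ h2
      _ = R ^ (e + 7) := by ring

end Term

/-- The variables and the memory are bounded by `X`, and the loop bounds by `R`. -/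
structure Bounded (X R : ℕ) (s : State) : Prop where
  reg : ∀ r < 64, s.reg r ≤ X
  mem : ∀ a, s.mem a ≤ X
  loop : ∀ g, 1 ≤ g → g ≤ 6 → s.reg g ≤ R

theorem Bounded.set {X R : ℕ} {s : State} (h : Bounded X R s) {r v : ℕ} (hr : 7 ≤ r) (hv : v ≤ X) :
    Bounded X R (s.set r v) where
  reg q hq := by
    by_cases e : q = r
    · subst e; simpa using hv
    · simpa [Function.update_of_ne e] using h.reg q hq
  mem := h.mem
  loop g h1 h2 := by
    have e : g ≠ r := by omega
    simpa [Function.update_of_ne e] using h.loop g h1 h2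

theorem Bounded.congr {X R : ℕ} {s s' : State} (h : Bounded X R s)
    (hr : ∀ r < 64, s'.reg r = s.reg r) (hm : s'.mem = s.mem) : Bounded X R s' where
  reg r hr' := by rw [hr r hr']; exact h.reg r hr'
  mem a := by rw [hm]; exact h.mem a
  loop g h1 h2 := by rw [hr g (by omega)]; exact h.loop g h1 h2

/-! ### Correctness of compiled terms. -/

namespace Term

theorem eval_congr (μ : ℕ → ℕ) (t : Term) (hwf : t.WF) (ρ ρ' : ℕ → ℕ)
    (h : ∀ r < 64, ρ r = ρ' r) : t.eval μ ρ = t.eval μ ρ' := by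
  induction t generalizing ρ ρ' with
  | reg r => exact h r (by simpa [WF] using hwf)
  | const v => rfl
  | add a b iha ihb | sub a b iha ihb | mul a b iha ihb | div a b iha ihb =>
    simp only [WF, Bool.and_eq_true] at hwf
    simp only [eval]
    rw [iha hwf.1 ρ ρ' h, ihb hwf.2 ρ ρ' h]
  | load a iha => simp only [eval]; rw [iha hwf ρ ρ' h]
  | sum r g t ih =>
    simp only [WF, Bool.and_eq_true, decide_eq_true_eq] at hwf
    simp only [eval]
    rw [h g (by omega)]
    refine Finset.sum_congr rfl fun i _ => ih hwf.2 _ _ fun q hq => ?_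
    by_cases e : q = r
    · subst e; simp
    · simp [Function.update_of_ne e, h q hq]

/-- Degrees add up because the bounds of subterms are at least 2, where `a + b ≤ a * b`. Differences
and quotients do not grow, a loaded word is bounded by assumption, and a sum has at most `X`
summands. The loop variable stays below `X`, so the induction hypothesis applies inside a sum. -/
theorem eval_le {X R : ℕ} (hX : 2 ≤ X) (t : Term) (hwf : t.WF) (s : State) (hs : Bounded X R s) :
    t.eval s.mem s.reg ≤ X ^ t.deg := by
  have mono : ∀ {a b : ℕ}, a ≤ b → X ^ a ≤ X ^ b := fun h => Nat.pow_le_pow_right (by omega) h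
  have one : ∀ a, 1 ≤ X ^ a := fun a => Nat.one_le_pow _ _ (by omega)
  induction t generalizing s with
  | reg r => simpa [eval, deg] using hs.reg r (by simpa [WF] using hwf)
  | const v =>
    calc v ≤ 2 ^ v := Nat.lt_two_pow_self.le
      _ ≤ X ^ v := Nat.pow_le_pow_left hX v
      _ ≤ X ^ (v + 1) := mono (by omega)
  | add a b iha ihb =>
    simp only [WF, Bool.and_eq_true] at hwf
    have h1 := iha hwf.1 s hs
    have h2 := ihb hwf.2 s hs
    have h3 : 2 ≤ X ^ a.deg := hX.trans (by simpa using mono a.deg_pos)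
    have h4 : 2 ≤ X ^ b.deg := hX.trans (by simpa using mono b.deg_pos)
    simp only [eval, deg, pow_add]
    nlinarith
  | sub a b iha ihb =>
    simp only [WF, Bool.and_eq_true] at hwf
    have h1 := iha hwf.1 s hs
    simp only [eval, deg]
    exact (Nat.sub_le _ _).trans (h1.trans (mono (by omega)))
  | mul a b iha ihb =>
    simp only [WF, Bool.and_eq_true] at hwf
    simp only [eval, deg, pow_add]
    exact Nat.mul_le_mul (iha hwf.1 s hs) (ihb hwf.2 s hs)
  | div a b iha ihb =>
    simp only [WF, Bool.and_eq_true] at hwf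
    have h1 := iha hwf.1 s hs
    simp only [eval, deg]
    exact (Nat.div_le_self _ _).trans (h1.trans (mono (by omega)))
  | load a iha =>
    simp only [eval, deg]
    exact (hs.mem _).trans (by simpa using mono a.deg_pos)
  | sum r g t ih =>
    simp only [WF, Bool.and_eq_true, decide_eq_true_eq] at hwf
    simp only [eval, deg]
    calc _ ≤ ∑ i ∈ Finset.range (s.reg g), X ^ t.deg := by
          refine Finset.sum_le_sum fun i hi => ?_
          have hi' : i ≤ X := (Finset.mem_range.1 hi).le.trans (hs.reg g (by omega))
          exact ih hwf.2 (s.set r i) (hs.set hwf.1.1.1.1 hi')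
      _ = s.reg g * X ^ t.deg := by simp
      _ ≤ X * X ^ t.deg := Nat.mul_le_mul_right _ (hs.reg g (by omega))
      _ = X ^ (t.deg + 1) := by ring

/-- What compiled terms do. -/
def Computes (W X R : ℕ) (t : Term) : Prop :=
  ∀ d, 64 ≤ d → ∀ s : State, Bounded X R s →
    ∃ τ ≤ t.time R, ∃ s', Runs W (t.compile d) s τ s' ∧ s'.reg d = t.eval s.mem s.reg ∧
      (∀ r < d, s'.reg r = s.reg r) ∧ s'.mem = s.mem

/-- The four arithmetic operations share one code pattern. Evaluating the right operand from
register `d + 1` on preserves both the left value in `d` and the variables. -/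
theorem computes_binary {W X R : ℕ} {a b t : Term} (op : ℕ → ℕ → ℕ)
    (I : ℕ → Instr)
    (hI : ∀ d (s : State), op (s.reg d) (s.reg (d + 1)) < W →
      Runs W (.instr (I d)) s 1 (s.set d (op (s.reg d) (s.reg (d + 1)))))
    (hc : ∀ d, t.compile d = .seq (a.compile d) (.seq (b.compile (d + 1)) (.instr (I d))))
    (he : ∀ μ ρ, t.eval μ ρ = op (a.eval μ ρ) (b.eval μ ρ))
    (ht : t.time R = a.time R + b.time R + 1)
    (hwb : b.WF)
    (hlt : ∀ s : State, Bounded X R s → t.eval s.mem s.reg < W)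
    (ha : Computes W X R a) (hb : Computes W X R b) : Computes W X R t := by
  intro d hd s hs
  obtain ⟨τ1, hτ1, s1, hr1, hv1, hf1, hm1⟩ := ha d hd s hs
  have hs1 : Bounded X R s1 := hs.congr (fun r hr => hf1 r (by omega)) hm1
  obtain ⟨τ2, hτ2, s2, hr2, hv2, hf2, hm2⟩ := hb (d + 1) (by omega) s1 hs1
  have e1 : s2.reg d = a.eval s.mem s.reg := by rw [hf2 d (by omega), hv1]
  have e2 : s2.reg (d + 1) = b.eval s.mem s.reg := by
    rw [hv2, hm1]
    exact eval_congr _ _ hwb _ _ fun r hr => hf1 r (by omega)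
  have h3 := hI d s2 (by rw [e1, e2, ← he]; exact hlt s hs)
  refine ⟨τ1 + (τ2 + 1), by omega, _, by rw [hc]; exact .seq hr1 (.seq hr2 h3), ?_, ?_, ?_⟩
  · simp [e1, e2, he]
  · intro r hr
    have e : r ≠ d := by omega
    simp only [State.set_reg, Function.update_of_ne e]
    rw [hf2 r (by omega), hf1 r hr]
  · simp [hm1, hm2]

/-- The loop of a compiled sum. -/
theorem runs_sum_loop {W X R : ℕ} {t : Term} {r g d : ℕ} (hr : 7 ≤ r) (hr' : r < 64)
    (hg : 1 ≤ g) (hg' : g ≤ 6) (hd : 64 ≤ d) (hwf : t.WF) (hXW : X < W) (hX : 2 ≤ X)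
    (ih : Computes W X R t) (s₀ : State) (hs₀ : Bounded X R s₀)
    (hlt : ∀ i ≤ s₀.reg g, ∑ x ∈ Finset.range i, t.eval s₀.mem (Function.update s₀.reg r x) < W)
    (v : ℕ) :
    ∀ k i (s : State), i + k = s₀.reg g → s.mem = s₀.mem → s.reg r = i →
      (∀ q < d, q ≠ r → s.reg q = s₀.reg q) →
      s.reg d = ∑ x ∈ Finset.range i, t.eval s₀.mem (Function.update s₀.reg r x) →
      s.reg (d + 1) = v → s.reg (d + 2) = k →
      ∃ τ ≤ k * (t.time R + 5) + 1, ∃ s',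
        Runs W (.while (d + 2) <|
          .seq (t.compile (d + 3)) <| .seq (.instr (.add d d (d + 3))) <|
          .seq (.instr (.const (d + 3) 1)) <| .seq (.instr (.add r r (d + 3)))
            (.instr (.sub (d + 2) g r))) s τ s' ∧
        s'.mem = s₀.mem ∧ (∀ q < d, q ≠ r → s'.reg q = s₀.reg q) ∧
        s'.reg d = ∑ x ∈ Finset.range (s₀.reg g), t.eval s₀.mem (Function.update s₀.reg r x) ∧
        s'.reg (d + 1) = v := by
  intro k
  induction k with
  | zero =>
    intro i s hi hm hri hf hacc hv hk
    refine ⟨1, by omega, s, .while_false hk, hm, hf, ?_, hv⟩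
    rw [hacc]; congr 2
  | succ k ihk =>
    intro i s hi hm hri hf hacc hv hk
    have hgX : s₀.reg g ≤ X := hs₀.reg g (by omega)
    have hsr : ∀ q < 64, s.reg q = (s₀.set r i).reg q := by
      intro q hq
      by_cases e : q = r
      · subst e; simp [hri]
      · simp [Function.update_of_ne e, hf q (by omega) e]
    have hbs : Bounded X R s := (hs₀.set hr (by omega : i ≤ X)).congr hsr hm
    obtain ⟨τ1, hτ1, s1, hr1, hv1, hf1, hm1⟩ := ih (d + 3) (by omega) s hbs
    have hval : s1.reg (d + 3) = t.eval s₀.mem (Function.update s₀.reg r i) := by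
      rw [hv1, hm]
      exact eval_congr _ _ hwf _ _ hsr
    have hsum := hlt (i + 1) (by omega)
    rw [Finset.sum_range_succ] at hsum
    have h2 : Runs W (.instr (.add d d (d + 3))) s1 1 _ := runs_add s1 (by
      rw [hf1 d (by omega), hacc, hval]; exact hsum)
    set s2 := s1.set d (s1.reg d + s1.reg (d + 3)) with hs2
    have h3 : Runs W (.instr (.const (d + 3) 1)) s2 1 _ := runs_const s2 (by omega)
    set s3 := s2.set (d + 3) 1 with hs3
    have hr3 : s3.reg r = i := by
      have e1 : r ≠ d + 3 := by omega
      have e2 : r ≠ d := by omega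
      simp [hs3, hs2, Function.update_of_ne e1, Function.update_of_ne e2, hf1 r (by omega), hri]
    have hd3 : s3.reg (d + 3) = 1 := by simp [hs3]
    have h4 : Runs W (.instr (.add r r (d + 3))) s3 1 _ := runs_add s3 (by rw [hr3, hd3]; omega)
    set s4 := s3.set r (s3.reg r + s3.reg (d + 3)) with hs4
    have hr4 : s4.reg r = i + 1 := by simp [hs4, hr3, hd3]
    have hother : ∀ q, q ≠ r → q ≠ d → q ≠ d + 3 → s4.reg q = s1.reg q := by
      intro q e1 e2 e3
      simp [hs4, hs3, hs2, Function.update_of_ne e1, Function.update_of_ne e2,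
        Function.update_of_ne e3]
    have hg4 : s4.reg g = s₀.reg g := by
      rw [hother g (by omega) (by omega) (by omega), hf1 g (by omega), hf g (by omega) (by omega)]
    have h5 : Runs W (.instr (.sub (d + 2) g r)) s4 1 _ := runs_sub s4 (by rw [hg4]; omega)
    set s5 := s4.set (d + 2) (s4.reg g - s4.reg r) with hs5
    have h5o : ∀ q, q ≠ d + 2 → s5.reg q = s4.reg q := by
      intro q e; simp [hs5, Function.update_of_ne e]
    obtain ⟨τ2, hτ2, s', hr', hm', hf', hd', hv'⟩ := ihk (i + 1) s5 (by omega)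
      (by simp [hs5, hs4, hs3, hs2, hm1, hm])
      (by rw [h5o r (by omega), hr4])
      (fun q hq hqr => by
        rw [h5o q (by omega), hother q hqr (by omega) (by omega), hf1 q (by omega), hf q hq hqr])
      (by
        have e1 : d ≠ r := by omega
        rw [h5o d (by omega), Finset.sum_range_succ, ← hacc, ← hval, ← hf1 d (by omega)]
        simp [hs4, hs3, hs2, Function.update_of_ne e1])
      (by rw [h5o _ (by omega), hother _ (by omega) (by omega) (by omega), hf1 _ (by omega), hv])
      (by simp only [hs5, State.set_reg, Function.update_self, hg4, hr4]; omega)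
    refine ⟨_, ?_, s', .while_true (by omega) (.seq hr1 (.seq h2 (.seq h3 (.seq h4 h5)))) hr',
      hm', hf', hd', hv'⟩
    have : (k + 1) * (t.time R + 5) = k * (t.time R + 5) + (t.time R + 5) := by ring
    omega

/-- Degrees of subterms do not exceed the degree of the term, so the single condition `X ^ t.deg <
W` excludes overflow everywhere in the evaluation. -/
theorem computes {W X R : ℕ} (hX : 2 ≤ X) (t : Term) (hwf : t.WF) (hW : X ^ t.deg < W) :
    Computes W X R t := by
  have mono : ∀ {a b : ℕ}, a ≤ b → X ^ a ≤ X ^ b := fun h => Nat.pow_le_pow_right (by omega) h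
  have hlt : ∀ s : State, Bounded X R s → t.eval s.mem s.reg < W :=
    fun s hs => (eval_le hX t hwf s hs).trans_lt hW
  induction t with
  | reg r =>
    intro d hd s hs
    have hr : r < 64 := by simpa [WF] using hwf
    refine ⟨2, le_rfl, _, runs_copy s (by omega) (hlt s hs), by simp [eval], fun q hq => ?_, rfl⟩
    simp [Function.update_of_ne hq.ne]
  | const v =>
    intro d hd s hs
    refine ⟨1, le_rfl, _, runs_const s (hlt s hs), by simp [eval], fun q hq => ?_, rfl⟩
    simp [Function.update_of_ne hq.ne]
  | add a b iha ihb =>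
    simp only [WF, Bool.and_eq_true] at hwf
    have ha := (mono (show a.deg ≤ (add a b).deg by simp [deg])).trans_lt hW
    have hb := (mono (show b.deg ≤ (add a b).deg by simp [deg])).trans_lt hW
    exact computes_binary (· + ·) (fun d => .add d d (d + 1)) (fun d s h => runs_add s h)
      (fun d => rfl) (fun _ _ => rfl) rfl hwf.2 hlt
      (iha hwf.1 ha fun s hs => (eval_le hX a hwf.1 s hs).trans_lt ha)
      (ihb hwf.2 hb fun s hs => (eval_le hX b hwf.2 s hs).trans_lt hb)
  | sub a b iha ihb =>
    simp only [WF, Bool.and_eq_true] at hwf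
    have ha := (mono (show a.deg ≤ (sub a b).deg by simp [deg])).trans_lt hW
    have hb := (mono (show b.deg ≤ (sub a b).deg by simp [deg])).trans_lt hW
    exact computes_binary (· - ·) (fun d => .sub d d (d + 1)) (fun d s h => runs_sub s h)
      (fun d => rfl) (fun _ _ => rfl) rfl hwf.2 hlt
      (iha hwf.1 ha fun s hs => (eval_le hX a hwf.1 s hs).trans_lt ha)
      (ihb hwf.2 hb fun s hs => (eval_le hX b hwf.2 s hs).trans_lt hb)
  | mul a b iha ihb =>
    simp only [WF, Bool.and_eq_true] at hwf
    have ha := (mono (show a.deg ≤ (mul a b).deg by simp [deg])).trans_lt hW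
    have hb := (mono (show b.deg ≤ (mul a b).deg by simp [deg])).trans_lt hW
    exact computes_binary (· * ·) (fun d => .mul d d (d + 1)) (fun d s h => runs_mul s h)
      (fun d => rfl) (fun _ _ => rfl) rfl hwf.2 hlt
      (iha hwf.1 ha fun s hs => (eval_le hX a hwf.1 s hs).trans_lt ha)
      (ihb hwf.2 hb fun s hs => (eval_le hX b hwf.2 s hs).trans_lt hb)
  | div a b iha ihb =>
    simp only [WF, Bool.and_eq_true] at hwf
    have ha := (mono (show a.deg ≤ (div a b).deg by simp [deg])).trans_lt hW
    have hb := (mono (show b.deg ≤ (div a b).deg by simp [deg])).trans_lt hW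
    exact computes_binary (· / ·) (fun d => .div d d (d + 1)) (fun d s h => runs_div s h)
      (fun d => rfl) (fun _ _ => rfl) rfl hwf.2 hlt
      (iha hwf.1 ha fun s hs => (eval_le hX a hwf.1 s hs).trans_lt ha)
      (ihb hwf.2 hb fun s hs => (eval_le hX b hwf.2 s hs).trans_lt hb)
  | load a iha =>
    intro d hd s hs
    obtain ⟨τ, hτ, s1, hr1, hv1, hf1, hm1⟩ := iha hwf hW
      (fun s hs => (eval_le hX a hwf s hs).trans_lt hW) d hd s hs
    have h2 : Runs W (.instr (.load d d)) s1 1 _ := runs_load s1 (by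
      rw [hm1, hv1]; exact hlt s hs)
    refine ⟨τ + 1, by simp only [time]; omega, _, .seq hr1 h2, by simp [hm1, hv1, eval],
      fun q hq => ?_, by simp [hm1]⟩
    simp [Function.update_of_ne hq.ne, hf1 q hq]
  | sum r g t ih =>
    intro d hd s hs
    simp only [WF, Bool.and_eq_true, decide_eq_true_eq] at hwf
    obtain ⟨⟨⟨⟨hr7, hr64⟩, hg1⟩, hg6⟩, hwt⟩ := hwf
    have ht : X ^ t.deg < W := (mono (show t.deg ≤ (sum r g t).deg by simp [deg])).trans_lt hW
    have hXW : X < W := by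
      have := (mono (sum r g t).deg_pos).trans_lt hW
      simpa using this
    have iht := ih hwt ht fun s hs => (eval_le hX t hwt s hs).trans_lt ht
    have hrX := hs.reg r hr64
    have hgX := hs.reg g (by omega)
    have h1 : Runs W (.instr (.const d 0)) s 1 _ := runs_const s (by omega)
    set s1 := s.set d 0 with hs1
    have e1 : ∀ q, q ≠ d → s1.reg q = s.reg q := fun q e => by
      simp [hs1, Function.update_of_ne e]
    have h2 : Runs W (copy (d + 1) r) s1 2 _ := runs_copy s1 (by omega)
      (by rw [e1 r (by omega)]; omega)
    set s2 := s1.set (d + 1) (s1.reg r) with hs2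
    have e2 : ∀ q, q ≠ d + 1 → s2.reg q = s1.reg q := fun q e => by
      simp [hs2, Function.update_of_ne e]
    have h3 : Runs W (.instr (.const r 0)) s2 1 _ := runs_const s2 (by omega)
    set s3 := s2.set r 0 with hs3
    have e3 : ∀ q, q ≠ r → s3.reg q = s2.reg q := fun q e => by
      simp [hs3, Function.update_of_ne e]
    have hr3 : s3.reg r = 0 := by simp [hs3]
    have hg3 : s3.reg g = s.reg g := by
      rw [e3 g (by omega), e2 g (by omega), e1 g (by omega)]
    have h4 : Runs W (.instr (.sub (d + 2) g r)) s3 1 _ := runs_sub s3 (by rw [hg3]; omega)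
    set s4 := s3.set (d + 2) (s3.reg g - s3.reg r) with hs4
    have e4 : ∀ q, q ≠ d + 2 → s4.reg q = s3.reg q := fun q e => by
      simp [hs4, Function.update_of_ne e]
    -- Partial sums are bounded by the full sum, hence the accumulator never overflows.
    have hlt' : ∀ i ≤ s.reg g,
        ∑ x ∈ Finset.range i, t.eval s.mem (Function.update s.reg r x) < W := by
      intro i hi
      refine lt_of_le_of_lt ?_ (hlt s hs)
      simp only [eval]
      exact Finset.sum_le_sum_of_subset (by simpa using hi)
    obtain ⟨τ, hτ, s5, h5, hm5, hf5, hd5, hv5⟩ := runs_sum_loop (v := s.reg r) hr7 hr64 hg1 hg6 hd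
      hwt hXW hX iht s hs hlt' (s.reg g) 0 s4 (by omega) (by simp [hs4, hs3, hs2, hs1])
      (by rw [e4 r (by omega), hr3])
      (fun q hq hqr => by
        rw [e4 q (by omega), e3 q hqr, e2 q (by omega), e1 q (by omega)])
      (by rw [e4 d (by omega), e3 d (by omega), e2 d (by omega)]; simp [hs1])
      (by
        rw [e4 _ (by omega), e3 _ (by omega)]
        simp only [hs2, State.set_reg, Function.update_self]
        exact e1 r (by omega))
      (by simp only [hs4, State.set_reg, Function.update_self, hg3, hr3]; omega)
    have h6 : Runs W (copy r (d + 1)) s5 2 _ := runs_copy s5 (by omega) (by rw [hv5]; omega)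
    refine ⟨_, ?_, _, .seq h1 (.seq h2 (.seq h3 (.seq h4 (.seq h5 h6)))), ?_, ?_, ?_⟩
    · have := Nat.mul_le_mul_right (t.time R + 5) (hs.loop g hg1 hg6)
      simp only [time]
      omega
    · have e : d ≠ r := by omega
      simp [Function.update_of_ne e, hd5, eval]
    · intro q hq
      by_cases e : q = r
      · subst e; simp [hv5]
      · simp [Function.update_of_ne e, hf5 q hq e]
    · simp [hm5]

end Term
end WordRAM


/-! ### Commands and backtracking search -/

namespace WordRAM

/-- The two states have the same variables and the same memory. -/
def State.Agrees (s s' : State) : Prop := (∀ q < 64, s'.reg q = s.reg q) ∧ s'.mem = s.mem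

/-- The program `p`, started in `s`, halts after at most `T` steps in a state satisfying `Q`. -/
def Ends (W : ℕ) (p : Program) (s : State) (T : ℕ) (Q : State → Prop) : Prop :=
  ∃ τ ≤ T, ∃ s', Runs W p s τ s' ∧ Q s'

theorem Ends.seq {W : ℕ} {p q : Program} {s : State} {T₁ T₂ : ℕ} {Q₁ Q : State → Prop}
    (h₁ : Ends W p s T₁ Q₁) (h₂ : ∀ s', Q₁ s' → Ends W q s' T₂ Q) :
    Ends W (.seq p q) s (T₁ + T₂) Q := by
  obtain ⟨τ₁, h1, s₁, hr1, hq1⟩ := h₁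
  obtain ⟨τ₂, h2, s₂, hr2, hq2⟩ := h₂ s₁ hq1
  exact ⟨_, by omega, s₂, .seq hr1 hr2, hq2⟩

theorem Ends.mono {W : ℕ} {p : Program} {s : State} {T T' : ℕ} {Q Q' : State → Prop}
    (h : Ends W p s T Q) (hT : T ≤ T') (hQ : ∀ s', Q s' → Q' s') : Ends W p s T' Q' := by
  obtain ⟨τ, h1, s₁, hr1, hq1⟩ := h
  exact ⟨τ, h1.trans hT, s₁, hr1, hQ _ hq1⟩

theorem ends_skip {W : ℕ} {s : State} {Q : State → Prop} (h : Q s) : Ends W .skip s 0 Q :=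
  ⟨0, le_rfl, s, .skip s, h⟩

/-- `reg r := t` -/
def assign (r : ℕ) (t : Term) : Program := .seq (t.compile 64) (copy r 64)

/-- `mem a := t` -/
def assignMem (a t : Term) : Program :=
  .seq (a.compile 64) (.seq (t.compile 65) (.instr (.store 64 65)))

/-- `if t ≠ 0 then p else q` -/
def cond (t : Term) (p q : Program) : Program := .seq (t.compile 64) (.ite 64 p q)

section
variable {W X R : ℕ}

/-- The term `t` can be evaluated without overflow if the variables and the memory are bounded by
`X`. -/
structure Term.Fits (W X : ℕ) (t : Term) : Prop where
  two_le : 2 ≤ X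
  wf : t.WF
  lt : X ^ t.deg < W

theorem ends_assign {r : ℕ} {t : Term} (ht : t.Fits W X) (hr : r < 64) {s : State}
    (hs : Bounded X R s) :
    Ends W (assign r t) s (t.time R + 2) (State.Agrees (s.set r (t.eval s.mem s.reg))) := by
  obtain ⟨τ, hτ, s1, h1, hv, hf, hm⟩ := Term.computes ht.two_le t ht.wf ht.lt 64 le_rfl s hs
  have h2 : Runs W (copy r 64) s1 2 _ := runs_copy s1 (by omega)
    (by rw [hv]; exact (Term.eval_le ht.two_le t ht.wf s hs).trans_lt ht.lt)
  refine ⟨_, by omega, _, .seq h1 h2, fun q hq => ?_, by simp [hm]⟩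
  by_cases e : q = r
  · subst e; simp [hv]
  · simp [Function.update_of_ne e, hf q hq]

theorem ends_assignMem {a t : Term} (ha : a.Fits W X) (ht : t.Fits W X) {s : State}
    (hs : Bounded X R s) :
    Ends W (assignMem a t) s (a.time R + t.time R + 1)
      (State.Agrees (s.poke (a.eval s.mem s.reg) (t.eval s.mem s.reg))) := by
  obtain ⟨τ, hτ, s1, h1, hv1, hf1, hm1⟩ := Term.computes ha.two_le a ha.wf ha.lt 64 le_rfl s hs
  obtain ⟨τ', hτ', s2, h2, hv2, hf2, hm2⟩ := Term.computes ht.two_le t ht.wf ht.lt 65 (by omega) s1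
    (hs.congr (fun r hr => hf1 r hr) hm1)
  refine ⟨_, ?_, _, .seq h1 (.seq h2 (runs_store s2)), fun q hq => ?_, ?_⟩
  · omega
  · simp [hf2 q (by omega), hf1 q hq]
  · have e : t.eval s1.mem s1.reg = t.eval s.mem s.reg := by
      rw [hm1]; exact Term.eval_congr _ _ ht.wf _ _ fun r hr => hf1 r hr
    simp [hm2, hm1, hv2, hf2 64 (by omega), hv1, ← e]

theorem ends_cond {t : Term} {p q : Program} (ht : t.Fits W X) {s : State} (hs : Bounded X R s)
    {T : ℕ} {Q : State → Prop}
    (h1 : t.eval s.mem s.reg ≠ 0 → ∀ s', s.Agrees s' → Ends W p s' T Q)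
    (h2 : t.eval s.mem s.reg = 0 → ∀ s', s.Agrees s' → Ends W q s' T Q) :
    Ends W (cond t p q) s (t.time R + 1 + T) Q := by
  obtain ⟨τ, hτ, s1, hr1, hv, hf, hm⟩ := Term.computes ht.two_le t ht.wf ht.lt 64 le_rfl s hs
  have hag : s.Agrees s1 := ⟨fun r hr => hf r hr, hm⟩
  by_cases e : t.eval s.mem s.reg = 0
  · obtain ⟨τ2, hτ2, s2, hr2, hq⟩ := h2 e s1 hag
    exact ⟨_, by omega, s2, .seq hr1 (.ite_false (by rw [hv, e]) hr2), hq⟩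
  · obtain ⟨τ2, hτ2, s2, hr2, hq⟩ := h1 e s1 hag
    exact ⟨_, by omega, s2, .seq hr1 (.ite_true (by rw [hv]; exact e) hr2), hq⟩

theorem Bounded.of_agrees {s s' : State} (hs : Bounded X R s) (h : s.Agrees s') :
    Bounded X R s' := hs.congr h.1 h.2

theorem Bounded.poke {s : State} (h : Bounded X R s) (a : ℕ) {v : ℕ} (hv : v ≤ X) :
    Bounded X R (s.poke a v) where
  reg := h.reg
  mem b := by
    by_cases e : b = a
    · subst e; simpa using hv
    · simpa [Function.update_of_ne e] using h.mem b
  loop := h.loop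

/-- Some iterations of a loop with test register `r` and body `p`. -/
inductive Iterates (W : ℕ) (r : ℕ) (p : Program) : State → ℕ → State → Prop where
  | refl (s : State) : Iterates W r p s 0 s
  | step {s s' s'' : State} {t u : ℕ} (hr : s.reg r ≠ 0) (hp : Runs W p s t s')
      (h : Iterates W r p s' u s'') : Iterates W r p s (t + u + 1) s''

theorem Iterates.trans {r : ℕ} {p : Program} {s s' s'' : State} {t u : ℕ}
    (h : Iterates W r p s t s') (h' : Iterates W r p s' u s'') : Iterates W r p s (t + u) s'' := by
  induction h with
  | refl s => simpa using h'
  | step hr hp _ ih =>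
    have := Iterates.step hr hp (ih h')
    convert this using 1
    omega

theorem Iterates.runs {r : ℕ} {p : Program} {s s' s'' : State} {t u : ℕ}
    (h : Iterates W r p s t s') (h' : Runs W (.while r p) s' u s'') :
    Runs W (.while r p) s (t + u) s'' := by
  induction h with
  | refl s => simpa using h'
  | step hr hp _ ih =>
    have := Runs.while_true hr hp (ih h')
    convert this using 1
    omega

open Classical in
/-- The extensions of the prefix `p` by `f` digits below `K` all whose intermediate prefixes satisfy
`Val`. -/
noncomputable def leaves (Val : List ℕ → Prop) (K : ℕ) : ℕ → List ℕ → List (List ℕ)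
  | 0, p => [p]
  | f + 1, p => (List.range K).flatMap fun x =>
      if Val (p ++ [x]) then leaves Val K f (p ++ [x]) else []

open Classical in
/-- The number of nodes that a backtracking search visits below the prefix `p`. -/
noncomputable def nodes (Val : List ℕ → Prop) (K : ℕ) : ℕ → List ℕ → ℕ
  | 0, _ => 0
  | f + 1, p => ((List.range K).map fun x =>
      1 + if Val (p ++ [x]) then nodes Val K f (p ++ [x]) else 0).sum

/-- The loop body of a backtracking search. -/
def searchBody (dep cur run L K base : ℕ) (t : Term) (leaf : Program) : Program :=
  -- If a digit below `K` is left, it is written at the current depth and tested. Otherwise the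
  -- search retreats by one level and continues after the digit stored there. At depth 0 it stops.
  cond (.sub (.reg K) (.reg cur))
    (.seq (assignMem (.add (.reg base) (.reg dep)) (.reg cur)) <|
      cond t
        (cond (.sub (.reg L) (.add (.reg dep) (.const 1)))
          (.seq (assign dep (.add (.reg dep) (.const 1))) (assign cur (.const 0)))
          (.seq leaf (assign cur (.add (.reg cur) (.const 1)))))
        (assign cur (.add (.reg cur) (.const 1))))
    (cond (.reg dep)
      (.seq (assign dep (.sub (.reg dep) (.const 1)))
        (assign cur (.add (.load (.add (.reg base) (.reg dep))) (.const 1))))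
      (assign run (.const 0)))

/-- Backtracking search over the sequences of `reg L` digits below `reg K`, kept in memory from the
cell `reg base`; `t` tests whether a prefix is to be pursued, and `leaf` is run at the leaves. -/
def backtrack (dep cur run L K base : ℕ) (t : Term) (leaf : Program) : Program :=
  .seq (assign dep (.const 0)) <| .seq (assign cur (.const 0)) <| .seq (assign run (.const 1)) <|
  .while run (searchBody dep cur run L K base t leaf)

/-- The digits `p` stand in memory from cell `b`. -/
def Holds (s : State) (b : ℕ) (p : List ℕ) : Prop := ∀ i < p.length, s.mem (b + i) = p.getD i 0

/-- The hypotheses of the correctness theorem for backtracking. -/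
structure BacktrackSpec (W X R dep cur run L K base : ℕ) (t : Term) (leaf : Program)
    (Lv Kv bv T : ℕ) (Val : List ℕ → Prop) (Inv : List (List ℕ) → State → Prop) : Prop where
  -- The fixed terms of the loop body have degree at most 4.
  large : X ^ (t.deg + 4) < W
  two_le : 2 ≤ X
  wf : t.WF
  regs : (∀ q ∈ [dep, cur, run, L, K, base], q < 64) ∧ (∀ q ∈ [dep, cur, run], 7 ≤ q) ∧
    [dep, cur, run, L, K, base].Nodup
  len_pos : 1 ≤ Lv
  len_le : Lv ≤ X
  digit_le : Kv ≤ X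
  bounded : ∀ D s, Inv D s → Bounded X R s ∧ s.reg L = Lv ∧ s.reg K = Kv ∧ s.reg base = bv
  -- The invariant has to survive the bookkeeping of the search, so it may depend neither on the
  -- three control registers nor on the cells of the digits.
  stable : ∀ D s s', Inv D s →
    (∀ q < 64, q ≠ dep → q ≠ cur → q ≠ run → s'.reg q = s.reg q) →
    (∀ a, a < bv ∨ bv + Lv ≤ a → s'.mem a = s.mem a) → Bounded X R s' → Inv D s'
  test : ∀ D s p, Inv D s → Holds s bv p → p.length = s.reg dep + 1 → p.length ≤ Lv →
    (t.eval s.mem s.reg ≠ 0 ↔ Val p)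
  leaf : ∀ D s p, Inv D s → Holds s bv p → p.length = Lv → Val p →
    Ends W leaf s T fun s' => Inv (D ++ [p]) s' ∧ Holds s' bv p ∧ s'.reg dep = s.reg dep ∧
      s'.reg cur = s.reg cur ∧ s'.reg run = s.reg run

/-- The situation during a backtracking search: the leaves `D` have been processed, the digits `p`
are in memory, and the depth and the current digit are `d` and `x`. -/
structure AtNode (dep cur run bv : ℕ) (Inv : List (List ℕ) → State → Prop) (D : List (List ℕ))
    (p : List ℕ) (d x : ℕ) (s : State) : Prop where
  inv : Inv D s
  dep_eq : s.reg dep = d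
  cur_eq : s.reg cur = x
  run_eq : s.reg run = 1
  holds : Holds s bv p

/-! ### Correctness and running time of backtracking. -/

namespace BacktrackSpec

variable {dep cur run L K base : ℕ} {t : Term} {leaf : Program} {Lv Kv bv T : ℕ}
  {Val : List ℕ → Prop} {Inv : List (List ℕ) → State → Prop}
  (h : BacktrackSpec W X R dep cur run L K base t leaf Lv Kv bv T Val Inv)
include h

omit h in
theorem holds_congr {s s' : State} {p : List ℕ} (hp : Holds s bv p) (hm : s'.mem = s.mem) :
    Holds s' bv p := fun i hi => by rw [hm]; exact hp i hi

theorem fits {u : Term} (hu : u.WF) (hd : u.deg ≤ t.deg + 4) : u.Fits W X :=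
  ⟨h.two_le, hu, (Nat.pow_le_pow_right (by have := h.two_le; omega) hd).trans_lt h.large⟩

theorem inv_congr {D : List (List ℕ)} {s s' : State} (hs : Inv D s)
    (hr : ∀ q < 64, q ≠ dep → q ≠ cur → q ≠ run → s'.reg q = s.reg q) (hm : s'.mem = s.mem)
    (hb : Bounded X R s') : Inv D s' :=
  h.stable D s s' hs hr (fun a _ => by rw [hm]) hb

theorem atNode_agrees {D : List (List ℕ)} {p : List ℕ} {d x : ℕ} {s s' : State}
    (hs : AtNode dep cur run bv Inv D p d x s) (ha : s.Agrees s') :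
    AtNode dep cur run bv Inv D p d x s' := by
  obtain ⟨hr1, -, -⟩ := h.regs
  simp only [List.mem_cons, List.not_mem_nil, or_false, forall_eq_or_imp, forall_eq] at hr1
  refine ⟨h.inv_congr hs.inv (fun q hq _ _ _ => ha.1 q hq) ha.2
    ((h.bounded D s hs.inv).1.of_agrees ha), ?_, ?_, ?_, holds_congr hs.holds ha.2⟩
  · rw [ha.1 _ hr1.1, hs.dep_eq]
  · rw [ha.1 _ hr1.2.1, hs.cur_eq]
  · rw [ha.1 _ hr1.2.2.1, hs.run_eq]

theorem bounded_atNode {D : List (List ℕ)} {p : List ℕ} {d x : ℕ} {s : State}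
    (hs : AtNode dep cur run bv Inv D p d x s) : Bounded X R s := (h.bounded D s hs.inv).1

theorem ends_assign_dep {D : List (List ℕ)} {p : List ℕ} {d x : ℕ} {s : State} {u : Term}
    (hu : u.WF) (hd : u.deg ≤ t.deg + 4)
    (hs : AtNode dep cur run bv Inv D p d x s) (hv : u.eval s.mem s.reg ≤ X) :
    Ends W (assign dep u) s (u.time R + 2)
      (AtNode dep cur run bv Inv D p (u.eval s.mem s.reg) x) := by
  obtain ⟨hr1, hr2, hr3⟩ := h.regs
  simp only [List.mem_cons, List.not_mem_nil, or_false, forall_eq_or_imp, forall_eq] at hr1 hr2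
  simp only [List.nodup_cons, List.mem_cons, List.not_mem_nil, or_false, not_or] at hr3
  have hb := h.bounded_atNode hs
  refine (ends_assign (h.fits hu hd) hr1.1 hb).mono le_rfl fun s' ha => ?_
  refine h.atNode_agrees (s := s.set dep (u.eval s.mem s.reg)) ⟨?_, ?_, ?_, ?_, ?_⟩ ha
  · refine h.inv_congr hs.inv (fun q _ e _ _ => ?_) rfl (hb.set hr2.1 hv)
    simp [Function.update_of_ne e]
  · simp
  · simpa [Function.update_of_ne (Ne.symm hr3.1.1)] using hs.cur_eq
  · simpa [Function.update_of_ne (Ne.symm hr3.1.2.1)] using hs.run_eq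
  · exact holds_congr hs.holds rfl

theorem ends_assign_cur {D : List (List ℕ)} {p : List ℕ} {d x : ℕ} {s : State} {u : Term}
    (hu : u.WF) (hd : u.deg ≤ t.deg + 4)
    (hs : AtNode dep cur run bv Inv D p d x s) (hv : u.eval s.mem s.reg ≤ X) :
    Ends W (assign cur u) s (u.time R + 2)
      (AtNode dep cur run bv Inv D p d (u.eval s.mem s.reg)) := by
  obtain ⟨hr1, hr2, hr3⟩ := h.regs
  simp only [List.mem_cons, List.not_mem_nil, or_false, forall_eq_or_imp, forall_eq] at hr1 hr2
  simp only [List.nodup_cons, List.mem_cons, List.not_mem_nil, or_false, not_or] at hr3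
  have hb := h.bounded_atNode hs
  refine (ends_assign (h.fits hu hd) hr1.2.1 hb).mono le_rfl fun s' ha => ?_
  refine h.atNode_agrees (s := s.set cur (u.eval s.mem s.reg)) ⟨?_, ?_, ?_, ?_, ?_⟩ ha
  · refine h.inv_congr hs.inv (fun q _ _ e _ => ?_) rfl (hb.set hr2.2.1 hv)
    simp [Function.update_of_ne e]
  · simpa [Function.update_of_ne hr3.1.1] using hs.dep_eq
  · simp
  · simpa [Function.update_of_ne (Ne.symm hr3.2.1.1)] using hs.run_eq
  · exact holds_congr hs.holds rfl

theorem ends_assign_run {D : List (List ℕ)} {s : State} {v : ℕ} (hv1 : v ≤ 1) (hs : Inv D s) :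
    Ends W (assign run (.const v)) s 3
      (fun s' => Inv D s' ∧ s'.reg run = v ∧ s'.reg dep = s.reg dep ∧ s'.reg cur = s.reg cur) := by
  obtain ⟨hr1, hr2, hr3⟩ := h.regs
  simp only [List.mem_cons, List.not_mem_nil, or_false, forall_eq_or_imp, forall_eq] at hr1 hr2
  simp only [List.nodup_cons, List.mem_cons, List.not_mem_nil, or_false, not_or] at hr3
  have hb := (h.bounded D s hs).1
  have hX := h.two_le
  refine (ends_assign (h.fits (u := .const v) rfl (by simp [Term.deg]; omega)) hr1.2.2.1 hb).mono
    le_rfl fun s' ha => ⟨?_, ?_, ?_, ?_⟩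
  · refine h.inv_congr hs (fun q hq _ _ e => ?_) (by rw [ha.2]; rfl)
      ((hb.set (r := run) hr2.2.2 (v := v) (by omega)).of_agrees ha)
    rw [ha.1 q hq]
    simp [Function.update_of_ne e]
  · rw [ha.1 _ hr1.2.2.1]; simp [Term.eval]
  · rw [ha.1 _ hr1.1]; simp [Function.update_of_ne hr3.1.2.1]
  · rw [ha.1 _ hr1.2.1]; simp [Function.update_of_ne hr3.2.1.1]

theorem ends_write_digit {D : List (List ℕ)} {p : List ℕ} {x : ℕ} {s : State}
    (hs : AtNode dep cur run bv Inv D p p.length x s) (hx : x < Kv) (hp : p.length < Lv) :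
    Ends W (assignMem (.add (.reg base) (.reg dep)) (.reg cur)) s 8
      (AtNode dep cur run bv Inv D (p ++ [x]) p.length x) := by
  obtain ⟨hr1, hr2, hr3⟩ := h.regs
  simp only [List.mem_cons, List.not_mem_nil, or_false, forall_eq_or_imp, forall_eq] at hr1 hr2
  have hb := h.bounded_atNode hs
  have hxX : x ≤ X := hx.le.trans h.digit_le
  obtain ⟨-, -, -, hbase⟩ := h.bounded D s hs.inv
  have hdeg := t.deg_pos
  refine (ends_assignMem (h.fits (u := .add (.reg base) (.reg dep))
    (by simp [Term.WF, hr1]) (by simp [Term.deg]))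
    (h.fits (u := .reg cur) (by simp [Term.WF, hr1]) (by simp [Term.deg])) hb).mono
    (by simp [Term.time]) fun s' ha => ?_
  refine h.atNode_agrees (s := s.poke (bv + p.length) x) ⟨?_, ?_, ?_, ?_, ?_⟩
    (by simpa [Term.eval, hbase, hs.dep_eq, hs.cur_eq] using ha)
  · refine h.stable D s _ hs.inv (fun q _ _ _ _ => rfl) (fun a ha => ?_) (hb.poke _ hxX)
    have e : a ≠ bv + p.length := by omega
    simp [Function.update_of_ne e]
  · exact hs.dep_eq
  · exact hs.cur_eq
  · exact hs.run_eq
  · intro i hi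
    simp only [List.length_append, List.length_cons, List.length_nil] at hi
    by_cases e : i = p.length
    · subst e; simp
    · have e' : bv + i ≠ bv + p.length := by omega
      have hi' : i < p.length := by omega
      simp only [State.poke_mem, Function.update_of_ne e']
      rw [hs.holds i hi']
      simp [List.getD, List.getElem?_append_left hi']

/-- The bound on the time of one iteration (without the time of `leaf`). -/
theorem ends_try {D : List (List ℕ)} {p : List ℕ} {x : ℕ} {s : State}
    (hs : AtNode dep cur run bv Inv D p p.length x s) (hx : x < Kv) (hp : p.length < Lv) :
    Ends W (searchBody dep cur run L K base t leaf) s (t.time R + 60 + T) (fun s' =>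
      (¬ Val (p ++ [x]) → AtNode dep cur run bv Inv D p p.length (x + 1) s') ∧
      (Val (p ++ [x]) → p.length + 1 = Lv →
        AtNode dep cur run bv Inv (D ++ [p ++ [x]]) p p.length (x + 1) s') ∧
      (Val (p ++ [x]) → p.length + 1 < Lv →
        AtNode dep cur run bv Inv D (p ++ [x]) (p.length + 1) 0 s')) := by
  obtain ⟨hr1, hr2, hr3⟩ := h.regs
  simp only [List.mem_cons, List.not_mem_nil, or_false, forall_eq_or_imp, forall_eq] at hr1 hr2
  obtain ⟨hb, -, hK, -⟩ := h.bounded D s hs.inv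
  have hdeg := t.deg_pos
  have hX := h.two_le
  have hLX := h.len_le
  have hKX := h.digit_le
  have cut : ∀ {D : List (List ℕ)} {d y : ℕ} {s : State},
      AtNode dep cur run bv Inv D (p ++ [x]) d y s → AtNode dep cur run bv Inv D p d y s := by
    intro D d y s hs
    refine ⟨hs.inv, hs.dep_eq, hs.cur_eq, hs.run_eq, fun i hi => ?_⟩
    rw [hs.holds i (by simp; omega)]
    simp [List.getD, List.getElem?_append_left hi]
  have incr : ∀ {D : List (List ℕ)} {s : State}, AtNode dep cur run bv Inv D (p ++ [x]) p.length x s →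
      Ends W (assign cur (.add (.reg cur) (.const 1))) s 6
        (AtNode dep cur run bv Inv D p p.length (x + 1)) := by
    intro D s hs
    have he : Term.eval s.mem (.add (.reg cur) (.const 1)) s.reg = x + 1 := by
      simp [Term.eval, hs.cur_eq]
    refine (h.ends_assign_cur (u := .add (.reg cur) (.const 1)) (by simp [Term.WF, hr1])
      (by simp [Term.deg]) hs (by rw [he]; omega)).mono (by simp [Term.time])
      fun s' hs' => ?_
    rw [he] at hs'
    exact cut hs'
  refine (ends_cond (T := t.time R + 40 + T) (h.fits (u := .sub (.reg K) (.reg cur))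
    (by simp [Term.WF, hr1]) (by simp [Term.deg])) hb (fun _ s1 ha1 => ?_)
    (fun h0 => ?_)).mono (by simp [Term.time]; omega) fun _ hQ => hQ
  · refine ((h.ends_write_digit (h.atNode_agrees hs ha1) hx hp).seq (T₂ := t.time R + 32 + T)
      fun s2 hs2 => ?_).mono (by omega) fun _ hQ => hQ
    have htest := h.test D s2 (p ++ [x]) hs2.inv hs2.holds (by simp [hs2.dep_eq]) (by simp; omega)
    refine (ends_cond (T := 31 + T) (h.fits h.wf (by omega)) (h.bounded_atNode hs2)
      (fun h1 s3 ha3 => ?_) (fun h1 s3 ha3 => ?_)).mono (by omega) fun _ hQ => hQ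
    · have hval := htest.1 h1
      have hs3 := h.atNode_agrees hs2 ha3
      obtain ⟨hb3, hL3, -, -⟩ := h.bounded D s3 hs3.inv
      have he : Term.eval s3.mem (.sub (.reg L) (.add (.reg dep) (.const 1))) s3.reg =
          Lv - (p.length + 1) := by simp [Term.eval, hL3, hs3.dep_eq]
      refine (ends_cond (T := 22 + T) (h.fits (u := .sub (.reg L) (.add (.reg dep) (.const 1)))
        (by simp [Term.WF, hr1]) (by simp [Term.deg])) hb3 (fun h2 s4 ha4 => ?_)
        (fun h2 s4 ha4 => ?_)).mono (by simp [Term.time]; omega) fun _ hQ => hQ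
      · have hs4 := h.atNode_agrees hs3 ha4
        have he4 : Term.eval s4.mem (.add (.reg dep) (.const 1)) s4.reg = p.length + 1 := by
          simp [Term.eval, hs4.dep_eq]
        refine ((h.ends_assign_dep (u := .add (.reg dep) (.const 1)) (by simp [Term.WF, hr1])
          (by simp [Term.deg]) hs4 (by rw [he4]; omega)).seq (T₂ := 3)
          fun s5 hs5 => ?_).mono (by simp [Term.time]; omega) fun _ hQ => hQ
        rw [he4] at hs5
        refine (h.ends_assign_cur (u := .const 0) rfl (by simp [Term.deg]) hs5
          (by simp [Term.eval])).mono (by simp [Term.time]) fun s6 hs6 => ?_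
        exact ⟨fun hv => absurd hval hv, fun _ hl => absurd h2 (by rw [he]; omega),
          fun _ _ => hs6⟩
      · have hs4 := h.atNode_agrees hs3 ha4
        have hl : p.length + 1 = Lv := by rw [he] at h2; omega
        refine ((h.leaf D s4 (p ++ [x]) hs4.inv hs4.holds (by simpa using hl) hval).seq (T₂ := 6)
          fun s5 hs5 => ?_).mono (by omega) fun _ hQ => hQ
        obtain ⟨hi5, hh5, hd5, hc5, hrn5⟩ := hs5
        refine (incr ⟨hi5, by rw [hd5, hs4.dep_eq], by rw [hc5, hs4.cur_eq],
          by rw [hrn5, hs4.run_eq], hh5⟩).mono le_rfl fun s6 hs6 => ?_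
        exact ⟨fun hv => absurd hval hv, fun _ _ => hs6, fun _ hl' => by omega⟩
    · have hval : ¬ Val (p ++ [x]) := fun hv => htest.2 hv h1
      refine (incr (h.atNode_agrees hs2 ha3)).mono (by omega) fun s6 hs6 => ?_
      exact ⟨fun _ => hs6, fun hv => absurd hv hval, fun hv => absurd hv hval⟩
  · simp [Term.eval, hK, hs.cur_eq] at h0
    omega

/-- When the digits below `p ++ [x]` are exhausted, the cell at depth `p.length` still contains `x`.
The search reads it back and resumes with `x + 1`. -/
theorem ends_pop {D : List (List ℕ)} {p : List ℕ} {x : ℕ} {s : State}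
    (hs : AtNode dep cur run bv Inv D (p ++ [x]) (p.length + 1) Kv s) (hx : x < Kv) :
    Ends W (searchBody dep cur run L K base t leaf) s (t.time R + 60)
      (AtNode dep cur run bv Inv D p p.length (x + 1)) := by
  obtain ⟨hr1, hr2, hr3⟩ := h.regs
  simp only [List.mem_cons, List.not_mem_nil, or_false, forall_eq_or_imp, forall_eq] at hr1 hr2
  have hdeg := t.deg_pos
  have hX := h.two_le
  have hKX := h.digit_le
  obtain ⟨hb, -, hK, -⟩ := h.bounded D s hs.inv
  refine (ends_cond (T := 40) (h.fits (u := .sub (.reg K) (.reg cur))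
    (by simp [Term.WF, hr1]) (by simp [Term.deg])) hb (fun h0 => ?_)
    (fun _ s1 ha1 => ?_)).mono (by simp [Term.time]) fun _ hQ => hQ
  · simp [Term.eval, hK, hs.cur_eq] at h0
  have hs1 := h.atNode_agrees hs ha1
  refine (ends_cond (T := 30) (h.fits (u := .reg dep)
    (by simp [Term.WF, hr1]) (by simp [Term.deg])) (h.bounded_atNode hs1)
    (fun _ s2 ha2 => ?_) (fun h0 => ?_)).mono (by simp [Term.time]) fun _ hQ => hQ
  · have hs2 := h.atNode_agrees hs1 ha2
    have he2 : Term.eval s2.mem (.sub (.reg dep) (.const 1)) s2.reg = p.length := by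
      simp [Term.eval, hs2.dep_eq]
    have hdX := (h.bounded_atNode hs2).reg dep hr1.1
    rw [hs2.dep_eq] at hdX
    refine ((h.ends_assign_dep (u := .sub (.reg dep) (.const 1)) (by simp [Term.WF, hr1])
      (by simp [Term.deg]) hs2 (by rw [he2]; omega)).seq (T₂ := 10)
      fun s3 hs3 => ?_).mono (by simp [Term.time]) fun _ hQ => hQ
    rw [he2] at hs3
    obtain ⟨-, -, -, hbase⟩ := h.bounded D s3 hs3.inv
    have he3 : Term.eval s3.mem (.add (.load (.add (.reg base) (.reg dep))) (.const 1)) s3.reg =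
        x + 1 := by
      simp only [Term.eval, hbase, hs3.dep_eq]
      rw [hs3.holds _ (by simp)]
      simp
    refine (h.ends_assign_cur (u := .add (.load (.add (.reg base) (.reg dep))) (.const 1))
      (by simp [Term.WF, hr1]) (by simp [Term.deg]) hs3 (by rw [he3]; omega)).mono
      (by simp [Term.time]) fun s4 hs4 => ?_
    rw [he3] at hs4
    refine ⟨hs4.inv, hs4.dep_eq, hs4.cur_eq, hs4.run_eq, fun i hi => ?_⟩
    rw [hs4.holds i (by simp; omega)]
    simp [List.getD, List.getElem?_append_left hi]
  · simp [Term.eval, hs1.dep_eq] at h0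

theorem ends_finish {D : List (List ℕ)} {s : State}
    (hs : AtNode dep cur run bv Inv D [] 0 Kv s) :
    Ends W (searchBody dep cur run L K base t leaf) s (t.time R + 60)
      (fun s' => Inv D s' ∧ s'.reg run = 0) := by
  obtain ⟨hr1, hr2, hr3⟩ := h.regs
  simp only [List.mem_cons, List.not_mem_nil, or_false, forall_eq_or_imp, forall_eq] at hr1 hr2
  have hdeg := t.deg_pos
  obtain ⟨hb, -, hK, -⟩ := h.bounded D s hs.inv
  refine (ends_cond (T := 40) (h.fits (u := .sub (.reg K) (.reg cur))
    (by simp [Term.WF, hr1]) (by simp [Term.deg])) hb (fun h0 => ?_)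
    (fun _ s1 ha1 => ?_)).mono (by simp [Term.time]) fun _ hQ => hQ
  · simp [Term.eval, hK, hs.cur_eq] at h0
  have hs1 := h.atNode_agrees hs ha1
  refine (ends_cond (T := 30) (h.fits (u := .reg dep)
    (by simp [Term.WF, hr1]) (by simp [Term.deg])) (h.bounded_atNode hs1)
    (fun h0 => ?_) (fun _ s2 ha2 => ?_)).mono (by simp [Term.time]) fun _ hQ => hQ
  · simp [Term.eval, hs1.dep_eq] at h0
  · have hs2 := h.atNode_agrees hs1 ha2
    exact (h.ends_assign_run (v := 0) (by omega) hs2.inv).mono (by omega)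
      fun s3 hs3 => ⟨hs3.1, hs3.2.1⟩

/-- Exploring the tree below a node. -/
theorem explore (f : ℕ) : ∀ (p : List ℕ) (D : List (List ℕ)), p.length + (f + 1) = Lv →
    ∀ s, AtNode dep cur run bv Inv D p p.length 0 s →
    ∃ τ ≤ nodes Val Kv (f + 1) p * (2 * t.time R + 122 + T), ∃ s',
      Iterates W run (searchBody dep cur run L K base t leaf) s τ s' ∧
      AtNode dep cur run bv Inv (D ++ leaves Val Kv (f + 1) p) p p.length Kv s' := by
  classical
  -- A node is charged for one attempt and at most one retreat: each takes `t.time R + 60` steps and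
  -- one loop test, and a leaf takes `T` more.
  set C := 2 * t.time R + 122 + T with hC
  induction f with
  | zero =>
    intro p D hp s hs
    -- Induction on the number `y` of digits that have been tried at this node.
    have key : ∀ y ≤ Kv, ∃ τ ≤ ((List.range y).map fun x =>
        1 + if Val (p ++ [x]) then nodes Val Kv 0 (p ++ [x]) else 0).sum * C, ∃ s',
        Iterates W run (searchBody dep cur run L K base t leaf) s τ s' ∧
        AtNode dep cur run bv Inv (D ++ (List.range y).flatMap fun x =>
          if Val (p ++ [x]) then leaves Val Kv 0 (p ++ [x]) else []) p p.length y s' := by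
      intro y
      induction y with
      | zero => exact fun _ => ⟨0, by simp, s, .refl s, by simpa using hs⟩
      | succ y ih =>
        intro hy
        obtain ⟨τ, hτ, s1, hi1, hs1⟩ := ih (by omega)
        obtain ⟨τ2, hτ2, s2, hr2, hv2, hl2, -⟩ := h.ends_try hs1 (by omega) (by omega)
        refine ⟨τ + (τ2 + 0 + 1), ?_, s2, hi1.trans (.step (by rw [hs1.run_eq]; omega) hr2
          (.refl _)), ?_⟩
        · rw [List.range_succ, List.map_append, List.sum_append]
          simp only [List.map_cons, List.map_nil, List.sum_cons, List.sum_nil, add_zero, add_mul]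
          omega
        · rw [List.range_succ, List.flatMap_append, ← List.append_assoc]
          by_cases hv : Val (p ++ [y])
          · simpa [hv, leaves] using hl2 hv (by omega)
          · simpa [hv] using hv2 hv
    exact key Kv le_rfl
  | succ f ihf =>
    intro p D hp s hs
    have key : ∀ y ≤ Kv, ∃ τ ≤ ((List.range y).map fun x =>
        1 + if Val (p ++ [x]) then nodes Val Kv (f + 1) (p ++ [x]) else 0).sum * C, ∃ s',
        Iterates W run (searchBody dep cur run L K base t leaf) s τ s' ∧
        AtNode dep cur run bv Inv (D ++ (List.range y).flatMap fun x =>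
          if Val (p ++ [x]) then leaves Val Kv (f + 1) (p ++ [x]) else []) p p.length y s' := by
      intro y
      induction y with
      | zero => exact fun _ => ⟨0, by simp, s, .refl s, by simpa using hs⟩
      | succ y ih =>
        intro hy
        obtain ⟨τ, hτ, s1, hi1, hs1⟩ := ih (by omega)
        obtain ⟨τ2, hτ2, s2, hr2, hv2, -, hd2⟩ := h.ends_try hs1 (by omega) (by omega)
        have hit := hi1.trans (.step (by rw [hs1.run_eq]; omega) hr2 (.refl _))
        rw [List.range_succ, List.map_append, List.sum_append, List.flatMap_append,
          ← List.append_assoc]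
        simp only [List.map_cons, List.map_nil, List.sum_cons, List.sum_nil, add_zero, add_mul,
          List.flatMap_cons, List.flatMap_nil, List.append_nil, one_mul]
        by_cases hv : Val (p ++ [y])
        · simp only [hv, if_true]
          obtain ⟨τ3, hτ3, s3, hi3, hs3⟩ := ihf (p ++ [y]) _ (by simp; omega) s2
            (by simpa using hd2 hv (by omega))
          obtain ⟨τ4, hτ4, s4, hr4, hs4⟩ := h.ends_pop (by simpa using hs3) (by omega : y < Kv)
          exact ⟨_, by omega, s4, (hit.trans hi3).trans (.step (by rw [hs3.run_eq]; omega) hr4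
            (.refl _)), by rw [List.append_assoc]; exact hs4⟩
        · simp only [hv, if_false, List.append_nil]
          exact ⟨_, by omega, s2, hit, hv2 hv⟩
    exact key Kv le_rfl

/-- Backtracking processes all the leaves. -/
theorem ends_backtrack {D : List (List ℕ)} {s : State} (hs : Inv D s) :
    Ends W (backtrack dep cur run L K base t leaf) s
      ((nodes Val Kv Lv [] + 1) * (2 * t.time R + 122 + T))
      (Inv (D ++ leaves Val Kv Lv [])) := by
  obtain ⟨hr1, hr2, hr3⟩ := h.regs
  simp only [List.mem_cons, List.not_mem_nil, or_false, forall_eq_or_imp, forall_eq] at hr1 hr2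
  simp only [List.nodup_cons, List.mem_cons, List.not_mem_nil, or_false, not_or] at hr3
  have hdeg := t.deg_pos
  have hX := h.two_le
  have hb := (h.bounded D s hs).1
  have hf0 : (Term.const 0).Fits W X := h.fits rfl (by simp [Term.deg])
  have set_inv : ∀ {s s' : State} (r : ℕ), r = dep ∨ r = cur → Inv D s →
      (s.set r 0).Agrees s' → Inv D s' := by
    intro s s' r hr hs ha
    refine h.inv_congr hs (fun q hq e1 e2 _ => ?_) (by rw [ha.2]; rfl)
      (((h.bounded D s hs).1.set (r := r) (by rcases hr with rfl | rfl <;> omega)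
        (Nat.zero_le X)).of_agrees ha)
    have e : q ≠ r := by rcases hr with rfl | rfl <;> assumption
    rw [ha.1 q hq]
    simp [Function.update_of_ne e]
  have main : Ends W (backtrack dep cur run L K base t leaf) s
      (3 + (3 + (3 + (nodes Val Kv Lv [] * (2 * t.time R + 122 + T) + (t.time R + 62)))))
      (Inv (D ++ leaves Val Kv Lv [])) := by
    refine (ends_assign hf0 hr1.1 hb).seq fun s1 ha1 => ?_
    have hi1 := set_inv dep (.inl rfl) hs ha1
    have hd1 : s1.reg dep = 0 := by rw [ha1.1 _ hr1.1]; simp [Term.eval]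
    refine (ends_assign hf0 hr1.2.1 (h.bounded D s1 hi1).1).seq fun s2 ha2 => ?_
    have hi2 := set_inv cur (.inr rfl) hi1 ha2
    have hd2 : s2.reg dep = 0 := by
      rw [ha2.1 _ hr1.1]; simp [Function.update_of_ne hr3.1.1, hd1]
    have hc2 : s2.reg cur = 0 := by rw [ha2.1 _ hr1.2.1]; simp [Term.eval]
    refine (h.ends_assign_run (v := 1) le_rfl hi2).seq fun s3 hs3 => ?_
    obtain ⟨hi3, hrun3, hd3, hc3⟩ := hs3
    have hn3 : AtNode dep cur run bv Inv D [] ([] : List ℕ).length 0 s3 :=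
      ⟨hi3, by rw [hd3, hd2]; rfl, by rw [hc3, hc2], hrun3, fun i hi => by simp at hi⟩
    obtain ⟨f, hf⟩ : ∃ f, Lv = f + 1 := ⟨Lv - 1, by have := h.len_pos; omega⟩
    obtain ⟨τ4, hτ4, s4, hi4, hs4⟩ := h.explore f [] D (by simp [hf]) s3 hn3
    obtain ⟨τ5, hτ5, s5, hr5, hi5, hz5⟩ := h.ends_finish hs4
    refine ⟨τ4 + (τ5 + 1 + 1), by rw [hf]; omega, s5, hi4.runs (.while_true ?_ hr5
      (.while_false hz5)), by rw [hf]; exact hi5⟩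
    rw [hs4.run_eq]; omega
  refine main.mono ?_ fun _ hQ => hQ
  rw [add_mul]
  omega

end BacktrackSpec

end

/-! ### Counting the nodes of a search tree. -/

theorem sum_map_range (K : ℕ) (g : ℕ → ℕ) :
    ((List.range K).map g).sum = ∑ x ∈ Finset.range K, g x := by
  induction K with
  | zero => simp
  | succ K ih => simp [List.range_succ, Finset.sum_range_succ, ih]

open Classical in
theorem length_leaves_succ (Val : List ℕ → Prop) (K f : ℕ) (p : List ℕ) :
    (leaves Val K (f + 1) p).length =
      ∑ x ∈ Finset.range K, if Val (p ++ [x]) then (leaves Val K f (p ++ [x])).length else 0 := by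
  rw [leaves, List.length_flatMap, sum_map_range]
  exact Finset.sum_congr rfl fun x _ => by split_ifs <;> rfl

/-- Each surviving prefix on a level below `f` is expanded once, by trying `K` digits. The last
level is not expanded, which later saves a factor of the alphabet size. -/
theorem nodes_eq (Val : List ℕ → Prop) (K f : ℕ) (p : List ℕ) :
    nodes Val K f p = K * ∑ i ∈ Finset.range f, (leaves Val K i p).length := by
  classical
  induction f generalizing p with
  | zero => simp [nodes]
  | succ f ih =>
    rw [nodes, sum_map_range, Finset.sum_range_succ']
    simp only [length_leaves_succ, show (leaves Val K 0 p).length = 1 from rfl]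
    rw [Finset.sum_comm (s := Finset.range f), Finset.sum_add_distrib, mul_add, Finset.mul_sum, add_comm]
    simp only [Finset.sum_const, Finset.card_range, smul_eq_mul, mul_one]
    congr 1
    refine Finset.sum_congr rfl fun x _ => ?_
    split_ifs with hv
    · rw [ih, Finset.mul_sum]
    · simp

theorem mem_leaves {Val : List ℕ → Prop} {K f : ℕ} {p q : List ℕ} :
    q ∈ leaves Val K f p ↔ p <+: q ∧ q.length = p.length + f ∧
      (∀ i, p.length < i → i ≤ q.length → Val (q.take i)) ∧ ∀ x ∈ q.drop p.length, x < K := by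
  classical
  induction f generalizing p with
  | zero =>
    simp only [leaves, List.mem_singleton, add_zero]
    constructor
    · rintro rfl
      exact ⟨List.prefix_rfl, rfl, fun i h1 h2 => by omega, by simp⟩
    · rintro ⟨h1, h2, -, -⟩
      exact (h1.eq_of_length h2.symm).symm
  | succ f ih =>
    simp only [leaves, List.mem_flatMap, List.mem_range]
    constructor
    · rintro ⟨x, hx, hq⟩
      split_ifs at hq with hv
      · obtain ⟨⟨u, rfl⟩, h2, h3, h4⟩ := ih.1 hq
        refine ⟨⟨x :: u, by simp⟩, by simp at h2 ⊢; omega, fun i h5 h6 => ?_, ?_⟩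
        · by_cases e : i = p.length + 1
          · subst e
            rw [List.take_append_of_le_length (by simp)]
            rwa [List.take_of_length_le (by simp)]
          · exact h3 i (by simp; omega) h6
        · intro y hy
          simp only [List.append_assoc, List.cons_append, List.nil_append, List.drop_left,
            List.mem_cons] at hy
          rcases hy with rfl | hy
          · exact hx
          · exact h4 y (by rw [List.drop_left]; exact hy)
      · simp at hq
    · rintro ⟨⟨u, rfl⟩, h2, h3, h4⟩
      rcases u with - | ⟨x, u⟩
      · simp at h2
      · have hx : x < K := h4 x (by simp)
        have hv : Val (p ++ [x]) := by
          have := h3 (p.length + 1) (by omega) (by simp)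
          rw [List.take_append, List.take_of_length_le (by omega)] at this
          simpa using this
        refine ⟨x, hx, ?_⟩
        rw [if_pos hv]
        refine ih.2 ⟨⟨u, by simp⟩, by simp at h2 ⊢; omega, fun i h5 h6 => h3 i (by simp at h5; omega) h6,
          fun y hy => h4 y ?_⟩
        have : p ++ x :: u = (p ++ [x]) ++ u := by simp
        rw [this, List.drop_left] at hy
        simp [hy]

theorem nodup_leaves (Val : List ℕ → Prop) (K f : ℕ) (p : List ℕ) : (leaves Val K f p).Nodup := by
  classical
  induction f generalizing p with
  | zero => simp [leaves]
  | succ f ih =>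
    rw [leaves, List.nodup_flatMap]
    refine ⟨fun x _ => ?_, List.nodup_range.imp fun {x y} hxy => ?_⟩
    · split_ifs
      · exact ih _
      · exact List.nodup_nil
    · intro q hq1 hq2
      simp only at hq1 hq2
      have e1 : p ++ [x] <+: q := by
        by_cases hv : Val (p ++ [x])
        · rw [if_pos hv] at hq1; exact (mem_leaves.1 hq1).1
        · simp [hv] at hq1
      have e2 : p ++ [y] <+: q := by
        by_cases hv : Val (p ++ [y])
        · rw [if_pos hv] at hq2; exact (mem_leaves.1 hq2).1
        · simp [hv] at hq2
      obtain ⟨u, hu⟩ := e1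
      obtain ⟨w, hw⟩ := e2
      rw [← hw] at hu
      simp at hu
      exact hxy hu.1

end WordRAM


/-! ### Shearer's inequality, hashing, and largest subsets -/

namespace ColumnOutliers

open Finset

/-! ### Shearer's inequality by induction on the coordinates. -/

section Shearer

variable {ι κ α : Type*} [DecidableEq ι] [DecidableEq α]

/-- The restriction of `f` to the coordinates in `T`. -/
def proj (T : Finset ι) (f : ι → α) : ι → Option α := fun x => if x ∈ T then some (f x) else none

open Classical in
/-- **Shearer's inequality** for a fractional cover `p` of the coordinates in `A`. -/
theorem shearer (I : Finset κ) (T : κ → Finset ι) (p : κ → ℝ) (hp : ∀ i ∈ I, 0 ≤ p i)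
    (A : Finset ι) (hcov : ∀ a ∈ A, 1 ≤ ∑ i ∈ I with a ∈ T i, p i) (S : Finset (ι → α))
    (hS : ∀ f ∈ S, ∀ g ∈ S, ∀ x ∉ A, f x = g x) :
    (#S : ℝ) ≤ ∏ i ∈ I, (#(S.image (proj (T i))) : ℝ) ^ p i := by
  induction A using Finset.induction_on generalizing S with
  | empty =>
    rcases S.eq_empty_or_nonempty with rfl | hne
    · simp only [card_empty, Nat.cast_zero]
      exact prod_nonneg fun i _ => Real.rpow_nonneg (Nat.cast_nonneg _) _
    · have h1 : #S ≤ 1 := card_le_one.2 fun f hf g hg => funext fun x => hS f hf g hg x (by simp)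
      refine (Nat.cast_le_one.2 h1).trans ?_
      have := prod_le_prod (s := I) (f := fun _ => (1 : ℝ))
        (g := fun i => (#(S.image (proj (T i))) : ℝ) ^ p i) (fun _ _ => zero_le_one)
        (fun i hi => Real.one_le_rpow (by exact_mod_cast (hne.image _).card_pos) (hp i hi))
      simpa using this
  | insert a A ha ih =>
    rcases S.eq_empty_or_nonempty with rfl | hne
    · simp only [card_empty, Nat.cast_zero]
      exact prod_nonneg fun i _ => Real.rpow_nonneg (Nat.cast_nonneg _) _
    -- `S` is split by the value at the new coordinate `a`. The members of a part agree at `a`, so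
    -- the induction hypothesis applies to each part.
    set V := S.image (fun f => f a)
    set F : α → Finset (ι → α) := fun v => S.filter (fun f => f a = v)
    have hcard : (#S : ℝ) = ∑ v ∈ V, (#(F v) : ℝ) := by
      rw [card_eq_sum_card_image (fun f => f a) S]; push_cast; rfl
    have hF : ∀ v, (#(F v) : ℝ) ≤ ∏ i ∈ I, (#((F v).image (proj (T i))) : ℝ) ^ p i := by
      intro v
      refine ih (fun b hb => hcov b (mem_insert_of_mem hb)) (F v) fun f hf g hg x hx => ?_
      simp only [F, mem_filter] at hf hg
      by_cases e : x = a
      · subst e; rw [hf.2, hg.2]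
      · exact hS f hf.1 g hg.1 x (by simp [e, hx])
    set Y : κ → ℝ := fun i => (#(S.image (proj (T i))) : ℝ)
    set y : κ → α → ℝ := fun i v => (#((F v).image (proj (T i))) : ℝ)
    have hY : ∀ i, 0 < Y i := fun i => by
      simp only [Y]; exact_mod_cast (hne.image _).card_pos
    have hy0 : ∀ i v, 0 ≤ y i v := fun i v => Nat.cast_nonneg _
    have hyY : ∀ i v, y i v ≤ Y i := fun i v => by
      simp only [y, Y]
      exact_mod_cast card_le_card (image_subset_image (filter_subset _ _))
    -- If `T i` contains `a`, a projection reveals the value at `a`. The projections of different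
    -- parts are therefore disjoint and their sizes add up.
    have hsum : ∀ i, a ∈ T i → ∑ v ∈ V, y i v = Y i := by
      intro i hi
      simp only [y, Y]
      rw [← Nat.cast_sum, ← card_biUnion]
      · congr 2
        ext q
        simp only [mem_biUnion, mem_image, F, mem_filter, V]
        constructor
        · rintro ⟨_, -, f, ⟨hf, -⟩, rfl⟩; exact ⟨f, hf, rfl⟩
        · rintro ⟨f, hf, rfl⟩; exact ⟨f a, ⟨f, hf, rfl⟩, f, ⟨hf, rfl⟩, rfl⟩
      · intro v _ w _ hvw
        rw [Function.onFun, disjoint_left]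
        intro q hq hq'
        simp only [mem_image, F, mem_filter] at hq hq'
        obtain ⟨f, ⟨-, hf⟩, rfl⟩ := hq
        obtain ⟨g, ⟨-, hg⟩, he⟩ := hq'
        have := congrFun he a
        simp only [proj, hi, if_true, Option.some.injEq] at this
        exact hvw (by rw [← hf, ← hg, this])
    set J := I.filter (fun i => a ∈ T i)
    set P := ∑ i ∈ J, p i
    have hP : 1 ≤ P := hcov a (mem_insert_self _ _)
    -- The ratios are at most 1. So factors that do not see `a` may be dropped, and the remaining
    -- exponents, with sum `P ≥ 1`, may be decreased to have sum 1. The weighted inequality of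
    -- arithmetic and geometric means then gives a bound that is linear in the ratios and can be
    -- summed over `v`.
    have hz : ∀ v, ∏ i ∈ I, (y i v / Y i) ^ p i ≤ ∑ i ∈ J, p i / P * (y i v / Y i) := by
      intro v
      have z0 : ∀ i, 0 ≤ y i v / Y i := fun i => div_nonneg (hy0 i v) (hY i).le
      have z1 : ∀ i, y i v / Y i ≤ 1 := fun i => (div_le_one (hY i)).2 (hyY i v)
      have hJ : ∀ i ∈ J, 0 ≤ p i := fun i hi => hp i (mem_filter.1 hi).1
      calc ∏ i ∈ I, (y i v / Y i) ^ p i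
          ≤ ∏ i ∈ I, if i ∈ J then (y i v / Y i) ^ (p i / P) else 1 := by
            refine prod_le_prod (fun i _ => Real.rpow_nonneg (z0 i) _) fun i hi => ?_
            split_ifs with hiJ
            · exact Real.rpow_le_rpow_of_exponent_ge' (z0 i) (z1 i)
                (div_nonneg (hp i hi) (by linarith)) (div_le_self (hp i hi) hP)
            · exact Real.rpow_le_one (z0 i) (z1 i) (hp i hi)
        _ = ∏ i ∈ J, (y i v / Y i) ^ (p i / P) := by
            rw [prod_ite_mem, inter_eq_right.2 (filter_subset _ _)]
        _ ≤ ∑ i ∈ J, p i / P * (y i v / Y i) :=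
            Real.geom_mean_le_arith_mean_weighted J _ _
              (fun i hi => div_nonneg (hJ i hi) (by linarith))
              (by rw [← sum_div]; exact div_self (by linarith)) (fun i _ => z0 i)
    have hone : ∑ v ∈ V, ∑ i ∈ J, p i / P * (y i v / Y i) = 1 := by
      rw [sum_comm]
      have : ∀ i ∈ J, ∑ v ∈ V, p i / P * (y i v / Y i) = p i / P := by
        intro i hi
        rw [← mul_sum, ← sum_div, hsum i (mem_filter.1 hi).2, div_self (hY i).ne', mul_one]
      rw [sum_congr rfl this, ← sum_div]
      exact div_self (by linarith)
    calc (#S : ℝ) = ∑ v ∈ V, (#(F v) : ℝ) := hcard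
      _ ≤ ∑ v ∈ V, ∏ i ∈ I, y i v ^ p i := sum_le_sum fun v _ => hF v
      _ = ∑ v ∈ V, (∏ i ∈ I, Y i ^ p i) * ∏ i ∈ I, (y i v / Y i) ^ p i := by
          refine sum_congr rfl fun v _ => ?_
          rw [← prod_mul_distrib]
          refine prod_congr rfl fun i _ => ?_
          rw [← Real.mul_rpow (hY i).le (div_nonneg (hy0 i v) (hY i).le),
            mul_div_cancel₀ _ (hY i).ne']
      _ ≤ ∑ v ∈ V, (∏ i ∈ I, Y i ^ p i) * ∑ i ∈ J, p i / P * (y i v / Y i) :=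
          sum_le_sum fun v _ => mul_le_mul_of_nonneg_left (hz v)
            (prod_nonneg fun i _ => Real.rpow_nonneg (hY i).le _)
      _ = ∏ i ∈ I, Y i ^ p i := by rw [← mul_sum, hone, mul_one]

open Classical in
/-- Shearer's inequality if every coordinate is covered by at least half of the weight. -/
theorem card_le_sq_of_half_cover (I : Finset κ) (T : κ → Finset ι) (u : κ → ℕ)
    (hu : 0 < ∑ i ∈ I, u i) (A : Finset ι)
    (hcov : ∀ a ∈ A, ∑ i ∈ I, u i ≤ 2 * ∑ i ∈ I with a ∈ T i, u i) (S : Finset (ι → α))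
    (hS : ∀ f ∈ S, ∀ g ∈ S, ∀ x ∉ A, f x = g x) (M : ℕ) (hM : 1 ≤ M)
    (hSM : ∀ i ∈ I, #(S.image (proj (T i))) ≤ M) : #S ≤ M ^ 2 := by
  have hU : (0 : ℝ) < ∑ i ∈ I, (u i : ℝ) := by exact_mod_cast hu
  have hM' : (0 : ℝ) < M := by exact_mod_cast hM
  set U := ∑ i ∈ I, (u i : ℝ)
  -- With weights `2 * u i / U` every coordinate has total weight at least 1, while the sum of all
  -- weights is 2; this is the exponent of `M`.
  have h := shearer I T (fun i => 2 * u i / U) (fun i _ => by positivity) A (fun a ha => ?_) S hS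
  · have h2 : ∏ i ∈ I, (#(S.image (proj (T i))) : ℝ) ^ (2 * u i / U : ℝ) ≤ (M : ℝ) ^ 2 := by
      calc _ ≤ ∏ i ∈ I, (M : ℝ) ^ (2 * u i / U : ℝ) := by
            refine prod_le_prod (fun i _ => Real.rpow_nonneg (Nat.cast_nonneg _) _) fun i hi => ?_
            exact Real.rpow_le_rpow (Nat.cast_nonneg _) (by exact_mod_cast hSM i hi) (by positivity)
        _ = (M : ℝ) ^ (2 : ℝ) := by
            rw [← Real.rpow_sum_of_pos hM', ← sum_div, ← mul_sum, mul_div_assoc, div_self hU.ne',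
              mul_one]
        _ = (M : ℝ) ^ 2 := by norm_cast
    exact_mod_cast h.trans h2
  · rw [← sum_div, le_div_iff₀ hU, one_mul, ← mul_sum]
    have := hcov a ha
    simp only [U]
    exact_mod_cast this

end Shearer

/-- A small family of hash functions that contains an injective one for every small set. -/
theorem exists_hash_injOn {n Q : ℕ} (hn : 0 < n) (S : Finset ℕ) (hS : ∀ j ∈ S, j < n)
    (hQ : #S * #S < Q) :
    ∃ P a, P ≤ 2 * n ∧ a ≤ 2 * n ∧ Set.InjOn (fun j => a * j % P % Q) S := by
  -- By Bertrand's postulate there is a prime `P` with `n < P ≤ 2 * n`; different columns are then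
  -- different residues.
  obtain ⟨P, hP, hnP, hPn⟩ := Nat.exists_prime_lt_and_le_two_mul n (by omega)
  have : Fact P.Prime := ⟨hP⟩
  have hP2 := hP.two_le
  -- The multipliers for which a pair collides. The order of the two residues is prescribed so that
  -- the natural subtraction is not truncated.
  set bad : ℕ × ℕ → Finset ℕ := fun q => (Ico 1 P).filter fun a =>
    a * q.2 % P < a * q.1 % P ∧ Q ∣ a * q.1 % P - a * q.2 % P
  have hsub : ∀ (a : ℕ) (q : ℕ × ℕ), a * q.2 % P < a * q.1 % P →
      ((a * q.1 % P - a * q.2 % P : ℕ) : ZMod P) = (a : ZMod P) * ((q.1 : ZMod P) - q.2) := by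
    intro a q h
    rw [Nat.cast_sub h.le, ZMod.natCast_mod, ZMod.natCast_mod]
    push_cast
    ring
  -- The difference of the residues determines the multiplier, and it is a positive multiple of `Q`
  -- that is at most `P - 1`.
  have hbad : ∀ q ∈ S ×ˢ S, #(bad q) ≤ (P - 1) / Q := by
    intro q hq
    rw [← Nat.Ioc_filter_dvd_card_eq_div]
    refine card_le_card_of_injOn (fun a => a * q.1 % P - a * q.2 % P) ?_ ?_
    · intro a ha
      simp only [bad, coe_filter, mem_Ico, Set.mem_ofPred_eq] at ha
      have := Nat.mod_lt (a * q.1) (by omega : P > 0)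
      simp only [coe_filter, mem_Ioc, Set.mem_ofPred_eq]
      exact ⟨⟨by omega, by omega⟩, ha.2.2⟩
    · intro a ha b hb hab
      simp only [bad, coe_filter, mem_Ico, Set.mem_ofPred_eq] at ha hb
      simp only at hab
      have h1 := congrArg (Nat.cast : ℕ → ZMod P) hab
      rw [hsub a q ha.2.1, hsub b q hb.2.1] at h1
      have hne : (q.1 : ZMod P) - q.2 ≠ 0 := by
        intro h0
        have h3 := hsub a q ha.2.1
        rw [h0, mul_zero, ZMod.natCast_eq_zero_iff] at h3
        have := Nat.le_of_dvd (by omega) h3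
        have := Nat.mod_lt (a * q.1) (by omega : P > 0)
        omega
      have h2 := mul_right_cancel₀ hne h1
      rw [ZMod.natCast_eq_natCast_iff', Nat.mod_eq_of_lt ha.1.2, Nat.mod_eq_of_lt hb.1.2] at h2
      exact h2
  -- Union bound: fewer than `Q` pairs with at most `(P - 1) / Q` bad multipliers each cannot
  -- exhaust the `P - 1` multipliers.
  have hcard : #((S ×ˢ S).biUnion bad) < #(Ico 1 P) := by
    calc #((S ×ˢ S).biUnion bad) ≤ #(S ×ˢ S) * ((P - 1) / Q) := card_biUnion_le_card_mul _ _ _ hbad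
      _ = #S * #S * ((P - 1) / Q) := by rw [card_product]
      _ < P - 1 := by
          rcases Nat.eq_zero_or_pos ((P - 1) / Q) with h0 | h0
          · rw [h0]; omega
          · calc #S * #S * ((P - 1) / Q) < Q * ((P - 1) / Q) := Nat.mul_lt_mul_of_pos_right hQ h0
              _ ≤ P - 1 := Nat.mul_div_le _ _
      _ = #(Ico 1 P) := by simp
  obtain ⟨a, ha, hna⟩ := exists_mem_notMem_of_card_lt_card hcard
  rw [mem_Ico] at ha
  refine ⟨P, a, hPn, by omega, ?_⟩
  have key : ∀ x ∈ S, ∀ y ∈ S, a * x % P % Q = a * y % P % Q → ¬ a * y % P < a * x % P := by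
    intro x hx y hy he hlt
    refine hna (mem_biUnion.2 ⟨(x, y), mem_product.2 ⟨hx, hy⟩, ?_⟩)
    simp only [bad, mem_filter, mem_Ico]
    exact ⟨ha, hlt, (Nat.modEq_iff_dvd' hlt.le).1 he.symm⟩
  intro x hx y hy he
  have h1 := key x hx y hy he
  have h2 := key y hy x hx he.symm
  have h3 : a * x % P = a * y % P := by omega
  rw [← ZMod.natCast_eq_natCast_iff'] at h3
  push_cast at h3
  have ha0 : (a : ZMod P) ≠ 0 := by
    rw [Ne, ZMod.natCast_eq_zero_iff]
    exact fun h => absurd (Nat.le_of_dvd (by omega) h) (by omega)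
  have h4 := mul_left_cancel₀ ha0 h3
  have := hS x hx
  have := hS y hy
  rwa [ZMod.natCast_eq_natCast_iff', Nat.mod_eq_of_lt (by omega), Nat.mod_eq_of_lt (by omega)] at h4

/-- The `h` elements with the largest keys are cut out by a threshold. -/
theorem exists_threshold (T : Finset ℕ) (key : ℕ → ℕ) (hinj : Set.InjOn key T) (K h : ℕ)
    (hK : ∀ t ∈ T, key t ≤ K) (hh : h ≤ #T) :
    ∃ θ ≤ K + 1, #(T.filter fun t => θ ≤ key t) = h := by
  -- A discrete intermediate value argument: `θ` is lowered from `K + 1`, and since the keys are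
  -- distinct each step adds at most one element, so no cardinality is skipped.
  have main : ∀ d, ∃ θ ≤ K + 1, #(T.filter fun t => θ ≤ key t) = h ∨
      (θ + d = K + 1 ∧ #(T.filter fun t => θ ≤ key t) < h) ∨ K + 1 < d := by
    intro d
    induction d with
    | zero =>
      have h0 : T.filter (fun t => K + 1 ≤ key t) = ∅ :=
        filter_eq_empty_iff.2 fun t ht => by have := hK t ht; omega
      refine ⟨K + 1, le_rfl, ?_⟩
      rw [h0, card_empty]
      omega
    | succ d ih =>
      obtain ⟨θ, hθ, h1 | ⟨h1, h2⟩ | h1⟩ := ih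
      · exact ⟨θ, hθ, .inl h1⟩
      · rcases Nat.eq_zero_or_pos θ with rfl | hpos
        · exact ⟨0, by omega, by omega⟩
        have hle : #(T.filter fun t => θ - 1 ≤ key t) ≤ #(T.filter fun t => θ ≤ key t) + 1 := by
          have hsub : T.filter (fun t => θ - 1 ≤ key t) ⊆
              T.filter (fun t => θ ≤ key t) ∪ T.filter (fun t => key t = θ - 1) := by
            intro t ht
            simp only [mem_union, mem_filter] at ht ⊢
            by_cases e : key t = θ - 1
            · exact .inr ⟨ht.1, e⟩
            · exact .inl ⟨ht.1, by omega⟩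
          refine (card_le_card hsub).trans ((card_union_le _ _).trans ?_)
          refine Nat.add_le_add_left (card_le_one.2 fun x hx y hy => ?_) _
          simp only [mem_filter] at hx hy
          exact hinj hx.1 hy.1 (by rw [hx.2, hy.2])
        refine ⟨θ - 1, by omega, ?_⟩
        omega
      · exact ⟨θ, hθ, .inr (.inr (by omega))⟩
  obtain ⟨θ, hθ, h1 | ⟨h1, h2⟩ | h1⟩ := main (K + 1)
  · exact ⟨θ, hθ, h1⟩
  · have h0 : θ = 0 := by omega
    subst h0
    simp at h2
    omega
  · omega

/-- Sets that are cut out by a threshold have the largest weight. -/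
theorem sum_le_sum_threshold (T H : Finset ℕ) (hH : H ⊆ T) (key w : ℕ → ℕ)
    (hw : ∀ x ∈ T, ∀ y ∈ T, key x ≤ key y → w x ≤ w y) (θ : ℕ)
    (hcard : #(T.filter fun t => θ ≤ key t) = #H) :
    ∑ t ∈ H, w t ≤ ∑ t ∈ T with θ ≤ key t, w t := by
  set G := T.filter fun t => θ ≤ key t
  have h1 : #(H \ G) = #(G \ H) := (card_sdiff_comm hcard).symm
  set m := (H \ G).sup w
  have h2 : ∑ t ∈ H \ G, w t ≤ #(H \ G) • m :=
    sum_le_card_nsmul _ _ _ fun t ht => le_sup (f := w) ht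
  have h3 : #(G \ H) • m ≤ ∑ t ∈ G \ H, w t := by
    refine card_nsmul_le_sum _ _ _ fun t ht => Finset.sup_le fun x hx => ?_
    simp only [G, mem_sdiff, mem_filter, not_and, not_le] at ht hx
    have := hx.2 (hH hx.1)
    exact hw x (hH hx.1) t ht.1.1 (by omega)
  rw [← sum_sdiff (inter_subset_left : H ∩ G ⊆ H), ← sum_sdiff (inter_subset_right : H ∩ G ⊆ G)]
  rw [sdiff_inter_self_left, sdiff_inter_self_right]
  rw [h1] at h2
  omega

end ColumnOutliers


/-! ### Clusterings as assignments of centers -/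

namespace ColumnOutliers

open Finset

/-- The data of an instance, with rows, columns and letters indexed by natural numbers. -/
structure Data where
  m : ℕ
  n : ℕ
  B : ℕ
  k : ℕ
  l : ℕ
  sig : ℕ
  A : ℕ → ℕ → ℕ
  al : ℕ → ℕ

namespace Data

variable (D : Data)

/-- The Hamming distance from column `j` to the center `c`. -/
def dist (j : ℕ) (c : ℕ → ℕ) : ℕ := #{r ∈ range D.m | D.A r j ≠ c r}

/-- Column `j` as a center. -/
def col (j : ℕ) : ℕ → ℕ := fun r => D.A r j

open Classical in
/-- There is an assignment of at most `k` centers to all but `l` columns of cost at most `B`. -/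
def Core : Prop :=
  ∃ N ⊆ range D.n, D.n ≤ #N + D.l ∧ ∃ γ : ℕ → ℕ → ℕ, #(N.image γ) ≤ D.k ∧
    (∀ j ∈ N, ∀ r < D.m, ∃ v < D.sig, γ j r = D.al v) ∧ ∑ j ∈ N, D.dist j (γ j) ≤ D.B

end Data

/-! ### Yes-instances as assignments of at most `k` centers. -/

namespace Instance

variable (x : Instance)

/-- The data of an instance. -/
def toData : Data where
  m := x.m
  n := x.n
  B := x.B
  k := x.k
  l := x.l
  sig := #x.alphabet
  A := fun r j => if h : r < x.m ∧ j < x.n then x.A ⟨r, h.1⟩ ⟨j, h.2⟩ else 0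
  al := fun v => (x.alphabet.sort (· ≤ ·)).getD v 0

theorem toData_A (r : Fin x.m) (j : Fin x.n) : x.toData.A r j = x.A r j := by simp [toData]

theorem mem_alphabet_iff {a : ℕ} : a ∈ x.alphabet ↔ ∃ v < x.toData.sig, a = x.toData.al v := by
  rw [← Finset.mem_sort (· ≤ ·), List.mem_iff_getElem]
  simp only [toData, length_sort]
  constructor
  · rintro ⟨i, hi, h⟩
    exact ⟨i, hi, by rw [List.getD_eq_getElem _ _ (by simpa using hi), h]⟩
  · rintro ⟨i, hi, h⟩
    exact ⟨i, hi, by rw [h, List.getD_eq_getElem _ _ (by simpa using hi)]⟩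

theorem dist_eq_hammingDist (j : Fin x.n) (c : ℕ → ℕ) :
    x.toData.dist j c = hammingDist (fun h => x.A h j) (fun h => c h) := by
  rw [Data.dist, hammingDist, card_filter, card_filter, Finset.sum_range]
  change ∑ r : Fin x.m, _ = _
  refine Finset.sum_congr rfl fun r _ => ?_
  have := x.toData_A r j
  simp only [this]

/-- The partition is forgotten: every covered column is assigned the center of its cluster. Elements
chosen from the `k` disjoint nonempty clusters are distinct, whence `k ≤ n`. -/
theorem core_of_isYes (h : x.IsYes) : x.k ≤ x.n ∧ x.toData.Core := by
  classical
  obtain ⟨O, I, c, hO, hne, hdis, hU, hc, hcost⟩ := h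
  choose e he using fun i => hne i
  have heinj : Function.Injective e := by
    intro i i' h
    by_contra hii
    exact disjoint_left.1 (hdis i i' hii) (he i) (by rw [h]; exact he i')
  refine ⟨by simpa using Fintype.card_le_of_injective e heinj, ?_⟩
  have hcov : ∀ j : Fin x.n, ∃ i, j ∉ O → j ∈ I i := by
    intro j
    by_cases hj : j ∈ O
    · exact ⟨⟨0, x.k_pos⟩, fun h => absurd hj h⟩
    · have : j ∈ Finset.univ.biUnion I := by rw [hU]; simp [hj]
      obtain ⟨i, -, hi⟩ := mem_biUnion.1 this
      exact ⟨i, fun _ => hi⟩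
  choose a ha using hcov
  set cc : Fin x.k → ℕ → ℕ := fun i r => if h : r < x.m then c i ⟨r, h⟩ else 0
  have hcc : ∀ i, (fun h : Fin x.m => cc i h) = c i := fun i => by ext h; simp [cc]
  set γ : ℕ → ℕ → ℕ := fun j => if h : j < x.n then cc (a ⟨j, h⟩) else fun _ => 0
  have hγ : ∀ j : Fin x.n, γ j = cc (a j) := fun j => by simp [γ]
  refine ⟨(univ \ O).image Fin.val, ?_, ?_, γ, ?_, ?_, ?_⟩
  · intro j hj
    obtain ⟨i, -, rfl⟩ := mem_image.1 hj
    exact mem_range.2 i.2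
  · rw [card_image_of_injective _ Fin.val_injective, card_univ_sdiff, Fintype.card_fin]
    change x.n ≤ x.n - #O + x.l
    omega
  · have hsub : ((univ \ O).image Fin.val).image γ ⊆ univ.image cc := by
      intro f hf
      simp only [mem_image] at hf
      obtain ⟨_, ⟨j, -, rfl⟩, rfl⟩ := hf
      rw [hγ]
      exact mem_image_of_mem _ (mem_univ _)
    refine (card_le_card hsub).trans (card_image_le.trans ?_)
    simp [toData]
  · intro j hj r hr
    obtain ⟨i, -, rfl⟩ := mem_image.1 hj
    have hr' : r < x.m := hr
    rw [← mem_alphabet_iff, hγ]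
    simp only [cc, hr', dif_pos]
    exact hc _ _
  · rw [sum_image Fin.val_injective.injOn]
    refine le_trans (le_of_eq ?_) hcost
    rw [← hU, sum_biUnion fun i _ i' _ hii => hdis i i' hii]
    refine sum_congr rfl fun i _ => sum_congr rfl fun j hj => ?_
    have hjO : j ∉ O := by
      have : j ∈ Finset.univ.biUnion I := mem_biUnion.2 ⟨i, mem_univ _, hj⟩
      rw [hU] at this
      simpa using this
    have hai : a j = i := by
      by_contra hne
      exact disjoint_left.1 (hdis _ _ hne) (ha j hjO) hj
    rw [hγ, hai, dist_eq_hammingDist, hcc]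

-- An assignment may use fewer than `k` centers, so clusters have to be split. One covered column
-- per used center is chosen, and these are extended to a set `Y` of exactly `k` covered columns.
-- Each member of `Y` opens a cluster and keeps its center; every other column joins the chosen
-- column of its center. No distance changes.
open Classical in
theorem isYes_of_large_core (N : Finset (Fin x.n)) (hk : x.k ≤ #N) (hN : x.n ≤ #N + x.l)
    (γ : Fin x.n → ℕ → ℕ) (hγ : #(N.image γ) ≤ x.k)
    (hc : ∀ j ∈ N, ∀ r : Fin x.m, γ j r ∈ x.alphabet)
    (hcost : ∑ j ∈ N, x.toData.dist j (γ j) ≤ x.B) : x.IsYes := by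
  have : Nonempty (Fin x.n) := ⟨⟨0, x.n_pos⟩⟩
  choose! e he using fun f (hf : f ∈ N.image γ) => mem_image.1 hf
  set E := (N.image γ).image e
  have hEN : E ⊆ N := by
    intro j hj
    obtain ⟨f, hf, rfl⟩ := mem_image.1 hj
    exact (he f hf).1
  have hEk : #E ≤ x.k := card_image_le.trans hγ
  obtain ⟨Y, hEY, hYN, hYk⟩ := exists_subsuperset_card_eq hEN hEk hk
  set y : Fin x.n → Fin x.n := fun j => if j ∈ Y then j else e (γ j)
  have hy : ∀ j ∈ N, y j ∈ Y ∧ γ (y j) = γ j := by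
    intro j hj
    have hf := mem_image_of_mem γ hj
    by_cases h : j ∈ Y
    · simp [y, h]
    · simp only [y, h, if_false]
      exact ⟨hEY (mem_image_of_mem e hf), (he _ hf).2⟩
  have hyY : ∀ j ∈ Y, y j = j := fun j hj => by simp [y, hj]
  let φ : Fin x.k ≃ Y := (Fin.castOrderIso hYk.symm).toEquiv.trans Y.equivFin.symm
  refine ⟨univ \ N, fun i => N.filter fun j => y j = φ i, fun i r => γ (φ i) r, ?_, ?_, ?_, ?_, ?_,
    ?_⟩
  · rw [card_univ_sdiff, Fintype.card_fin]
    omega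
  · intro i
    exact ⟨φ i, mem_filter.2 ⟨hYN (φ i).2, hyY _ (φ i).2⟩⟩
  · intro i i' hii
    rw [disjoint_left]
    intro j hj hj'
    simp only [mem_filter] at hj hj'
    exact hii (φ.injective (Subtype.ext (hj.2.symm.trans hj'.2)))
  · ext j
    simp only [mem_biUnion, mem_univ, true_and, mem_filter, mem_sdiff, not_not]
    constructor
    · rintro ⟨i, h, -⟩; exact h
    · intro h
      exact ⟨φ.symm ⟨y j, (hy j h).1⟩, h, by simp⟩
  · intro i r
    exact hc _ (hYN (φ i).2) r
  · refine le_trans (le_of_eq ?_) hcost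
    have hunion : univ.biUnion (fun i => N.filter fun j => y j = φ i) = N := by
      ext j
      simp only [mem_biUnion, mem_univ, true_and, mem_filter]
      constructor
      · rintro ⟨i, h, -⟩; exact h
      · intro h
        exact ⟨φ.symm ⟨y j, (hy j h).1⟩, h, by simp⟩
    conv_rhs => rw [← hunion]
    rw [sum_biUnion]
    · refine sum_congr rfl fun i _ => sum_congr rfl fun j hj => ?_
      simp only [mem_filter] at hj
      have e : γ (φ i) = γ j := by rw [← hj.2, (hy j hj.1).2]
      rw [dist_eq_hammingDist, ← e]
    · intro i _ i' _ hii
      rw [Function.onFun, disjoint_left]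
      intro j hj hj'
      simp only [mem_filter] at hj hj'
      exact hii (φ.injective (Subtype.ext (hj.2.symm.trans hj'.2)))

/-- If fewer than `k` columns are covered, the covered set is enlarged to exactly `k` columns, each
of which becomes its own center. This costs nothing and leaves no more outliers than before. -/
theorem isYes_of_core (hk : x.k ≤ x.n) (h : x.toData.Core) : x.IsYes := by
  classical
  obtain ⟨N, hNn, hNl, γ, hγ, hc, hcost⟩ := h
  have hNn' : ∀ j ∈ N, j < x.n := fun j hj => mem_range.1 (hNn hj)
  set N' : Finset (Fin x.n) := univ.filter fun j => (j : ℕ) ∈ N with hN'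
  have himg : N'.image Fin.val = N := by
    ext j
    simp only [mem_image, hN', mem_filter, mem_univ, true_and]
    constructor
    · rintro ⟨i, hi, rfl⟩; exact hi
    · intro hj; exact ⟨⟨j, hNn' j hj⟩, hj, rfl⟩
  have hcard : #N' = #N := by rw [← himg, card_image_of_injective _ Fin.val_injective]
  by_cases hkN : x.k ≤ #N'
  · refine x.isYes_of_large_core N' hkN (by rw [hcard]; exact hNl) (fun j => γ j) ?_ ?_ ?_
    · rw [← himg, image_image] at hγ
      exact hγ
    · intro j hj r
      rw [mem_alphabet_iff]
      exact hc j (by simpa [hN'] using hj) r r.2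
    · rw [← himg, sum_image Fin.val_injective.injOn] at hcost
      exact hcost
  · obtain ⟨Y, hY, -, hYk⟩ := exists_subsuperset_card_eq (subset_univ N') (by omega : #N' ≤ x.k)
      (by simpa using hk)
    refine x.isYes_of_large_core Y hYk.ge ?_ (fun j => x.toData.col j)
      (card_image_le.trans hYk.le) ?_ ?_
    · have : x.n ≤ #N + x.l := hNl
      omega
    · intro j _ r
      simp only [Data.col, toData_A]
      exact x.A_mem r j
    · simp [Data.dist, Data.col]

theorem isYes_iff : x.IsYes ↔ x.k ≤ x.n ∧ x.toData.Core :=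
  ⟨x.core_of_isYes, fun h => x.isYes_of_core h.1 h.2⟩

end Instance

end ColumnOutliers


/-! ### Guesses and their soundness -/

namespace ColumnOutliers

open Finset
open scoped Classical

/-- A guess of the structure of a solution. The numbers `P` and `a` determine a colouring of the
columns, and `θ` determines the most frequent columns. There are `2 * B` slots for columns, and the
slot `i` has its cluster `kap i`, its colour `chi i`, a flag `fl i` for frequent columns, a
multiplicity `us i`, and a distance `ds i` to the center; `tau` describes the coordinates where the
column differs from the leading column of its cluster. -/
structure Guess where
  P : ℕ
  a : ℕ
  θ : ℕ
  kap : ℕ → ℕ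
  chi : ℕ → ℕ
  fl : ℕ → ℕ
  us : ℕ → ℕ
  ds : ℕ → ℕ
  tau : ℕ → ℕ

namespace Data

variable (D : Data)

/-- Columns `i` and `j` are equal. -/
def Same (i j : ℕ) : Prop := ∀ r < D.m, D.A r i = D.A r j

/-- Column `j` is the first one of its kind. -/
def Rep (j : ℕ) : Prop := ∀ i < D.n, i < j → ¬ D.Same i j

/-- The multiplicity of column `j`. -/
noncomputable def mult (j : ℕ) : ℕ := #{i ∈ range D.n | D.Same i j}

/-- The first column equal to column `j`. -/
noncomputable def rep (j : ℕ) : ℕ := Nat.find (p := fun i => D.Same i j) ⟨j, fun _ _ => rfl⟩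

/-- The number of colours. -/
def colors : ℕ := 4 * D.B * D.B + 1

variable (G : Guess)

/-- Column `j` is a frequent column. -/
def Large (j : ℕ) : Prop := D.Rep j ∧ G.θ ≤ D.mult j * D.n + j

/-- Slot `i` is in use. -/
def Used (i : ℕ) : Prop := G.kap i < 2 * D.B

/-- The first index of `tau` that belongs to slot `i`. -/
noncomputable def off (i : ℕ) : ℕ :=
  ∑ i' ∈ range (2 * D.B), if i' < i ∧ D.Used G i' then G.ds i' else 0

/-- The column in slot `i` differs from the leading column in the `a`-th coordinate. -/
def Mark (i a : ℕ) : Prop := G.tau (D.off G i + a) ≠ 0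

/-- Column `j` fits into slot `i`. -/
def InX (i j : ℕ) : Prop :=
  D.Rep j ∧ G.a * j % G.P % D.colors = G.chi i ∧ (D.Large G j ↔ G.fl i ≠ 0) ∧ G.us i ≤ D.mult j

/-- The number of covered columns that is gained by putting column `j` into slot `i`, plus `n`. -/
noncomputable def gain (i j : ℕ) : ℕ :=
  D.n + (if G.ds i = 0 then D.mult j else G.us i) - (if G.fl i ≠ 0 then D.mult j else 0)

/-- The guess is consistent. -/
structure Consistent : Prop where
  -- The leading slot has the smallest distance in its cluster, so positions below that distance lie
  -- in the block of marks of every slot of the cluster.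
  leader : ∀ i < 2 * D.B, D.Used G i →
    G.kap (G.kap i) = G.kap i ∧ G.ds (G.kap i) ≤ G.ds i ∧ 1 ≤ G.us i
  cost : (∑ i ∈ range (2 * D.B), if D.Used G i then G.us i * G.ds i else 0) ≤ D.B
  color : ∀ i < 2 * D.B, ∀ i' < 2 * D.B, D.Used G i → D.Used G i' → G.chi i = G.chi i' → i = i'
  -- The majority property of optimal centers, which is the half cover needed for Shearer's
  -- inequality.
  cover : ∀ s < 2 * D.B, G.kap s = s → ∀ a < D.B, a < G.ds s →
    (∑ i ∈ range (2 * D.B), if G.kap i = s then G.us i else 0) ≤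
      2 * ∑ i ∈ range (2 * D.B), if G.kap i = s ∧ D.Mark G i a then G.us i else 0

/-- The digits `h` describe a candidate for the center of the cluster `s` after `t` changes of the
leading column. -/
def Good (s t : ℕ) (h : ℕ → ℕ) : Prop :=
  -- `h 0` is the leading column, and `h (a + 1)` encodes change number `a` as the row times `sig`
  -- plus the number of the letter. Only the first `t` changes are read, which makes the predicate a
  -- test for prefixes.
  h 0 < D.n ∧ (∀ a < D.B, a < t → h (a + 1) < D.m * D.sig) ∧
    ∀ i < 2 * D.B, G.kap i = s → ∃ j < D.n, D.InX G i j ∧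
      D.dist j (D.col (h 0)) ≤ G.ds s + G.ds i ∧
      ∀ a < D.B, a < t → D.Mark G i a →
        D.A (h (a + 1) / D.sig) j ≠ D.A (h (a + 1) / D.sig) (h 0)

/-- Column `j` differs in row `r` from the center described by `h`. -/
def Differs (s : ℕ) (h : ℕ → ℕ) (r j : ℕ) : Prop :=
  (∃ a < D.B, a < G.ds s ∧ h (a + 1) / D.sig = r ∧ D.al (h (a + 1) % D.sig) ≠ D.A r j) ∨
  ((∀ a < D.B, a < G.ds s → h (a + 1) / D.sig ≠ r) ∧ D.A r (h 0) ≠ D.A r j)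

/-- Column `j` fits into slot `i` and has the right distance to the center described by `h`. -/
def Fit (s : ℕ) (h : ℕ → ℕ) (i j : ℕ) : Prop :=
  D.InX G i j ∧ #{r ∈ range D.m | D.Differs G s h r j} ≤ G.ds i

/-- The largest gain for slot `i`. -/
noncomputable def top (s : ℕ) (h : ℕ → ℕ) (i : ℕ) : ℕ :=
  -- A maximum in the form of a count, because terms can form sums but not maxima.
  #{v ∈ range (2 * D.n + 1) | ∃ j < D.n, D.Fit G s h i j ∧ v < D.gain G i j}

/-- The largest gain for the cluster `s` with the center described by `h`. -/
noncomputable def leafVal (s : ℕ) (h : ℕ → ℕ) : ℕ :=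
  if ∀ i < 2 * D.B, G.kap i = s → D.top G s h i ≠ 0 then
    ∑ i ∈ range (2 * D.B), if G.kap i = s then D.top G s h i else 0 else 0

/-- The slots that lead a cluster. -/
noncomputable def leaders : Finset ℕ := {s ∈ range (2 * D.B) | G.kap s = s}

/-- The final test, where `total` is the sum of the largest gains for the clusters. -/
def Accepts (total : ℕ) : Prop :=
  -- Frequent kinds that sit in slots occur on both sides. What remains is that the frequent kinds
  -- outside the slots and the clusters together number at most `k`.
  #{j ∈ range D.n | D.Large G j} + #(D.leaders G) ≤
    D.k + #{i ∈ range (2 * D.B) | D.Used G i ∧ G.fl i ≠ 0} ∧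
  -- The product on the left compensates for the shift by `n` in the gain of each slot in use.
  D.n + D.n * #{i ∈ range (2 * D.B) | D.Used G i} ≤
    (∑ j ∈ range D.n, if D.Large G j then D.mult j else 0) + total + D.l

/-! ### Kinds of columns, and soundness of accepted guesses. -/

variable {D G}

theorem Same.symm {i j : ℕ} (h : D.Same i j) : D.Same j i := fun r hr => (h r hr).symm

theorem Same.trans {i j k : ℕ} (h : D.Same i j) (h' : D.Same j k) : D.Same i k :=
  fun r hr => (h r hr).trans (h' r hr)

theorem Same.dist_eq {i j : ℕ} (h : D.Same i j) (c : ℕ → ℕ) : D.dist i c = D.dist j c := by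
  unfold dist
  congr 1
  refine filter_congr fun r hr => ?_
  rw [h r (mem_range.1 hr)]

theorem same_rep (j : ℕ) : D.Same (D.rep j) j :=
  Nat.find_spec (p := fun i => D.Same i j) ⟨j, fun _ _ => rfl⟩

theorem rep_le (j : ℕ) : D.rep j ≤ j :=
  Nat.find_min' (p := fun i => D.Same i j) _ fun _ _ => rfl

theorem Same.rep_eq {i j : ℕ} (h : D.Same i j) : D.rep i = D.rep j := by
  refine le_antisymm (Nat.find_min' (p := fun k => D.Same k i) _ ((same_rep j).trans h.symm))
    (Nat.find_min' (p := fun k => D.Same k j) _ ((same_rep i).trans h))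

theorem rep_rep (j : ℕ) : D.Rep (D.rep j) := by
  intro i _ hlt h
  exact Nat.find_min (p := fun k => D.Same k j) _ hlt (h.trans (same_rep j))

theorem Rep.rep_eq {j : ℕ} (h : D.Rep j) (hj : j < D.n) : D.rep j = j := by
  by_contra hne
  have := rep_le (D := D) j
  exact h _ (by omega) (by omega) (same_rep j)

theorem Rep.eq {i j : ℕ} (hi : D.Rep i) (hj : D.Rep j) (hin : i < D.n) (hjn : j < D.n)
    (h : D.Same i j) : i = j := by
  rw [← hi.rep_eq hin, ← hj.rep_eq hjn, h.rep_eq]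

theorem dist_col_eq_zero {i j : ℕ} : D.dist i (D.col j) = 0 ↔ D.Same i j := by
  simp only [dist, card_eq_zero, filter_eq_empty_iff, mem_range, not_not]
  rfl

theorem mult_le (j : ℕ) : D.mult j ≤ D.n := (card_filter_le _ _).trans (by simp)

theorem mult_pos {j : ℕ} (hj : j < D.n) : 0 < D.mult j :=
  card_pos.2 ⟨j, mem_filter.2 ⟨mem_range.2 hj, fun _ _ => rfl⟩⟩

/-- A counting set of the form `{v | ∃ j, P j ∧ v < g j}` is an initial segment. -/
theorem card_filter_exists_lt {n K : ℕ} (P : ℕ → Prop) (g : ℕ → ℕ) (hg : ∀ j < n, g j < K) :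
    (∀ j < n, P j → g j ≤ #{v ∈ range K | ∃ j < n, P j ∧ v < g j}) ∧
    (#{v ∈ range K | ∃ j < n, P j ∧ v < g j} ≠ 0 →
      ∃ j < n, P j ∧ g j = #{v ∈ range K | ∃ j < n, P j ∧ v < g j}) := by
  set M := ((range n).filter P).sup g with hM
  have hset : {v ∈ range K | ∃ j < n, P j ∧ v < g j} = range M := by
    ext v
    simp only [mem_filter, mem_range, hM, Finset.lt_sup_iff, and_assoc]
    constructor
    · rintro ⟨-, h⟩; exact h
    · rintro ⟨j, hj, hP, hv⟩; exact ⟨hv.trans (hg j hj), j, hj, hP, hv⟩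
  rw [hset, card_range]
  refine ⟨fun j hj hP => le_sup (f := g) (by simp [hj, hP]), fun h0 => ?_⟩
  have hne : ((range n).filter P).Nonempty := by
    rw [nonempty_iff_ne_empty]
    intro he
    rw [hM, he] at h0
    simp at h0
  obtain ⟨j, hj, he⟩ := exists_mem_eq_sup _ hne g
  simp only [mem_filter, mem_range] at hj
  exact ⟨j, hj.1, hj.2, he.symm⟩

theorem gain_lt {i j : ℕ} (h : D.InX G i j) : D.gain G i j < 2 * D.n + 1 := by
  have h1 := mult_le (D := D) j
  have h2 := h.2.2.2
  unfold gain
  split_ifs <;> omega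

/-- The number of columns that are covered by putting column `j` into slot `i`. -/
noncomputable def cov (D : Data) (G : Guess) (i j : ℕ) : ℕ :=
  if G.ds i = 0 then D.mult j else G.us i

/-- The shift by `n` prevents truncation, since a multiplicity is at most `n`. The subtracted
multiplicity cancels the contribution of the same kind to the sum over all frequent kinds. -/
theorem gain_add (i j : ℕ) : D.gain G i j + (if G.fl i ≠ 0 then D.mult j else 0) =
    D.n + D.cov G i j := by
  have h1 := mult_le (D := D) j
  unfold gain cov
  split_ifs <;> omega

/-- Several changes may concern the same row. `Differs` holds as soon as one of them disagrees with
the column, so an arbitrary choice among them gives a center whose distances are at most the counts.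
-/
theorem exists_center {s : ℕ} {h : ℕ → ℕ}
    (hal : ∀ j < D.n, ∀ r < D.m, ∃ v < D.sig, D.A r j = D.al v)
    (h0 : h 0 < D.n) (hd : ∀ a < D.B, a < G.ds s → h (a + 1) < D.m * D.sig) :
    ∃ c : ℕ → ℕ, (∀ r < D.m, ∃ v < D.sig, c r = D.al v) ∧
      ∀ j, D.dist j c ≤ #{r ∈ range D.m | D.Differs G s h r j} := by
  set c : ℕ → ℕ := fun r =>
    if H : ∃ a < D.B, a < G.ds s ∧ h (a + 1) / D.sig = r then D.al (h (H.choose + 1) % D.sig)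
    else D.A r (h 0) with hc
  refine ⟨c, fun r hr => ?_, fun j => card_le_card fun r hr => ?_⟩
  · by_cases H : ∃ a < D.B, a < G.ds s ∧ h (a + 1) / D.sig = r
    · simp only [hc, H, dif_pos]
      refine ⟨_, Nat.mod_lt _ ?_, rfl⟩
      obtain ⟨a, h1, h2, -⟩ := H
      have := hd a h1 h2
      rcases Nat.eq_zero_or_pos D.sig with e | e
      · simp [e] at this
      · exact e
    · simp only [hc, H, dif_neg, not_false_eq_true]
      exact hal _ h0 r hr
  · simp only [mem_filter, mem_range] at hr ⊢
    refine ⟨hr.1, ?_⟩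
    by_cases H : ∃ a < D.B, a < G.ds s ∧ h (a + 1) / D.sig = r
    · have hcr : c r = D.al (h (H.choose + 1) % D.sig) := by simp only [hc, H, dif_pos]
      obtain ⟨h1, h2, h3⟩ := H.choose_spec
      exact .inl ⟨_, h1, h2, h3, by rw [← hcr]; exact hr.2.symm⟩
    · have hcr : c r = D.A r (h 0) := by simp only [hc, H, dif_neg, not_false_eq_true]
      push Not at H
      exact .inr ⟨H, by rw [← hcr]; exact hr.2.symm⟩

/-- An accepted guess yields a clustering. -/
theorem core_of_accepts (hal : ∀ j < D.n, ∀ r < D.m, ∃ v < D.sig, D.A r j = D.al v)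
    (hG : D.Consistent G) (h : ℕ → ℕ → ℕ)
    (hgood : ∀ s ∈ D.leaders G, D.Good G s (G.ds s) (h s))
    (hpos : ∀ s ∈ D.leaders G, D.leafVal G s (h s) ≠ 0)
    (hacc : D.Accepts G (∑ s ∈ D.leaders G, D.leafVal G s (h s))) : D.Core := by
  set I := {i ∈ range (2 * D.B) | D.Used G i} with hI
  have hI' : ∀ i ∈ I, i < 2 * D.B ∧ D.Used G i := fun i hi => by simpa [hI] using hi
  have hlead : ∀ i ∈ I, G.kap i ∈ D.leaders G := fun i hi => by
    obtain ⟨h1, h2⟩ := hI' i hi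
    exact mem_filter.2 ⟨mem_range.2 h2, (hG.leader i h1 h2).1⟩
  have htop0 : ∀ i ∈ I, D.top G (G.kap i) (h (G.kap i)) i ≠ 0 := by
    intro i hi
    have := hpos _ (hlead i hi)
    unfold leafVal at this
    split_ifs at this with hall
    · exact hall i (hI' i hi).1 rfl
    · exact absurd rfl this
  have hpick : ∀ i ∈ I, ∃ j < D.n, D.Fit G (G.kap i) (h (G.kap i)) i j ∧
      D.gain G i j = D.top G (G.kap i) (h (G.kap i)) i := by
    intro i hi
    -- The gain is bounded by `2 * n` only for columns that fit into the slot, so it is replaced by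
    -- 0 elsewhere.
    have := (card_filter_exists_lt (n := D.n) (K := 2 * D.n + 1)
      (fun j => D.Fit G (G.kap i) (h (G.kap i)) i j)
      (fun j => if D.InX G i j then D.gain G i j else 0) (fun j _ => by
        split_ifs with hx
        · exact gain_lt hx
        · omega)).2
    have hset : {v ∈ range (2 * D.n + 1) | ∃ j < D.n, D.Fit G (G.kap i) (h (G.kap i)) i j ∧
        v < if D.InX G i j then D.gain G i j else 0} = {v ∈ range (2 * D.n + 1) | ∃ j < D.n,
          D.Fit G (G.kap i) (h (G.kap i)) i j ∧ v < D.gain G i j} := by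
      refine filter_congr fun v _ => exists_congr fun j => and_congr_right fun _ =>
        and_congr_right fun hf => ?_
      rw [if_pos hf.1]
    rw [hset] at this
    obtain ⟨j, hj, hf, he⟩ := this (htop0 i hi)
    rw [if_pos hf.1] at he
    exact ⟨j, hj, hf, he⟩
  choose! t htn hfit hgain using hpick
  have hcen : ∀ s ∈ D.leaders G, ∃ c : ℕ → ℕ, (∀ r < D.m, ∃ v < D.sig, c r = D.al v) ∧
      ∀ j, D.dist j c ≤ #{r ∈ range D.m | D.Differs G s (h s) r j} := fun s hs =>
    exists_center hal (hgood s hs).1 (hgood s hs).2.1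
  choose! c hcal hcd using hcen
  -- The color is a function of the column and differs between slots, so independently filled slots
  -- contain different kinds.
  have hinj : ∀ i ∈ I, ∀ i' ∈ I, D.Same (t i) (t i') → i = i' := by
    intro i hi i' hi' hs
    have e := (hfit i hi).1.1.eq (hfit i' hi').1.1 (htn i hi) (htn i' hi') hs
    refine hG.color i (hI' i hi).1 i' (hI' i' hi').1 (hI' i hi).2 (hI' i' hi').2 ?_
    rw [← (hfit i hi).1.2.1, ← (hfit i' hi').1.2.1, e]
  set Cl : ℕ → Finset ℕ := fun t => {j ∈ range D.n | D.Same j t} with hCl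
  have hclcard : ∀ t, #(Cl t) = D.mult t := fun t => rfl
  have hcovle : ∀ i ∈ I, D.cov G i (t i) ≤ #(Cl (t i)) := by
    intro i hi
    rw [hclcard]
    unfold cov
    split_ifs
    · exact le_rfl
    · exact (hfit i hi).1.2.2.2
  choose! C hCsub hCcard using fun i hi => exists_subset_card_eq (hcovle i hi)
  set L := {j ∈ range D.n | D.Large G j} with hL
  -- The frequent kinds outside the slots: each is its own center, and all its copies are covered at
  -- cost zero.
  set L' := {j ∈ L | ∀ i ∈ I, t i ≠ j} with hL'
  have hLrep : ∀ j ∈ L, j < D.n ∧ D.Rep j ∧ D.Large G j := fun j hj => by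
    simp only [hL, mem_filter, mem_range] at hj
    exact ⟨hj.1, hj.2.1, hj.2⟩
  set J := {i ∈ I | G.fl i ≠ 0} with hJ
  have hLsplit : L = L' ∪ J.image t := by
    ext j
    simp only [hL', hJ, mem_union, mem_filter, mem_image]
    constructor
    · intro hj
      by_cases hex : ∃ i ∈ I, t i = j
      · obtain ⟨i, hi, rfl⟩ := hex
        exact .inr ⟨i, ⟨hi, (hfit i hi).1.2.2.1.1 (hLrep _ hj).2.2⟩, rfl⟩
      · push Not at hex
        exact .inl ⟨hj, hex⟩
    · rintro (⟨hj, -⟩ | ⟨i, ⟨hi, hf⟩, rfl⟩)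
      · exact hj
      · exact mem_filter.2 ⟨mem_range.2 (htn i hi), (hfit i hi).1.2.2.1.2 hf⟩
  have hLdisj : Disjoint L' (J.image t) := by
    rw [disjoint_left]
    intro j hj hj'
    simp only [hL', hJ, mem_filter, mem_image] at hj hj'
    obtain ⟨i, ⟨hi, -⟩, e⟩ := hj'
    exact hj.2 i hi e
  have hJinj : Set.InjOn t J := by
    intro i hi i' hi' e
    simp only [hJ, coe_filter, Set.mem_ofPred_eq] at hi hi'
    exact hinj i hi.1 i' hi'.1 (by rw [e]; exact fun _ _ => rfl)
  have hdis1 : Set.PairwiseDisjoint (L' : Set ℕ) Cl := by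
    intro x hx y hy hxy
    rw [Function.onFun, disjoint_left]
    intro j hj hj'
    simp only [hCl, mem_filter] at hj hj'
    have h1 := hLrep x (mem_filter.1 hx).1
    have h2 := hLrep y (mem_filter.1 hy).1
    exact hxy (h1.2.1.eq h2.2.1 h1.1 h2.1 (hj.2.symm.trans hj'.2))
  have hCsame : ∀ i ∈ I, ∀ j ∈ C i, j < D.n ∧ D.Same j (t i) := fun i hi j hj => by
    have := hCsub i hi hj
    simpa [hCl] using this
  have hdis2 : Set.PairwiseDisjoint (I : Set ℕ) C := by
    intro x hx y hy hxy
    rw [Function.onFun, disjoint_left]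
    intro j hj hj'
    exact hxy (hinj x hx y hy ((hCsame x hx j hj).2.symm.trans (hCsame y hy j hj').2))
  have hdis3 : Disjoint (L'.biUnion Cl) (I.biUnion C) := by
    rw [disjoint_left]
    intro j hj hj'
    simp only [mem_biUnion] at hj hj'
    obtain ⟨x, hx, hjx⟩ := hj
    obtain ⟨i, hi, hji⟩ := hj'
    have h1 := hLrep x (mem_filter.1 hx).1
    have h2 := hCsame i hi j hji
    simp only [hCl, mem_filter] at hjx
    exact (mem_filter.1 hx).2 i hi
      ((hfit i hi).1.1.eq h1.2.1 (htn i hi) h1.1 (h2.2.symm.trans hjx.2))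
  set N := L'.biUnion Cl ∪ I.biUnion C with hN
  set γ : ℕ → ℕ → ℕ := fun j =>
    if H : ∃ i ∈ I, D.Same j (t i) then c (G.kap H.choose) else D.col (D.rep j) with hγ
  have hγC : ∀ i ∈ I, ∀ j ∈ C i, γ j = c (G.kap i) := by
    intro i hi j hj
    have H : ∃ i ∈ I, D.Same j (t i) := ⟨i, hi, (hCsame i hi j hj).2⟩
    obtain ⟨h1, h2⟩ := H.choose_spec
    have e := hinj _ h1 i hi (h2.symm.trans (hCsame i hi j hj).2)
    simp only [hγ, H, dif_pos]
    rw [e]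
  have hγL : ∀ x ∈ L', ∀ j ∈ Cl x, γ j = D.col x := by
    intro x hx j hj
    have h1 := hLrep x (mem_filter.1 hx).1
    simp only [hCl, mem_filter, mem_range] at hj
    have H : ¬ ∃ i ∈ I, D.Same j (t i) := by
      rintro ⟨i, hi, hs⟩
      exact (mem_filter.1 hx).2 i hi
        ((hfit i hi).1.1.eq h1.2.1 (htn i hi) h1.1 (hs.symm.trans hj.2))
    simp only [hγ, H, dif_neg, not_false_eq_true]
    rw [hj.2.rep_eq, h1.2.1.rep_eq h1.1]
  have hLcard : #L = #L' + #J := by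
    rw [hLsplit, card_union_of_disjoint hLdisj, card_image_of_injOn hJinj]
  obtain ⟨hacc1, hacc2⟩ := hacc
  have hJ' : {i ∈ range (2 * D.B) | D.Used G i ∧ G.fl i ≠ 0} = J := by
    rw [hJ, hI, filter_filter]
  rw [hJ', ← hL] at hacc1
  rw [← hI] at hacc2
  refine ⟨N, ?_, ?_, γ, ?_, ?_, ?_⟩
  · intro j hj
    simp only [hN, mem_union, mem_biUnion] at hj
    rcases hj with ⟨x, -, hj⟩ | ⟨i, hi, hj⟩
    · exact (mem_filter.1 hj).1
    · exact mem_range.2 (hCsame i hi j hj).1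
  · have hNcard : #N = ∑ x ∈ L', D.mult x + ∑ i ∈ I, D.cov G i (t i) := by
      rw [hN, card_union_of_disjoint hdis3, card_biUnion hdis1, card_biUnion hdis2]
      congr 1
      exact sum_congr rfl hCcard
    have htotal : ∑ s ∈ D.leaders G, D.leafVal G s (h s) = ∑ i ∈ I, D.gain G i (t i) := by
      calc _ = ∑ s ∈ D.leaders G, ∑ i ∈ I with G.kap i = s, D.gain G i (t i) := by
            refine sum_congr rfl fun s hs => ?_
            have := hpos s hs
            unfold leafVal at this ⊢
            split_ifs at this ⊢ with hall
            · rw [← sum_filter]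
              have hfil : {i ∈ range (2 * D.B) | G.kap i = s} = {i ∈ I | G.kap i = s} := by
                ext i
                simp only [hI, mem_filter]
                constructor
                · rintro ⟨h1, h2⟩
                  refine ⟨⟨h1, ?_⟩, h2⟩
                  change G.kap i < 2 * D.B
                  rw [h2]
                  exact mem_range.1 (mem_filter.1 hs).1
                · rintro ⟨⟨h1, -⟩, h2⟩; exact ⟨h1, h2⟩
              rw [hfil]
              refine sum_congr rfl fun i hi => ?_
              simp only [mem_filter] at hi
              rw [hgain i hi.1, hi.2]
            · exact absurd rfl this
        _ = ∑ i ∈ I, D.gain G i (t i) := sum_fiberwise_of_maps_to hlead _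
    have hsumL : (∑ j ∈ range D.n, if D.Large G j then D.mult j else 0) =
        ∑ x ∈ L', D.mult x + ∑ i ∈ I, if G.fl i ≠ 0 then D.mult (t i) else 0 := by
      rw [← sum_filter, ← hL, hLsplit, sum_union hLdisj, sum_image hJinj]
      congr 1
      rw [hJ, sum_filter]
    have hgsum : ∑ i ∈ I, D.gain G i (t i) + ∑ i ∈ I, (if G.fl i ≠ 0 then D.mult (t i) else 0) =
        D.n * #I + ∑ i ∈ I, D.cov G i (t i) := by
      rw [← sum_add_distrib, sum_congr rfl fun i _ => gain_add i (t i), sum_add_distrib, sum_const,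
        smul_eq_mul, mul_comm]
    rw [htotal, hsumL] at hacc2
    rw [hNcard]
    omega
  · have hsub : N.image γ ⊆ (D.leaders G).image c ∪ L'.image D.col := by
      intro f hf
      obtain ⟨j, hj, rfl⟩ := mem_image.1 hf
      simp only [hN, mem_union, mem_biUnion] at hj
      rcases hj with ⟨x, hx, hj⟩ | ⟨i, hi, hj⟩
      · rw [hγL x hx j hj]
        exact mem_union_right _ (mem_image_of_mem _ hx)
      · rw [hγC i hi j hj]
        exact mem_union_left _ (mem_image_of_mem _ (hlead i hi))
    have h1 := card_le_card hsub
    have h2 := card_union_le ((D.leaders G).image c) (L'.image D.col)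
    have h3 := card_image_le (s := D.leaders G) (f := c)
    have h4 := card_image_le (s := L') (f := D.col)
    omega
  · intro j hj r hr
    simp only [hN, mem_union, mem_biUnion] at hj
    rcases hj with ⟨x, hx, hj⟩ | ⟨i, hi, hj⟩
    · rw [hγL x hx j hj]
      exact hal x (hLrep x (mem_filter.1 hx).1).1 r hr
    · rw [hγC i hi j hj]
      exact hcal _ (hlead i hi) r hr
  · rw [hN, sum_union hdis3, sum_biUnion hdis1, sum_biUnion hdis2]
    have h1 : ∑ x ∈ L', ∑ j ∈ Cl x, D.dist j (γ j) = 0 := by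
      refine sum_eq_zero fun x hx => sum_eq_zero fun j hj => ?_
      rw [hγL x hx j hj, dist_col_eq_zero]
      exact (mem_filter.1 hj).2
    have h2 : ∑ i ∈ I, ∑ j ∈ C i, D.dist j (γ j) ≤ ∑ i ∈ I, G.us i * G.ds i := by
      refine sum_le_sum fun i hi => ?_
      have hdi : ∀ j ∈ C i, D.dist j (γ j) ≤ G.ds i := by
        intro j hj
        rw [hγC i hi j hj, (hCsame i hi j hj).2.dist_eq]
        exact (hcd _ (hlead i hi) _).trans (hfit i hi).2
      calc ∑ j ∈ C i, D.dist j (γ j) ≤ #(C i) • G.ds i := sum_le_card_nsmul _ _ _ hdi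
        _ = D.cov G i (t i) * G.ds i := by rw [hCcard i hi, smul_eq_mul]
        _ ≤ G.us i * G.ds i := by
            -- A slot with distance 0 may cover more than `us` columns, but they are free.
            unfold cov
            split_ifs with e
            · simp [e]
            · exact le_rfl
    have h3 := hG.cost
    rw [← sum_filter, ← hI] at h3
    omega

end Data

end ColumnOutliers


/-! ### Normal form of a clustering -/

namespace ColumnOutliers

open Finset
open scoped Classical

namespace Data

variable {D : Data}

/-- The structure of an optimal clustering: the kinds of columns in `Sp` are assigned to centers that
serve some column at a positive distance, `u t` columns of kind `t` are covered, and the kinds in `H`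
are centers of clusters of equal columns. -/
structure Plan (D : Data) where
  Sp : Finset ℕ
  H : Finset ℕ
  γ : ℕ → ℕ → ℕ
  u : ℕ → ℕ
  sp_rep : ∀ t ∈ Sp, t < D.n ∧ D.Rep t
  h_rep : ∀ t ∈ H, t < D.n ∧ D.Rep t
  disj : Disjoint Sp H
  card_sp : #Sp ≤ 2 * D.B
  card_le : #H + #(Sp.image γ) ≤ D.k
  u_pos : ∀ t ∈ Sp, 1 ≤ u t
  u_le : ∀ t ∈ Sp, u t ≤ D.mult t
  covers : D.n ≤ ∑ t ∈ H, D.mult t + ∑ t ∈ Sp, u t + D.l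
  cost : ∑ t ∈ Sp, u t * D.dist t (γ t) ≤ D.B
  values : ∀ t ∈ Sp, ∀ r < D.m, ∃ v < D.sig, γ t r = D.al v
  majority : ∀ x ∈ Sp, ∀ r < D.m, γ x r ≠ D.A r x →
    ∑ t ∈ Sp with γ t = γ x, u t ≤ 2 * ∑ t ∈ Sp with γ t = γ x ∧ D.A r t ≠ D.A r x, u t

/-- `γ` assigns at most `k` centers over the alphabet to the columns in `N`. -/
def Feasible (D : Data) (N : Finset ℕ) (γ : ℕ → ℕ → ℕ) : Prop :=
  #(N.image γ) ≤ D.k ∧ ∀ j ∈ N, ∀ r < D.m, ∃ v < D.sig, γ j r = D.al v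

/-- In an assignment of least cost, every column is reassigned to a nearest used center. The choice
is a function of `D.dist j` rather than of `j`, so equal columns receive the same center. Neither
the cost nor the set of centers grows. -/
theorem exists_optimal {N : Finset ℕ} {γ₀ : ℕ → ℕ → ℕ} (h : D.Feasible N γ₀) :
    ∃ γ, D.Feasible N γ ∧ (∑ j ∈ N, D.dist j (γ j) ≤ ∑ j ∈ N, D.dist j (γ₀ j)) ∧
      (∀ i j, D.Same i j → γ i = γ j) ∧
      ∀ γ', D.Feasible N γ' → ∑ j ∈ N, D.dist j (γ j) ≤ ∑ j ∈ N, D.dist j (γ' j) := by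
  have hex : ∃ v, ∃ γ, D.Feasible N γ ∧ ∑ j ∈ N, D.dist j (γ j) = v := ⟨_, γ₀, h, rfl⟩
  obtain ⟨γ₁, hγ₁, hv⟩ := Nat.find_spec hex
  have hmin : ∀ γ', D.Feasible N γ' → ∑ j ∈ N, D.dist j (γ₁ j) ≤ ∑ j ∈ N, D.dist j (γ' j) := by
    intro γ' h'
    rw [hv]
    exact Nat.find_min' hex ⟨γ', h', rfl⟩
  set C := N.image γ₁
  set pick : ((ℕ → ℕ) → ℕ) → ℕ → ℕ := fun F =>
    if H : ∃ c ∈ C, ∀ c' ∈ C, F c ≤ F c' then H.choose else fun _ => 0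
  have hpick : ∀ j ∈ N, pick (D.dist j) ∈ C ∧ ∀ c' ∈ C, D.dist j (pick (D.dist j)) ≤ D.dist j c' := by
    intro j hj
    have H : ∃ c ∈ C, ∀ c' ∈ C, D.dist j c ≤ D.dist j c' :=
      exists_min_image C (D.dist j) ⟨_, mem_image_of_mem γ₁ hj⟩
    simp only [pick, H, dif_pos]
    exact H.choose_spec
  have hle : ∑ j ∈ N, D.dist j (pick (D.dist j)) ≤ ∑ j ∈ N, D.dist j (γ₁ j) :=
    sum_le_sum fun j hj => (hpick j hj).2 _ (mem_image_of_mem γ₁ hj)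
  refine ⟨fun j => pick (D.dist j), ⟨?_, ?_⟩, hle.trans (hmin _ h), fun i j hij => ?_,
    fun γ' h' => hle.trans (hmin γ' h')⟩
  · refine (card_le_card ?_).trans hγ₁.1
    intro f hf
    obtain ⟨j, hj, rfl⟩ := mem_image.1 hf
    exact (hpick j hj).1
  · intro j hj
    obtain ⟨i, hi, he⟩ := mem_image.1 (hpick j hj).1
    change ∀ r < D.m, ∃ v < D.sig, pick (D.dist j) r = D.al v
    rw [← he]
    exact hγ₁.2 i hi
  · have : D.dist i = D.dist j := funext fun c => hij.dist_eq c
    simp only [this]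

theorem dist_update (j r : ℕ) (hr : r < D.m) (c : ℕ → ℕ) (v : ℕ) :
    D.dist j (Function.update c r v) + (if D.A r j ≠ c r then 1 else 0) =
      D.dist j c + if D.A r j ≠ v then 1 else 0 := by
  have hmem : r ∈ range D.m := mem_range.2 hr
  simp only [dist, card_filter]
  rw [← add_sum_erase _ _ hmem, ← add_sum_erase (range D.m) (fun r => if D.A r j ≠ c r then 1 else 0)
    hmem]
  have : ∑ x ∈ (range D.m).erase r, (if D.A x j ≠ Function.update c r v x then 1 else 0) =
      ∑ x ∈ (range D.m).erase r, if D.A x j ≠ c x then 1 else 0 := by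
    refine sum_congr rfl fun x hx => ?_
    rw [Function.update_of_ne (ne_of_mem_erase hx)]
  rw [this, Function.update_self]
  omega

/-- In an optimal assignment, every other value occurs at most as often as the value of the center. -/
theorem majority_of_optimal {N : Finset ℕ} {γ : ℕ → ℕ → ℕ} (hf : D.Feasible N γ)
    (hmin : ∀ γ', D.Feasible N γ' → ∑ j ∈ N, D.dist j (γ j) ≤ ∑ j ∈ N, D.dist j (γ' j))
    (c : ℕ → ℕ) {r : ℕ} (hr : r < D.m) {v : ℕ} (hv : ∃ w < D.sig, v = D.al w) (hne : c r ≠ v) :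
    #{j ∈ N | γ j = c} ≤ 2 * #{j ∈ N | γ j = c ∧ D.A r j ≠ v} := by
  -- Exchange argument: the letter `v` replaces `c r` in this one center. The new centers are the
  -- image of the old ones under a map, so there are no more of them. Every column disagrees with `c
  -- r` or with `v`, which turns the comparison of costs into a majority.
  set c' := Function.update c r v
  set γ' : ℕ → ℕ → ℕ := fun j => if γ j = c then c' else γ j
  have hf' : D.Feasible N γ' := by
    constructor
    · have : N.image γ' = (N.image γ).image (fun f => if f = c then c' else f) := by
        rw [image_image]; rfl
      rw [this]
      exact card_image_le.trans hf.1
    · intro j hj x hx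
      simp only [γ']
      split_ifs with e
      · by_cases hxr : x = r
        · subst hxr
          simpa [c'] using hv
        · simp only [c', Function.update_of_ne hxr, ← e]
          exact hf.2 j hj x hx
      · exact hf.2 j hj x hx
  have h1 := hmin γ' hf'
  rw [← sum_filter_add_sum_filter_not N (fun j => γ j = c) (fun j => D.dist j (γ j)),
    ← sum_filter_add_sum_filter_not N (fun j => γ j = c) (fun j => D.dist j (γ' j))] at h1
  have h2 : ∑ j ∈ N with ¬ γ j = c, D.dist j (γ' j) = ∑ j ∈ N with ¬ γ j = c, D.dist j (γ j) :=
    sum_congr rfl fun j hj => by simp only [γ', (mem_filter.1 hj).2, if_false]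
  have h3 : ∑ j ∈ N with γ j = c, D.dist j (γ' j) +
      ∑ j ∈ N with γ j = c, (if D.A r j ≠ c r then 1 else 0) =
      ∑ j ∈ N with γ j = c, D.dist j (γ j) +
      ∑ j ∈ N with γ j = c, (if D.A r j ≠ v then 1 else 0) := by
    rw [← sum_add_distrib, ← sum_add_distrib]
    refine sum_congr rfl fun j hj => ?_
    have e := (mem_filter.1 hj).2
    simp only [γ', e, if_true]
    exact dist_update j r hr c v
  have h4 : ∑ j ∈ N with γ j = c, (if D.A r j ≠ c r then 1 else 0) ≤
      ∑ j ∈ N with γ j = c, (if D.A r j ≠ v then 1 else 0) := by omega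
  have h5 : #{j ∈ N | γ j = c} ≤ ∑ j ∈ N with γ j = c, (if D.A r j ≠ c r then 1 else 0) +
      ∑ j ∈ N with γ j = c, (if D.A r j ≠ v then 1 else 0) := by
    rw [← sum_add_distrib, card_eq_sum_ones]
    refine sum_le_sum fun j _ => ?_
    by_cases e : D.A r j = v
    · have : D.A r j ≠ c r := by rw [e]; exact hne.symm
      simp [this]
    · simp [e]
  have h6 : ∑ j ∈ N with γ j = c, (if D.A r j ≠ v then 1 else 0) =
      #{j ∈ N | γ j = c ∧ D.A r j ≠ v} := by
    rw [← card_filter, filter_filter]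
  omega

/-- The set `S` of columns at positive distance has at most `B` elements, and so does the set `CS`
of their centers. A column served by `CS` lies in `S` or equals a center in `CS`, which gives at
most `2 * B` kinds. The columns with other centers equal their centers, so their kinds, collected in
`H`, are in bijection with these centers. -/
theorem exists_plan (hal : ∀ j < D.n, ∀ r < D.m, ∃ v < D.sig, D.A r j = D.al v) (h : D.Core) :
    Nonempty D.Plan := by
  obtain ⟨N, hN, hNl, γ₀, hk₀, hv₀, hc₀⟩ := h
  obtain ⟨γ, hf, hle, hsame, hmin⟩ := exists_optimal (N := N) (γ₀ := γ₀) ⟨hk₀, hv₀⟩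
  have hcost : ∑ j ∈ N, D.dist j (γ j) ≤ D.B := hle.trans hc₀
  have hNn : ∀ j ∈ N, j < D.n := fun j hj => mem_range.1 (hN hj)
  have hrep : ∀ j, γ (D.rep j) = γ j := fun j => hsame _ _ (same_rep j)
  have hdrep : ∀ j, D.dist (D.rep j) (γ (D.rep j)) = D.dist j (γ j) := fun j => by
    rw [hrep, (same_rep j).dist_eq]
  have hrepn : ∀ j ∈ N, D.rep j < D.n ∧ D.Rep (D.rep j) := fun j hj =>
    ⟨(rep_le j).trans_lt (hNn j hj), rep_rep j⟩
  have hzero : ∀ i j, D.dist i (γ i) = 0 → D.dist j (γ j) = 0 → γ i = γ j → D.Same i j := by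
    intro i j hi hj e r hr
    simp only [dist, card_eq_zero, filter_eq_empty_iff, mem_range, not_not] at hi hj
    rw [hi hr, hj hr, e]
  set S := {j ∈ N | D.dist j (γ j) ≠ 0} with hS
  have hSB : #S ≤ D.B := by
    refine le_trans ?_ hcost
    calc #S = ∑ j ∈ S, 1 := card_eq_sum_ones S
      _ ≤ ∑ j ∈ S, D.dist j (γ j) :=
          sum_le_sum fun j hj => Nat.one_le_iff_ne_zero.2 (mem_filter.1 hj).2
      _ ≤ _ := sum_le_sum_of_subset (filter_subset _ _)
  set CS := S.image γ with hCS
  have hCSB : #CS ≤ D.B := card_image_le.trans hSB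
  set N₁ := {j ∈ N | γ j ∈ CS} with hN₁
  set N₂ := {j ∈ N | γ j ∉ CS} with hN₂
  have hN₂0 : ∀ j ∈ N₂, D.dist j (γ j) = 0 := by
    intro j hj
    by_contra hne
    have hj' := mem_filter.1 hj
    exact hj'.2 (mem_image_of_mem γ (mem_filter.2 ⟨hj'.1, hne⟩))
  set Sp := N₁.image D.rep with hSp
  set H := N₂.image D.rep with hH
  have hSpγ : Sp.image γ = CS := by
    ext f
    simp only [hSp, image_image, mem_image, Function.comp, hrep]
    constructor
    · rintro ⟨j, hj, rfl⟩; exact (mem_filter.1 hj).2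
    · intro hf
      obtain ⟨j, hj, rfl⟩ := mem_image.1 hf
      exact ⟨j, mem_filter.2 ⟨(mem_filter.1 hj).1, mem_image_of_mem γ hj⟩, rfl⟩
  have hdisj : Disjoint Sp H := by
    rw [disjoint_left]
    intro t ht ht'
    obtain ⟨j, hj, rfl⟩ := mem_image.1 ht
    obtain ⟨i, hi, e⟩ := mem_image.1 ht'
    have h1 : γ i = γ j := by rw [← hrep i, e, hrep j]
    exact (mem_filter.1 hi).2 (by rw [h1]; exact (mem_filter.1 hj).2)
  have hinj : ∀ (M : Finset ℕ), M ⊆ N → (∀ j ∈ M, D.dist j (γ j) = 0) →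
      Set.InjOn γ (M.image D.rep : Finset ℕ) := by
    intro M hM h0 x hx y hy e
    obtain ⟨i, hi, rfl⟩ := mem_image.1 (mem_coe.1 hx)
    obtain ⟨j, hj, rfl⟩ := mem_image.1 (mem_coe.1 hy)
    rw [hrep, hrep] at e
    exact (hzero i j (h0 i hi) (h0 j hj) e).rep_eq
  set u : ℕ → ℕ := fun t => #{j ∈ N | D.rep j = t} with hu
  -- Weighted sums over kinds are counts of columns, for properties that depend on the kind only.
  -- This transfers coverage and majority from columns to kinds.
  have hfib : ∀ (p : ℕ → Prop) [DecidablePred p], (∀ j, p (D.rep j) ↔ p j) →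
      ∑ t ∈ Sp with p t, u t = #{j ∈ N₁ | p j} := by
    intro p _ hp
    rw [card_eq_sum_card_fiberwise (f := D.rep) (t := Sp.filter p)]
    · refine sum_congr rfl fun t ht => ?_
      simp only [hu]
      congr 1
      ext j
      simp only [mem_filter, hN₁]
      constructor
      · rintro ⟨hj, rfl⟩
        obtain ⟨ht1, ht2⟩ := mem_filter.1 ht
        have : γ (D.rep j) ∈ CS := by rw [← hSpγ]; exact mem_image_of_mem γ ht1
        rw [hrep] at this
        exact ⟨⟨⟨hj, this⟩, (hp j).1 ht2⟩, rfl⟩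
      · rintro ⟨⟨⟨hj, -⟩, -⟩, e⟩; exact ⟨hj, e⟩
    · intro j hj
      obtain ⟨h1, h2⟩ := mem_filter.1 (mem_coe.1 hj)
      exact mem_coe.2 (mem_filter.2 ⟨mem_image_of_mem _ h1, (hp j).2 h2⟩)
  have hsp : ∀ t ∈ Sp, ∃ j ∈ N, D.rep j = t ∧ γ j = γ t := by
    intro t ht
    obtain ⟨j, hj, rfl⟩ := mem_image.1 ht
    exact ⟨j, (mem_filter.1 hj).1, rfl, (hrep j).symm⟩
  have hu_le : ∀ t, u t ≤ D.mult t := by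
    intro t
    refine card_le_card fun j hj => ?_
    obtain ⟨hjN, rfl⟩ := mem_filter.1 hj
    exact mem_filter.2 ⟨hN hjN, (same_rep j).symm⟩
  refine ⟨⟨Sp, H, γ, u, ?_, ?_, hdisj, ?_, ?_, ?_, fun t _ => hu_le t, ?_, ?_, ?_, ?_⟩⟩
  · intro t ht
    obtain ⟨j, hj, rfl⟩ := mem_image.1 ht
    exact hrepn j (mem_filter.1 hj).1
  · intro t ht
    obtain ⟨j, hj, rfl⟩ := mem_image.1 ht
    exact hrepn j (mem_filter.1 hj).1
  · have hsub : Sp ⊆ S.image D.rep ∪ (N₁ \ S).image D.rep := by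
      rw [← image_union]
      exact image_subset_image fun j hj => by simp [hj]
    have h1 : #((N₁ \ S).image D.rep) ≤ #CS := by
      have hz : ∀ j ∈ N₁ \ S, D.dist j (γ j) = 0 := by
        intro j hj
        obtain ⟨h1, h2⟩ := mem_sdiff.1 hj
        by_contra hne
        exact h2 (mem_filter.2 ⟨(mem_filter.1 h1).1, hne⟩)
      refine card_le_card_of_injOn γ ?_ (hinj (N₁ \ S)
        (sdiff_subset.trans (filter_subset _ _)) hz)
      intro t ht
      obtain ⟨j, hj, rfl⟩ := mem_image.1 (mem_coe.1 ht)
      rw [hrep]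
      exact mem_coe.2 (mem_filter.1 (mem_sdiff.1 hj).1).2
    have h2 := card_le_card hsub
    have h3 := card_union_le (S.image D.rep) ((N₁ \ S).image D.rep)
    have h4 := card_image_le (s := S) (f := D.rep)
    omega
  · rw [hSpγ, ← card_image_of_injOn (hinj N₂ (filter_subset _ _) hN₂0), ← card_union_of_disjoint]
    · refine (card_le_card ?_).trans hf.1
      intro f hf
      rcases mem_union.1 hf with hf | hf
      · obtain ⟨t, ht, rfl⟩ := mem_image.1 hf
        obtain ⟨j, hj, rfl⟩ := mem_image.1 ht
        rw [hrep]
        exact mem_image_of_mem γ (mem_filter.1 hj).1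
      · obtain ⟨j, hj, rfl⟩ := mem_image.1 hf
        exact mem_image_of_mem γ (mem_filter.1 hj).1
    · rw [disjoint_left]
      intro f hf hf'
      obtain ⟨t, ht, rfl⟩ := mem_image.1 hf
      obtain ⟨j, hj, rfl⟩ := mem_image.1 ht
      rw [hrep] at hf'
      exact (mem_filter.1 hj).2 hf'
  · intro t ht
    obtain ⟨j, hj, e, -⟩ := hsp t ht
    exact card_pos.2 ⟨j, mem_filter.2 ⟨hj, e⟩⟩
  · have h1 : #N = #N₁ + #N₂ := (card_filter_add_card_filter_not _).symm
    have h2 := hfib (fun _ => True) (fun _ => Iff.rfl)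
    simp only [filter_true] at h2
    -- All copies of a kind in `H` may be covered, even those that were outliers, because they are
    -- free.
    have h3 : #N₂ ≤ ∑ t ∈ H, D.mult t := by
      rw [card_eq_sum_card_fiberwise (f := D.rep) (t := H)]
      · refine sum_le_sum fun t _ => le_trans (card_le_card ?_) (hu_le t)
        exact filter_subset_filter _ (filter_subset _ _)
      · exact fun j hj => mem_coe.2 (mem_image_of_mem _ (mem_coe.1 hj))
    omega
  · refine le_trans ?_ hcost
    have h1 : ∑ t ∈ Sp, u t * D.dist t (γ t) =
        ∑ t ∈ Sp, ∑ j ∈ N with D.rep j = t, D.dist j (γ j) := by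
      refine sum_congr rfl fun t _ => ?_
      simp only [hu]
      rw [← smul_eq_mul, ← sum_const]
      refine sum_congr rfl fun j hj => ?_
      rw [← (mem_filter.1 hj).2, hdrep]
    rw [h1, ← sum_biUnion]
    · refine sum_le_sum_of_subset fun j hj => ?_
      obtain ⟨t, -, hj⟩ := mem_biUnion.1 hj
      exact (mem_filter.1 hj).1
    · intro x _ y _ hxy
      rw [Function.onFun, disjoint_left]
      intro j hj hj'
      exact hxy ((mem_filter.1 hj).2.symm.trans (mem_filter.1 hj').2)
  · intro t ht r hr
    obtain ⟨j, hj, -, e⟩ := hsp t ht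
    rw [← e]
    exact hf.2 j hj r hr
  · intro x hx r hr hne
    obtain ⟨i, hi, rfl, -⟩ := hsp x hx
    have hxn := hrepn i hi
    have hmaj := majority_of_optimal hf hmin (γ (D.rep i)) hr (hal _ hxn.1 r hr) hne
    have hcs : γ (D.rep i) ∈ CS := by rw [← hSpγ]; exact mem_image_of_mem γ hx
    rw [hfib (fun t => γ t = γ (D.rep i)) (fun j => by rw [hrep j]),
      hfib (fun t => γ t = γ (D.rep i) ∧ D.A r t ≠ D.A r (D.rep i)) (fun j => by
        rw [hrep j, same_rep j r hr])]
    have e1 : {j ∈ N₁ | γ j = γ (D.rep i)} = {j ∈ N | γ j = γ (D.rep i)} := by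
      rw [hN₁, filter_filter]
      exact filter_congr fun j _ => ⟨fun h => h.2, fun h => ⟨by rw [h]; exact hcs, h⟩⟩
    have e2 : {j ∈ N₁ | γ j = γ (D.rep i) ∧ D.A r j ≠ D.A r (D.rep i)} =
        {j ∈ N | γ j = γ (D.rep i) ∧ D.A r j ≠ D.A r (D.rep i)} := by
      rw [hN₁, filter_filter]
      exact filter_congr fun j _ => ⟨fun h => h.2, fun h => ⟨by rw [h.1]; exact hcs, h⟩⟩
    rw [e1, e2]
    exact hmaj

end Data

end ColumnOutliers


/-! ### Completeness of the guesses -/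

namespace ColumnOutliers

open Finset
open scoped Classical

/-- The bounds for the entries of a guess. -/
structure Guess.Small (D : Data) (G : Guess) : Prop where
  P : G.P ≤ 2 * D.n
  a : G.a ≤ 2 * D.n
  θ : G.θ ≤ D.n * D.n + D.n + 1
  kap : ∀ i, G.kap i ≤ 2 * D.B
  chi : ∀ i, G.chi i < D.colors
  fl : ∀ i, G.fl i ≤ 1
  us : ∀ i, G.us i ≤ D.B + 1
  ds : ∀ i, G.ds i ≤ D.B
  tau : ∀ i, G.tau i ≤ 1
  rest : ∀ i, 2 * D.B ≤ i →
    G.kap i = 2 * D.B ∧ G.chi i = 0 ∧ G.fl i = 0 ∧ G.us i = 0 ∧ G.ds i = 0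
  tau_rest : ∀ i, D.B ≤ i → G.tau i = 0

theorem exists_enumeration (S : Finset ℕ) : ∃ tt ix : ℕ → ℕ,
    (∀ i < #S, tt i ∈ S ∧ ix (tt i) = i) ∧ ∀ t ∈ S, ix t < #S ∧ tt (ix t) = t := by
  refine ⟨fun i => if h : i < #S then (S.equivFin.symm ⟨i, h⟩ : ℕ) else 0,
    fun t => if h : t ∈ S then S.equivFin ⟨t, h⟩ else 0, fun i hi => ?_, fun t ht => ?_⟩
  · simp [hi]
  · simp [ht]

theorem sum_enumeration {S : Finset ℕ} {tt ix : ℕ → ℕ}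
    (h1 : ∀ i < #S, tt i ∈ S ∧ ix (tt i) = i) (h2 : ∀ t ∈ S, ix t < #S ∧ tt (ix t) = t)
    {K : ℕ} (hK : #S ≤ K) (F : ℕ → ℕ) :
    (∑ i ∈ range K, if i < #S then F (tt i) else 0) = ∑ t ∈ S, F t := by
  rw [← sum_filter]
  have : {i ∈ range K | i < #S} = range #S := by
    ext i; simp only [mem_filter, mem_range]; omega
  rw [this]
  exact sum_nbij' tt ix (fun i hi => (h1 i (mem_range.1 hi)).1)
    (fun t ht => mem_range.2 (h2 t ht).1) (fun i hi => (h1 i (mem_range.1 hi)).2)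
    (fun t ht => (h2 t ht).2) fun _ _ => rfl

theorem exists_listing (F : Finset ℕ) (p : ℕ → ℕ → Prop) (hp : ∀ r ∈ F, ∃ v, p r v) :
    ∃ pos val : ℕ → ℕ, (∀ a < #F, pos a ∈ F ∧ p (pos a) (val a)) ∧
      ∀ r ∈ F, ∃ a < #F, pos a = r := by
  obtain ⟨tt, ix, h1, h2⟩ := exists_enumeration F
  choose! v hv using hp
  exact ⟨tt, fun a => v (tt a), fun a ha => ⟨(h1 a ha).1, hv _ (h1 a ha).1⟩,
    fun r hr => ⟨ix r, (h2 r hr).1, (h2 r hr).2⟩⟩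

/-- The offsets of consecutive blocks determine the block. -/
theorem block_injective {K : ℕ} {d : ℕ → ℕ} {i i' a a' : ℕ} (hi : i < K) (hi' : i' < K)
    (ha : a < d i) (ha' : a' < d i')
    (h : (∑ x ∈ range K, if x < i then d x else 0) + a =
      (∑ x ∈ range K, if x < i' then d x else 0) + a') : i = i' ∧ a = a' := by
  have key : ∀ i < K, (∑ x ∈ range K, if x < i then d x else 0) = ∑ x ∈ range i, d x := by
    intro i hi
    rw [← sum_filter]
    congr 1
    ext x; simp only [mem_filter, mem_range]; omega
  rw [key i hi, key i' hi'] at h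
  have mono : ∀ {i i'}, i < i' → ∑ x ∈ range i, d x + d i ≤ ∑ x ∈ range i', d x := by
    intro i i' h
    rw [← sum_range_succ]
    exact sum_le_sum_of_subset (range_subset_range.2 h)
  rcases lt_trichotomy i i' with h1 | rfl | h1
  · have := mono h1; omega
  · exact ⟨rfl, by omega⟩
  · have := mono h1; omega

/-! ### The guess made from a plan. -/

namespace Data

variable {D : Data}

theorem dist_col_le (i j : ℕ) (c : ℕ → ℕ) : D.dist j (D.col i) ≤ D.dist i c + D.dist j c := by
  unfold dist
  rw [add_comm]
  refine (card_le_card fun r hr => ?_).trans (card_union_le _ _)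
  obtain ⟨hr1, hr2⟩ := mem_filter.1 hr
  by_cases e : D.A r j = c r
  · exact mem_union_right _ (mem_filter.2 ⟨hr1, fun e' => hr2 (e.trans e'.symm)⟩)
  · exact mem_union_left _ (mem_filter.2 ⟨hr1, e⟩)

theorem leafVal_of_fit {G : Guess} {s : ℕ} {h : ℕ → ℕ} (t : ℕ → ℕ)
    (ht : ∀ i < 2 * D.B, G.kap i = s → t i < D.n ∧ D.Fit G s h i (t i) ∧ D.gain G i (t i) ≠ 0) :
    (∑ i ∈ range (2 * D.B), if G.kap i = s then D.gain G i (t i) else 0) ≤ D.leafVal G s h := by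
  have hle : ∀ i < 2 * D.B, G.kap i = s → D.gain G i (t i) ≤ D.top G s h i := by
    intro i hi hs
    obtain ⟨h1, h2, -⟩ := ht i hi hs
    have hsub : range (D.gain G i (t i)) ⊆
        {v ∈ range (2 * D.n + 1) | ∃ j < D.n, D.Fit G s h i j ∧ v < D.gain G i j} := by
      intro v hv
      have hv' := mem_range.1 hv
      exact mem_filter.2 ⟨mem_range.2 (hv'.trans (gain_lt h2.1)), t i, h1, h2, hv'⟩
    simpa [top] using card_le_card hsub
  unfold leafVal
  rw [if_pos]
  · refine sum_le_sum fun i hi => ?_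
    split_ifs with e
    · exact hle i (mem_range.1 hi) e
    · exact le_rfl
  · intro i hi hs
    have := hle i hi hs
    have := (ht i hi hs).2.2
    omega

theorem Accepts.mono {G : Guess} {a b : ℕ} (h : D.Accepts G a) (hab : a ≤ b) : D.Accepts G b :=
  ⟨h.1, h.2.trans (by omega)⟩

/-- The slots enumerate the special kinds, and the kind nearest to the center leads its cluster. The
changes list the rows in which the leading column differs from the center, with the letters of the
center, and the marks record which kinds differ from the leading column in these rows. The majority
property of the plan is the cover condition. -/
theorem exists_guess (hn : 0 < D.n) (π : D.Plan) :
    ∃ G : Guess, G.Small D ∧ D.Consistent G ∧ ∃ h : ℕ → ℕ → ℕ,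
      (∀ s ∈ D.leaders G, (∀ t ≤ G.ds s, D.Good G s t (h s)) ∧ D.leafVal G s (h s) ≠ 0) ∧
      D.Accepts G (∑ s ∈ D.leaders G, D.leafVal G s (h s)) := by
  obtain ⟨Sp, H, γ, u, hsp, hh, hdisj, hcsp, hck, hu1, hule, hcov, hcost, hval, hmaj⟩ := π
  obtain ⟨P, a, hP, ha, hhash⟩ := exists_hash_injOn (Q := D.colors) hn Sp (fun t ht => (hsp t ht).1)
    (by
      have := Nat.mul_le_mul hcsp hcsp
      unfold colors
      nlinarith)
  set dd : ℕ → ℕ := fun t => D.dist t (γ t) with hdd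
  -- At positive distance the cost bounds the multiplicity by `B`. At distance 0 it may be large,
  -- but there `cov` takes all copies anyway, so 1 can be guessed.
  set uu : ℕ → ℕ := fun t => if dd t = 0 then 1 else u t with huu
  have huu1 : ∀ t ∈ Sp, 1 ≤ uu t ∧ uu t ≤ u t := by
    intro t ht
    have := hu1 t ht
    simp only [huu]
    split_ifs <;> omega
  have hlead : ∀ c ∈ Sp.image γ, ∃ t ∈ Sp, γ t = c ∧ ∀ t' ∈ Sp, γ t' = c → dd t ≤ dd t' := by
    intro c hc
    obtain ⟨t₀, ht₀, e₀⟩ := mem_image.1 hc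
    obtain ⟨t, ht, hmin⟩ := exists_min_image {t ∈ Sp | γ t = c} dd ⟨t₀, mem_filter.2 ⟨ht₀, e₀⟩⟩
    exact ⟨t, (mem_filter.1 ht).1, (mem_filter.1 ht).2,
      fun t' ht' e => hmin t' (mem_filter.2 ⟨ht', e⟩)⟩
  choose! lead hlS hlγ hlmin using hlead
  have hpos : ∀ c ∈ Sp.image γ, ∃ pos val : ℕ → ℕ,
      (∀ a < dd (lead c), (pos a < D.m ∧ D.A (pos a) (lead c) ≠ c (pos a)) ∧
        val a < D.sig ∧ c (pos a) = D.al (val a)) ∧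
      ∀ r < D.m, D.A r (lead c) ≠ c r → ∃ a < dd (lead c), pos a = r := by
    intro c hc
    obtain ⟨pos, val, h1, h2⟩ := exists_listing {r ∈ range D.m | D.A r (lead c) ≠ c r}
      (fun r v => v < D.sig ∧ c r = D.al v) (fun r hr => by
        have := hval _ (hlS c hc) r (mem_range.1 (mem_filter.1 hr).1)
        rwa [hlγ c hc] at this)
    have hcard : #{r ∈ range D.m | D.A r (lead c) ≠ c r} = dd (lead c) := by
      simp only [hdd, hlγ c hc]; rfl
    rw [hcard] at h1 h2
    simp only [mem_filter, mem_range] at h1 h2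
    exact ⟨pos, val, h1, fun r hr hne => h2 r ⟨hr, hne⟩⟩
  choose! pos val hpv hpsurj using hpos
  obtain ⟨tt, ix, htt, hix⟩ := exists_enumeration Sp
  set q := #Sp with hq
  -- the threshold
  set T := {t ∈ range D.n | D.Rep t ∧ t ∉ Sp} with hT
  -- Orders kinds by multiplicity; ties are broken by the index, which makes the keys distinct.
  set key : ℕ → ℕ := fun t => D.mult t * D.n + t with hkey
  have hHT : H ⊆ T := fun t ht => mem_filter.2 ⟨mem_range.2 (hh t ht).1, (hh t ht).2,
    fun h => disjoint_left.1 hdisj h ht⟩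
  have hTn : ∀ t ∈ T, t < D.n := fun t ht => mem_range.1 (mem_filter.1 ht).1
  obtain ⟨θ, hθ, hθcard⟩ := exists_threshold T key (by
      intro x hx y hy e
      have hx' := hTn x hx
      have hy' := hTn y hy
      simp only [hkey] at e
      have e1 : (D.mult x * D.n + x) % D.n = (D.mult y * D.n + y) % D.n := by rw [e]
      rwa [Nat.mul_add_mod', Nat.mul_add_mod', Nat.mod_eq_of_lt hx', Nat.mod_eq_of_lt hy'] at e1)
    (D.n * D.n + D.n) #H (fun t ht => by
      have := hTn t ht
      have := Nat.mul_le_mul_right D.n (mult_le (D := D) t)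
      simp only [hkey]; omega) (card_le_card hHT)
  have hθsum := sum_le_sum_threshold T H hHT key D.mult (by
    intro x hx y hy e
    have hx' := hTn x hx
    have hy' := hTn y hy
    simp only [hkey] at e
    by_contra hlt
    have : (D.mult y + 1) * D.n ≤ D.mult x * D.n := Nat.mul_le_mul_right _ (by omega)
    rw [add_mul] at this
    omega) θ hθcard
  -- the guess
  set kap : ℕ → ℕ := fun i => if i < q then ix (lead (γ (tt i))) else 2 * D.B with hkap
  set ds : ℕ → ℕ := fun i => if i < q then dd (tt i) else 0 with hds
  set us : ℕ → ℕ := fun i => if i < q then uu (tt i) else 0 with hus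
  set chi : ℕ → ℕ := fun i => if i < q then a * tt i % P % D.colors else 0 with hchi
  set fl : ℕ → ℕ := fun i =>
    if i < q ∧ D.Rep (tt i) ∧ θ ≤ D.mult (tt i) * D.n + tt i then 1 else 0 with hfl
  set mk : ℕ → ℕ → Prop := fun i b =>
    D.A (pos (γ (tt i)) b) (tt i) ≠ D.A (pos (γ (tt i)) b) (lead (γ (tt i))) with hmk
  -- The marks of all slots share one bit string, in which slot `i` owns a block of length `ds i`.
  -- Multiplicities are positive, so the cost bound limits the total length to `B`; separate strings
  -- for all slots could need quadratically many bits.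
  set tau : ℕ → ℕ := fun b => if ∃ i < q, ∃ e < ds i,
    b = (∑ x ∈ range (2 * D.B), if x < i then ds x else 0) + e ∧ mk i e then 1 else 0 with htau
  set G : Guess := ⟨P, a, θ, kap, chi, fl, us, ds, tau⟩ with hG
  have hγmem : ∀ i < q, γ (tt i) ∈ Sp.image γ := fun i hi => mem_image_of_mem γ (htt i hi).1
  have hkapq : ∀ i < q, kap i < q := fun i hi => by
    simp only [hkap, hi, if_true]
    exact (hix _ (hlS _ (hγmem i hi))).1
  have hused : ∀ i, D.Used G i ↔ i < q := by
    intro i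
    constructor
    · intro h
      by_contra hi
      have h' : kap i < 2 * D.B := h
      simp only [hkap, hi, if_false] at h'
      omega
    · intro hi
      exact lt_of_lt_of_le (hkapq i hi) hcsp
  have hkaptt : ∀ i < q, tt (kap i) = lead (γ (tt i)) := fun i hi => by
    simp only [hkap, hi, if_true]
    exact (hix _ (hlS _ (hγmem i hi))).2
  have hγkap : ∀ i < q, γ (tt (kap i)) = γ (tt i) := fun i hi => by
    rw [hkaptt i hi, hlγ _ (hγmem i hi)]
  have hkk : ∀ i < q, kap (kap i) = kap i := by
    intro i hi
    have h1 : kap (kap i) = ix (lead (γ (tt (kap i)))) := by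
      conv_lhs => simp only [hkap]
      rw [if_pos (hkapq i hi)]
    rw [h1, hγkap i hi]
    simp only [hkap, hi, if_true]
  have hds_eq : ∀ i < q, ds i = dd (tt i) := fun i hi => by simp only [hds, hi, if_true]
  have hus_eq : ∀ i < q, us i = uu (tt i) := fun i hi => by simp only [hus, hi, if_true]
  have hdsle : ∀ i < q, ds (kap i) ≤ ds i := by
    intro i hi
    rw [hds_eq _ (hkapq i hi), hds_eq i hi, hkaptt i hi]
    exact hlmin _ (hγmem i hi) _ (htt i hi).1 rfl
  have hds0 : ∀ i, ¬ i < q → ds i = 0 := fun i hi => by simp only [hds, hi, if_false]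
  have hoff : ∀ i, D.off G i = ∑ x ∈ range (2 * D.B), if x < i then ds x else 0 := by
    intro i
    refine sum_congr rfl fun x _ => ?_
    rw [hused]
    by_cases hx : x < q
    · simp [hx]
      rfl
    · simp only [hx, and_false, if_false, hds0 x hx, ite_self]
  have hmark : ∀ i < q, ∀ e < ds i, (D.Mark G i e ↔ mk i e) := by
    intro i hi e he
    unfold Mark
    rw [hoff]
    change tau _ ≠ 0 ↔ _
    simp only [htau]
    constructor
    · intro h
      by_contra hne
      refine h (if_neg ?_)
      rintro ⟨i', hi', e', he', heq, hm⟩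
      obtain ⟨rfl, rfl⟩ := block_injective (K := 2 * D.B) (by omega) (by omega) he he' heq
      exact hm hne
    · intro h
      rw [if_pos ⟨i, hi, e, he, rfl, h⟩]
      exact one_ne_zero
  have hkapiff : ∀ s < q, kap s = s → ∀ i < 2 * D.B, (kap i = s ↔ i < q ∧ γ (tt i) = γ (tt s)) := by
    intro s hs hss i hi
    constructor
    · intro h
      have hiq : i < q := (hused i).1 (by change kap i < _; omega)
      exact ⟨hiq, by rw [← h, hγkap i hiq]⟩
    · rintro ⟨hiq, e⟩
      rw [← hss]
      simp only [hkap, hiq, hs, if_true, e]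
  have hleadq : ∀ s ∈ D.leaders G, s < q ∧ kap s = s := by
    intro s hs
    obtain ⟨h1, h2⟩ := mem_filter.1 hs
    have h2' : kap s = s := h2
    exact ⟨(hused s).1 (by change kap s < _; rw [h2']; exact mem_range.1 h1), h2'⟩
  have hcostG : (∑ i ∈ range (2 * D.B), if D.Used G i then G.us i * G.ds i else 0) ≤ D.B := by
    refine le_trans (le_of_eq ?_) ((sum_le_sum fun t ht =>
      Nat.mul_le_mul_right (dd t) (huu1 t ht).2).trans hcost)
    rw [← sum_enumeration htt hix hcsp fun t => uu t * dd t]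
    refine sum_congr rfl fun i _ => ?_
    rw [hused]
    split_ifs with hi
    · change us i * ds i = _
      rw [hus_eq i hi, hds_eq i hi]
    · rfl
  have hterm : ∀ i < q, us i * ds i ≤ D.B := by
    intro i hi
    refine le_trans ?_ hcostG
    have := single_le_sum (f := fun i => if D.Used G i then G.us i * G.ds i else 0)
      (fun _ _ => Nat.zero_le _) (mem_range.2 (by omega : i < 2 * D.B))
    simp only [(hused i).2 hi, if_true] at this
    exact this
  have huspos : ∀ i < q, 1 ≤ us i := fun i hi => by
    rw [hus_eq i hi]; exact (huu1 _ (htt i hi).1).1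
  have hdsB : ∀ i, ds i ≤ D.B := by
    intro i
    by_cases hi : i < q
    · have h1 := hterm i hi
      have h2 := huspos i hi
      nlinarith
    · rw [hds0 i hi]; exact Nat.zero_le _
  have hlarge : ∀ j, D.Large G j ↔ D.Rep j ∧ θ ≤ D.mult j * D.n + j := fun j => Iff.rfl
  have hflag : ∀ i < q, (D.Large G (tt i) ↔ G.fl i ≠ 0) := by
    intro i hi
    change _ ↔ fl i ≠ 0
    rw [hlarge]
    simp only [hfl, hi, true_and]
    split_ifs with h <;> simp [h]
  have hinX : ∀ i < q, D.InX G i (tt i) := by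
    intro i hi
    refine ⟨(hsp _ (htt i hi).1).2, ?_, hflag i hi, ?_⟩
    · change _ = chi i
      simp only [hchi, hi, if_true]
      rfl
    · change us i ≤ _
      rw [hus_eq i hi]
      exact (huu1 _ (htt i hi).1).2.trans (hule _ (htt i hi).1)
  have hcons : D.Consistent G := by
    refine ⟨fun i _ hi => ?_, hcostG, fun i _ i' _ hi hi' e => ?_, fun s hs hss e _ hes => ?_⟩
    · have hi' := (hused i).1 hi
      exact ⟨hkk i hi', hdsle i hi', huspos i hi'⟩
    · have h1 := (hused i).1 hi
      have h2 := (hused i').1 hi'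
      have e' : chi i = chi i' := e
      simp only [hchi, h1, h2, if_true] at e'
      have := hhash (mem_coe.2 (htt i h1).1) (mem_coe.2 (htt i' h2).1) e'
      rw [← (htt i h1).2, this, (htt i' h2).2]
    · have hss' : kap s = s := hss
      have hsq : s < q := (hused s).1 (by change kap s < _; omega)
      have hes' : e < ds s := hes
      set c := γ (tt s) with hc
      have hcm : c ∈ Sp.image γ := hγmem s hsq
      have hts : tt s = lead c := by
        have := hkaptt s hsq
        rwa [hss'] at this
      have hel : e < dd (lead c) := by rw [← hts, ← hds_eq s hsq]; exact hes'
      -- There is a position `e` below the distance of the leading kind, so every kind of this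
      -- cluster has positive distance and its guessed multiplicity is the true one.
      have huc : ∀ t ∈ Sp, γ t = c → uu t = u t := by
        intro t ht e'
        have := hlmin c hcm t ht e'
        simp only [huu]
        rw [if_neg (by omega)]
      have hp := (hpv c hcm e hel).1
      have hm := hmaj (lead c) (hlS c hcm) (pos c e) hp.1 (by rw [hlγ c hcm]; exact hp.2.symm)
      rw [hlγ c hcm] at hm
      have s1 : (∑ i ∈ range (2 * D.B), if G.kap i = s then G.us i else 0) =
          ∑ t ∈ Sp with γ t = c, u t := by
        rw [sum_filter, ← sum_enumeration htt hix hcsp fun t => if γ t = c then u t else 0]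
        refine sum_congr rfl fun i hi => ?_
        have hk := hkapiff s hsq hss' i (mem_range.1 hi)
        change (if kap i = s then us i else 0) =
          if i < q then if γ (tt i) = c then u (tt i) else 0 else 0
        by_cases hiq : i < q
        · simp only [hk, hiq, true_and, if_true]
          split_ifs with e'
          · rw [hus_eq i hiq, huc _ (htt i hiq).1 e']
          · rfl
        · simp [hk, hiq]
      have s2 : (∑ i ∈ range (2 * D.B), if G.kap i = s ∧ D.Mark G i e then G.us i else 0) =
          ∑ t ∈ Sp with γ t = c ∧ D.A (pos c e) t ≠ D.A (pos c e) (lead c), u t := by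
        rw [sum_filter, ← sum_enumeration htt hix hcsp fun t =>
          if γ t = c ∧ D.A (pos c e) t ≠ D.A (pos c e) (lead c) then u t else 0]
        refine sum_congr rfl fun i hi => ?_
        have hk := hkapiff s hsq hss' i (mem_range.1 hi)
        change (if kap i = s ∧ D.Mark G i e then us i else 0) = if i < q then
          if γ (tt i) = c ∧ D.A (pos c e) (tt i) ≠ D.A (pos c e) (lead c) then u (tt i) else 0
          else 0
        by_cases hiq : i < q
        · simp only [hk, hiq, true_and, if_true]
          by_cases e' : γ (tt i) = c
          · have hei : e < ds i := by
              have := hdsle i hiq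
              rw [hk.2 ⟨hiq, e'⟩] at this
              omega
            have hme : mk i e ↔ D.A (pos c e) (tt i) ≠ D.A (pos c e) (lead c) := by
              simp only [hmk, e']
            rw [hmark i hiq e hei, hme, hus_eq i hiq, huc _ (htt i hiq).1 e']
            congr
          · simp [← hc, e']
        · simp [hk, hiq]
      rw [s1, s2]
      exact hm
  set h : ℕ → ℕ → ℕ := fun s b => if b = 0 then tt s else
    pos (γ (tt s)) (b - 1) * D.sig + val (γ (tt s)) (b - 1) with hh'
  have hh0 : ∀ s, h s 0 = tt s := fun s => by simp [hh']
  have hhs : ∀ s b, h s (b + 1) = pos (γ (tt s)) b * D.sig + val (γ (tt s)) b := fun s b => by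
    simp [hh']
  have hdecode : ∀ s < q, kap s = s → ∀ e < ds s, h s (e + 1) < D.m * D.sig ∧
      h s (e + 1) / D.sig = pos (γ (tt s)) e ∧ D.al (h s (e + 1) % D.sig) =
        γ (tt s) (pos (γ (tt s)) e) := by
    intro s hs hss e he
    have hts : tt s = lead (γ (tt s)) := by
      have := hkaptt s hs
      rwa [hss] at this
    have hel : e < dd (lead (γ (tt s))) := by rw [← hts, ← hds_eq s hs]; exact he
    obtain ⟨⟨h1, -⟩, h2, h3⟩ := hpv _ (hγmem s hs) e hel
    rw [hhs]
    refine ⟨?_, ?_, ?_⟩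
    · have := Nat.mul_le_mul_right D.sig (show pos (γ (tt s)) e + 1 ≤ D.m from h1)
      rw [add_mul] at this
      omega
    · rw [Nat.add_comm, Nat.add_mul_div_right _ _ (by omega), Nat.div_eq_of_lt h2, zero_add]
    · rw [Nat.mul_add_mod', Nat.mod_eq_of_lt h2, h3]
  have hgood : ∀ s ∈ D.leaders G, ∀ t ≤ G.ds s, D.Good G s t (h s) := by
    intro s hs t ht
    obtain ⟨hsq, hss⟩ := hleadq s hs
    have ht' : t ≤ ds s := ht
    have hts : tt s = lead (γ (tt s)) := by
      have := hkaptt s hsq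
      rwa [hss] at this
    refine ⟨?_, fun e _ he => (hdecode s hsq hss e (by omega)).1, fun i hi his => ?_⟩
    · rw [hh0]; exact (hsp _ (htt s hsq).1).1
    · obtain ⟨hiq, hγi⟩ := (hkapiff s hsq hss i hi).1 his
      refine ⟨tt i, (hsp _ (htt i hiq).1).1, hinX i hiq, ?_, fun e _ he hme => ?_⟩
      · change _ ≤ ds s + ds i
        rw [hh0, hds_eq s hsq, hds_eq i hiq]
        simp only [hdd]
        rw [hγi]
        exact dist_col_le _ _ _
      · have hes : e < ds s := by omega
        have hei : e < ds i := by
          have h1 := hdsle i hiq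
          have h2 : kap i = s := his
          rw [h2] at h1
          omega
        have h1 := (hmark i hiq e hei).1 hme
        simp only [hmk, hγi] at h1
        rw [(hdecode s hsq hss e hes).2.1, hh0]
        rw [← hts] at h1
        exact h1
  have hfit : ∀ s ∈ D.leaders G, ∀ i < 2 * D.B, G.kap i = s →
      tt i < D.n ∧ D.Fit G s (h s) i (tt i) ∧ D.gain G i (tt i) ≠ 0 := by
    intro s hs i hi his
    obtain ⟨hsq, hss⟩ := hleadq s hs
    obtain ⟨hiq, hγi⟩ := (hkapiff s hsq hss i hi).1 his
    have hts : tt s = lead (γ (tt s)) := by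
      have := hkaptt s hsq
      rwa [hss] at this
    have htn := (hsp _ (htt i hiq).1).1
    refine ⟨htn, ⟨hinX i hiq, ?_⟩, ?_⟩
    · change _ ≤ ds i
      rw [hds_eq i hiq]
      simp only [hdd]
      rw [hγi]
      refine card_le_card fun r hr => ?_
      obtain ⟨hr1, hr2⟩ := mem_filter.1 hr
      refine mem_filter.2 ⟨hr1, ?_⟩
      rcases hr2 with ⟨e, -, he, hpe, hne⟩ | ⟨hnone, hne⟩
      · have he' : e < ds s := he
        obtain ⟨-, h1, h2⟩ := hdecode s hsq hss e he'
        rw [h2, ← h1, hpe] at hne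
        exact hne.symm
      · rw [hh0] at hne
        -- The changes list all rows where the leading column and the center differ, so the two
        -- agree in a row without a change.
        have : D.A r (tt s) = γ (tt s) r := by
          by_contra hne'
          rw [hts, hlγ _ (hγmem s hsq)] at hne'
          obtain ⟨e, he, hpe⟩ := hpsurj _ (hγmem s hsq) r (mem_range.1 hr1) hne'
          rw [← hts, ← hds_eq s hsq] at he
          refine hnone e (lt_of_lt_of_le he (hdsB s)) he ?_
          rw [(hdecode s hsq hss e he).2.1, hpe]
        rw [← this]
        exact hne.symm
    · have h1 := gain_add (D := D) (G := G) i (tt i)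
      have h2 := mult_le (D := D) (tt i)
      have h3 := mult_pos htn
      have h4 : 1 ≤ D.cov G i (tt i) := by
        unfold cov
        have : 1 ≤ G.us i := huspos i hiq
        split_ifs <;> omega
      split_ifs at h1 <;> omega
  have hleaf : ∀ s ∈ D.leaders G,
      (∑ i ∈ range (2 * D.B), if G.kap i = s then D.gain G i (tt i) else 0) ≤
        D.leafVal G s (h s) := fun s hs => leafVal_of_fit tt (hfit s hs)
  -- The threshold was chosen for the kinds outside `Sp` only, where it selects exactly `#H` kinds;
  -- the other frequent kinds are the flagged slots.
  have hLs : {j ∈ range D.n | D.Large G j} = {t ∈ T | θ ≤ key t} ∪ {t ∈ Sp | D.Large G t} := by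
    ext j
    simp only [mem_union, mem_filter, hT, mem_range, hlarge]
    constructor
    · rintro ⟨h1, h2, h3⟩
      by_cases hj : j ∈ Sp
      · exact .inr ⟨hj, h2, h3⟩
      · exact .inl ⟨⟨h1, h2, hj⟩, h3⟩
    · rintro (⟨⟨h1, h2, -⟩, h3⟩ | ⟨hj, h2, h3⟩)
      · exact ⟨h1, h2, h3⟩
      · exact ⟨(hsp j hj).1, h2, h3⟩
  have hLdis : Disjoint {t ∈ T | θ ≤ key t} {t ∈ Sp | D.Large G t} := by
    rw [disjoint_left]
    intro j hj hj'
    exact (mem_filter.1 (mem_filter.1 hj).1).2.2 (mem_filter.1 hj').1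
  have hflcard : #{i ∈ range (2 * D.B) | D.Used G i ∧ G.fl i ≠ 0} =
      #{t ∈ Sp | D.Large G t} := by
    rw [card_filter, card_filter,
      ← sum_enumeration htt hix hcsp fun t => if D.Large G t then 1 else 0]
    refine sum_congr rfl fun i _ => ?_
    by_cases hiq : i < q
    · simp only [← hq, hiq, if_true, hused, true_and]
      exact if_congr (hflag i hiq).symm rfl rfl
    · simp only [← hq, hiq, if_false, hused, false_and]
  refine ⟨G, ⟨hP, ha, hθ, ?_, ?_, ?_, ?_, hdsB, ?_, ?_, ?_⟩, hcons, h, fun s hs => ⟨hgood s hs, ?_⟩, ?_, ?_⟩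
  · intro i
    by_cases hi : i < q
    · exact ((hused i).2 hi).le
    · change kap i ≤ _
      simp only [hkap, hi, if_false, le_rfl]
  · intro i
    change chi i < _
    have : 0 < D.colors := Nat.succ_pos _
    simp only [hchi]
    split_ifs
    · exact Nat.mod_lt _ this
    · exact this
  · intro i
    change fl i ≤ 1
    simp only [hfl]
    split_ifs <;> omega
  · intro i
    change us i ≤ _
    by_cases hi : i < q
    · rw [hus_eq i hi]
      simp only [huu]
      split_ifs with e
      · omega
      · have h1 := hterm i hi
        rw [hus_eq i hi, hds_eq i hi] at h1
        simp only [huu, e, if_false] at h1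
        have h2 : 1 ≤ dd (tt i) := Nat.one_le_iff_ne_zero.2 e
        nlinarith
    · simp only [hus, hi, if_false]; omega
  · intro i
    change tau i ≤ 1
    simp only [htau]
    split_ifs <;> omega
  · intro i hi
    have hiq : ¬ i < q := by omega
    refine ⟨?_, ?_, ?_, ?_, hds0 i hiq⟩
    · change kap i = _
      simp only [hkap, hiq, if_false]
    · change chi i = _
      simp only [hchi, hiq, if_false]
    · change fl i = _
      simp only [hfl, hiq, false_and, if_false]
    · change us i = _
      simp only [hus, hiq, if_false]
  · intro b hb
    refine if_neg ?_
    rintro ⟨i, hiq, e, he, rfl, -⟩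
    have h1 : (∑ x ∈ range (2 * D.B), if x < i then ds x else 0) + ds i ≤ D.B := by
      refine le_trans ?_ hcostG
      have : ds i = ∑ x ∈ range (2 * D.B), if i = x then ds i else 0 := by
        rw [sum_ite_eq, if_pos (mem_range.2 (by omega))]
      rw [this, ← sum_add_distrib]
      refine sum_le_sum fun x _ => ?_
      rw [hused]
      rw [show G.us x * G.ds x = us x * ds x from rfl]
      by_cases hx : x < q
      · have h2 := Nat.mul_le_mul_right (ds x) (huspos x hx)
        rw [if_pos hx]
        by_cases hxi : i = x
        · subst hxi
          simp only [lt_irrefl, if_false, if_true]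
          omega
        · simp only [hxi, if_false]
          split_ifs <;> omega
      · rw [if_neg (by omega), if_neg (by omega)]
        omega
    omega
  · have h1 := hleaf s hs
    obtain ⟨hsq, hss⟩ := hleadq s hs
    have hs2 : s < 2 * D.B := by omega
    have h2 := (hfit s hs s hs2 hss).2.2
    have h3 := single_le_sum (f := fun i => if G.kap i = s then D.gain G i (tt i) else 0)
      (fun _ _ => Nat.zero_le _) (mem_range.2 hs2)
    simp only [show G.kap s = s from hss, if_true] at h3
    omega
  · rw [hLs, card_union_of_disjoint hLdis, hθcard, hflcard]
    have : #(D.leaders G) ≤ #(Sp.image γ) := by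
      refine card_le_card_of_injOn (fun s => γ (tt s))
        (fun s hs => hγmem s (hleadq s (mem_coe.1 hs)).1) fun s hs s' hs' e => ?_
      obtain ⟨h1, h2⟩ := hleadq s (mem_coe.1 hs)
      obtain ⟨h3, h4⟩ := hleadq s' (mem_coe.1 hs')
      rw [← h2]
      exact (hkapiff s' h3 h4 s (by omega)).2 ⟨h1, e⟩
    omega
  · rw [← sum_filter, hLs, sum_union hLdis]
    have e1 : #{i ∈ range (2 * D.B) | D.Used G i} = q := by
      have : {i ∈ range (2 * D.B) | D.Used G i} = range q := by
        ext i; simp only [mem_filter, mem_range, hused]; omega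
      rw [this, card_range]
    have e2 : (∑ i ∈ range (2 * D.B), if i < q then D.gain G i (tt i) else 0) ≤
        ∑ s ∈ D.leaders G, D.leafVal G s (h s) := by
      refine le_trans (le_of_eq ?_) (sum_le_sum hleaf)
      rw [sum_comm]
      refine sum_congr rfl fun i hi => ?_
      rw [sum_ite_eq]
      refine if_congr ⟨fun hiq => mem_filter.2 ⟨mem_range.2 ?_, hkk i hiq⟩, fun hm => ?_⟩ rfl rfl
      · exact lt_of_lt_of_le (hkapq i hiq) hcsp
      · exact (hused i).1 (mem_range.1 (mem_filter.1 hm).1)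
    have e3 : (∑ i ∈ range (2 * D.B), if i < q then D.gain G i (tt i) else 0) +
        ∑ t ∈ Sp with D.Large G t, D.mult t = ∑ i ∈ range (2 * D.B),
          (if i < q then D.n + D.cov G i (tt i) else 0) := by
      rw [sum_filter, ← sum_enumeration htt hix hcsp fun t => if D.Large G t then D.mult t else 0,
        ← sum_add_distrib]
      refine sum_congr rfl fun i _ => ?_
      by_cases hiq : i < q
      · simp only [← hq, hiq, if_true]
        rw [← gain_add, if_congr (hflag i hiq) rfl rfl]
      · simp only [← hq, hiq, if_false]
    have e4 : D.n * q + ∑ t ∈ Sp, u t ≤ ∑ i ∈ range (2 * D.B),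
        (if i < q then D.n + D.cov G i (tt i) else 0) := by
      have : D.n * q + ∑ t ∈ Sp, u t = ∑ t ∈ Sp, (D.n + u t) := by
        rw [sum_add_distrib, sum_const, smul_eq_mul, mul_comm]
      rw [this, ← sum_enumeration htt hix hcsp fun t => D.n + u t]
      refine sum_le_sum fun i _ => ?_
      by_cases hiq : i < q
      · simp only [← hq, hiq, if_true]
        refine Nat.add_le_add_left ?_ _
        unfold cov
        change _ ≤ if ds i = 0 then _ else us i
        rw [hds_eq i hiq, hus_eq i hiq]
        simp only [huu]
        split_ifs
        · exact hule _ (htt i hiq).1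
        · exact le_rfl
      · simp only [← hq, hiq, if_false, le_rfl]
    rw [e1]
    omega

end Data

end ColumnOutliers


/-! ### The number of candidates -/

namespace ColumnOutliers

open Finset WordRAM
open scoped Classical

theorem getD_eq_of_forall {p q : List ℕ} (hl : p.length = q.length)
    (h : ∀ i < p.length, p.getD i 0 = q.getD i 0) : p = q := by
  refine List.ext_getElem hl fun i h1 h2 => ?_
  have := h i h1
  rwa [List.getD_eq_getElem _ _ h1, List.getD_eq_getElem _ _ h2] at this

/-! ### The number of candidates for one center. -/

namespace Data

variable {D : Data} {G : Guess}

theorem Consistent.ds_le (hG : D.Consistent G) {i : ℕ} (hi : i < 2 * D.B) (hu : D.Used G i) :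
    G.ds i ≤ D.B := by
  have h1 := single_le_sum (f := fun i => if D.Used G i then G.us i * G.ds i else 0)
    (fun _ _ => Nat.zero_le _) (mem_range.2 hi)
  simp only [hu, if_true] at h1
  have h2 := h1.trans hG.cost
  have h3 := (hG.leader i hi hu).2.2
  nlinarith

/-- A projection is determined by a witnessing column, with at most `n` choices, and for each
coordinate in `T` by one of the at most `d` rows in which that column differs from column `x`. -/
theorem card_proj_le {t d : ℕ} (T : Finset (Fin t)) (S : Finset (Fin t → ℕ)) (x : ℕ)
    (hS : ∀ f ∈ S, ∃ j < D.n, D.dist j (D.col x) ≤ d ∧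
      ∀ a ∈ T, f a < D.m ∧ D.A (f a) j ≠ D.A (f a) x) (hd : 1 ≤ d) :
    #(S.image (proj T)) ≤ D.n * d ^ t := by
  set F : ℕ → Finset ℕ := fun j => {r ∈ range D.m | D.A r j ≠ D.col x r} with hF
  set U := {j ∈ range D.n | D.dist j (D.col x) ≤ d} with hU
  have hsub : S.image (proj T) ⊆ U.biUnion fun j =>
      (Fintype.piFinset fun a => if a ∈ T then F j else {0}).image (proj T) := by
    intro g hg
    obtain ⟨f, hf, rfl⟩ := mem_image.1 hg
    obtain ⟨j, hj, hjd, hT⟩ := hS f hf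
    refine mem_biUnion.2 ⟨j, mem_filter.2 ⟨mem_range.2 hj, hjd⟩,
      mem_image.2 ⟨fun a => if a ∈ T then f a else 0, Fintype.mem_piFinset.2 fun a => ?_, ?_⟩⟩
    · split_ifs with ha
      · exact mem_filter.2 ⟨mem_range.2 (hT a ha).1, (hT a ha).2⟩
      · exact mem_singleton_self 0
    · funext a
      by_cases ha : a ∈ T <;> simp [proj, ha]
  refine (card_le_card hsub).trans (card_biUnion_le.trans ?_)
  calc _ ≤ ∑ j ∈ U, d ^ t := sum_le_sum fun j hj => card_image_le.trans ?_
    _ = #U * d ^ t := by rw [sum_const, smul_eq_mul]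
    _ ≤ D.n * d ^ t := Nat.mul_le_mul_right _ ((card_filter_le _ _).trans (by simp))
  rw [Fintype.card_piFinset]
  refine (prod_le_pow_card _ _ d fun a _ => ?_).trans (by simp)
  split_ifs
  · exact (mem_filter.1 hj).2
  · simpa using hd

/-- The number of candidates for the center of a cluster. -/
theorem card_good_le (hG : D.Consistent G) {s t : ℕ} (hs : s < 2 * D.B) (hss : G.kap s = s)
    (ht : t ≤ G.ds s) (S : Finset (List ℕ))
    (hS : ∀ p ∈ S, p.length = t + 1 ∧ D.Good G s t (p.getD · 0)) :
    #S ≤ D.n * D.sig ^ t * (D.n * (2 * D.B) ^ D.B) ^ 2 := by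
  have hused : ∀ i < 2 * D.B, G.kap i = s → D.Used G i := fun i _ h => by
    change G.kap i < _; omega
  have htB : t ≤ D.B := ht.trans (hG.ds_le hs (hused s hs hss))
  -- Fixing the leading column and the letters splits the candidates into at most `n * sig ^ t`
  -- classes. Within a class a candidate is a sequence of rows.
  set key : List ℕ → ℕ × (Fin t → ℕ) := fun p => (p.getD 0 0, fun a => p.getD (a + 1) 0 % D.sig)
    with hkey
  have himg : #(S.image key) ≤ D.n * D.sig ^ t := by
    have hsub : S.image key ⊆ range D.n ×ˢ Fintype.piFinset fun _ : Fin t => range D.sig := by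
      intro y hy
      obtain ⟨p, hp, rfl⟩ := mem_image.1 hy
      obtain ⟨-, h1, h2, -⟩ := hS p hp
      refine mem_product.2 ⟨mem_range.2 h1, Fintype.mem_piFinset.2 fun a => mem_range.2 ?_⟩
      refine Nat.mod_lt _ (Nat.pos_of_ne_zero fun e => ?_)
      have := h2 a (by omega) a.2
      simp [e] at this
    refine (card_le_card hsub).trans ?_
    rw [card_product, Fintype.card_piFinset]
    simp
  refine (card_le_mul_card_image S ((D.n * (2 * D.B) ^ D.B) ^ 2) fun y hy => ?_).trans
    (by rw [mul_comm]; exact Nat.mul_le_mul_right _ himg)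
  set V := {p ∈ S | key p = y} with hV
  have hVS : ∀ p ∈ V, p ∈ S ∧ key p = y := fun p hp => mem_filter.1 hp
  set row : List ℕ → Fin t → ℕ := fun p a => p.getD (a + 1) 0 / D.sig with hrow
  have hinj : Set.InjOn row V := by
    intro p hp q hq e
    obtain ⟨hp1, hp2⟩ := hVS p hp
    obtain ⟨hq1, hq2⟩ := hVS q hq
    have hlp := (hS p hp1).1
    have hlq := (hS q hq1).1
    rw [← hq2] at hp2
    refine getD_eq_of_forall (by omega) fun i hi => ?_
    rcases i with - | a
    · exact congrArg Prod.fst hp2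
    · have h1 := congrFun e ⟨a, by omega⟩
      have h2 := congrFun (congrArg Prod.snd hp2) ⟨a, by omega⟩
      simp only [hrow, hkey] at h1 h2
      rw [← Nat.div_add_mod (p.getD (a + 1) 0) D.sig, h1, h2, Nat.div_add_mod]
  rw [← card_image_of_injOn hinj]
  have hs1 := (hG.leader s hs (hused s hs hss)).2.2
  -- Shearer's inequality for the slots of the cluster, weighted by their multiplicities, with the
  -- marked changes of a slot as its coordinates.
  refine card_le_sq_of_half_cover {i ∈ range (2 * D.B) | G.kap i = s}
    (fun i => {a : Fin t | D.Mark G i a}) G.us ?_ univ (fun a _ => ?_) _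
    (fun f _ g _ x hx => absurd (mem_univ x) hx) _ ?_ fun i hi => ?_
  · exact lt_of_lt_of_le hs1 (single_le_sum (f := G.us) (fun _ _ => Nat.zero_le _)
      (mem_filter.2 ⟨mem_range.2 hs, hss⟩))
  · have h := hG.cover s hs hss a (by omega) (by omega)
    rw [← sum_filter, ← sum_filter] at h
    simp only [mem_filter, mem_univ, true_and, filter_filter]
    exact h
  · obtain ⟨p, hp⟩ : S.Nonempty := by
      obtain ⟨p, hp, -⟩ := mem_image.1 hy
      exact ⟨p, hp⟩
    have := (hS p hp).2.1
    exact Nat.one_le_iff_ne_zero.2 (mul_ne_zero (by omega) (pow_ne_zero _ (by omega)))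
  · obtain ⟨hi1, hi2⟩ := mem_filter.1 hi
    have hi1 := mem_range.1 hi1
    refine le_trans ?_ (Nat.mul_le_mul_left D.n
      (Nat.pow_le_pow_right (by omega : 0 < 2 * D.B) htB))
    -- A witnessing column has distance at most `ds s + ds i ≤ 2 * B` to the leading column.
    have := card_proj_le (D := D) (d := 2 * D.B) {a : Fin t | D.Mark G i a} (V.image row) y.1
      (fun f hf => ?_) (by omega)
    · refine le_trans (le_of_eq ?_) this
      congr!
    obtain ⟨p, hp, rfl⟩ := mem_image.1 hf
    obtain ⟨hp1, hp2⟩ := hVS p hp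
    obtain ⟨-, -, h2, h3⟩ := hS p hp1
    obtain ⟨j, hj, -, hjd, hm⟩ := h3 i hi1 hi2
    have e : p.getD 0 0 = y.1 := congrArg Prod.fst hp2
    simp only [e] at hjd hm
    have hb1 := hG.ds_le hs (hused s hs hss)
    have hb2 := hG.ds_le hi1 (hused i hi1 hi2)
    refine ⟨j, hj, by omega, fun a ha => ⟨?_, ?_⟩⟩
    · exact Nat.div_lt_of_lt_mul (by rw [mul_comm]; exact h2 a (by omega) a.2)
    · exact hm a (by omega) a.2 (by simpa using ha)

/-- An expansion tries `n + m * sig ≤ (n + m) * sig` digits. A node that is expanded after `t`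
changes has `t < ds s ≤ B`, so the extra factor turns `sig ^ t` into at most `sig ^ B`; the power of
the alphabet size does not exceed `B`. -/
theorem nodes_good_le (hG : D.Consistent G) (hn : 1 ≤ D.n) (hsig : 1 ≤ D.sig) {s : ℕ}
    (hs : s < 2 * D.B) (hss : G.kap s = s) :
    nodes (fun p => D.Good G s (p.length - 1) (p.getD · 0)) (D.n + D.m * D.sig) (1 + G.ds s) [] ≤
      (D.n + D.m) * ((D.B + 1) * (D.n * (D.n * (2 * D.B) ^ D.B) ^ 2 * D.sig ^ D.B)) := by
  set Val : List ℕ → Prop := fun p => D.Good G s (p.length - 1) (p.getD · 0) with hVal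
  have hds := hG.ds_le hs (show G.kap s < _ by omega)
  set C := D.n * (D.n * (2 * D.B) ^ D.B) ^ 2 with hC
  have hC1 : 1 ≤ C := Nat.one_le_iff_ne_zero.2 (mul_ne_zero (by omega)
    (pow_ne_zero _ (mul_ne_zero (by omega) (pow_ne_zero _ (by omega)))))
  have hlev : ∀ i < 1 + G.ds s,
      (leaves Val (D.n + D.m * D.sig) i []).length * D.sig ≤ C * D.sig ^ D.B := by
    intro i hi
    rcases i with - | t
    · simp only [leaves, List.length_singleton, one_mul]
      calc D.sig = 1 * D.sig ^ 1 := by ring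
        _ ≤ C * D.sig ^ D.B := Nat.mul_le_mul hC1 (Nat.pow_le_pow_right hsig (by omega))
    · rw [← List.toFinset_card_of_nodup (nodup_leaves _ _ _ _)]
      have h := card_good_le hG hs hss (t := t) (by omega)
        (leaves Val (D.n + D.m * D.sig) (t + 1) []).toFinset (fun p hp => by
          obtain ⟨-, h1, h2, -⟩ := mem_leaves.1 (List.mem_toFinset.1 hp)
          simp only [List.length_nil, zero_add] at h1 h2
          have h3 := h2 (t + 1) (by omega) (by omega)
          rw [List.take_of_length_le (by omega)] at h3
          simp only [hVal, h1] at h3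
          exact ⟨h1, h3⟩)
      calc _ ≤ D.n * D.sig ^ t * (D.n * (2 * D.B) ^ D.B) ^ 2 * D.sig := Nat.mul_le_mul_right _ h
        _ = C * D.sig ^ (t + 1) := by rw [hC]; ring
        _ ≤ C * D.sig ^ D.B := Nat.mul_le_mul_left _ (Nat.pow_le_pow_right hsig (by omega))
  rw [nodes_eq]
  calc _ ≤ (D.n * D.sig + D.m * D.sig) *
        ∑ i ∈ range (1 + G.ds s), (leaves Val (D.n + D.m * D.sig) i []).length :=
        Nat.mul_le_mul_right _ (Nat.add_le_add_right (Nat.le_mul_of_pos_right _ hsig) _)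
    _ = (D.n + D.m) *
        ∑ i ∈ range (1 + G.ds s), (leaves Val (D.n + D.m * D.sig) i []).length * D.sig := by
        rw [← sum_mul]; ring
    _ ≤ (D.n + D.m) * ∑ i ∈ range (1 + G.ds s), C * D.sig ^ D.B :=
        Nat.mul_le_mul_left _ (sum_le_sum fun i hi => hlev i (mem_range.1 hi))
    _ ≤ _ := by
        rw [sum_const, card_range, smul_eq_mul]
        exact Nat.mul_le_mul_left _ (Nat.mul_le_mul_right _ (by omega))

end Data

theorem length_leaves_le {Val : List ℕ → Prop} {b : ℕ → ℕ}
    (hb : ∀ p x, Val (p ++ [x]) → x < b p.length) (K f : ℕ) (p : List ℕ) :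
    (leaves Val K f p).length ≤ ∏ i ∈ range f, b (p.length + i) := by
  induction f generalizing p with
  | zero => simp [leaves]
  | succ f ih =>
    rw [length_leaves_succ, ← sum_filter, prod_range_succ']
    calc _ ≤ ∑ x ∈ range K with Val (p ++ [x]), ∏ i ∈ range f, b (p.length + (i + 1)) :=
          sum_le_sum fun x _ => (ih _).trans (le_of_eq (prod_congr rfl fun i _ => by
            rw [List.length_append, List.length_singleton]; congr 1; omega))
      _ ≤ b p.length * ∏ i ∈ range f, b (p.length + (i + 1)) := by
          rw [sum_const, smul_eq_mul]
          refine Nat.mul_le_mul_right _ ?_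
          have : {x ∈ range K | Val (p ++ [x])} ⊆ range (b p.length) := fun x hx =>
            mem_range.2 (hb p x (mem_filter.1 hx).2)
          simpa using card_le_card this
      _ = _ := by rw [mul_comm, add_zero]

/-- The number of nodes if the first three digits are below `M` and the other ones below `N`. -/
theorem nodes_le_of_digits {Val : List ℕ → Prop} {M N : ℕ} (hM : 1 ≤ M) (hN : 1 ≤ N)
    (h : ∀ p x, Val (p ++ [x]) → x < if p.length < 3 then M else N) (K f : ℕ) :
    nodes Val K f [] ≤ K * (f * (M ^ 3 * N ^ f)) := by
  rw [nodes_eq]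
  refine Nat.mul_le_mul_left _ ?_
  calc _ ≤ ∑ i ∈ range f, M ^ 3 * N ^ f := sum_le_sum fun i hi => ?_
    _ = _ := by rw [sum_const, card_range, smul_eq_mul]
  refine (length_leaves_le (b := fun i => if i < 3 then M else N) h K i []).trans ?_
  simp only [List.length_nil, zero_add]
  calc _ ≤ ∏ x ∈ range i, (if x < 3 then M else 1) * N := prod_le_prod' fun x _ => by
        split_ifs
        · exact Nat.le_mul_of_pos_right _ hN
        · simp
    _ = M ^ #{x ∈ range i | x < 3} * N ^ i := by
        rw [prod_mul_distrib, prod_ite, prod_const, prod_const_one, mul_one, prod_const, card_range]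
    _ ≤ M ^ 3 * N ^ f := by
        refine Nat.mul_le_mul (Nat.pow_le_pow_right hM ?_)
          (Nat.pow_le_pow_right hN (mem_range.1 hi).le)
        have : {x ∈ range i | x < 3} ⊆ range 3 := fun x hx => mem_range.2 (mem_filter.1 hx).2
        simpa using card_le_card this

/-! ### Guesses as strings of digits. -/

namespace Data

variable (D : Data)

/-- The guess that is described by the digits `g`. -/
def guess (g : ℕ → ℕ) : Guess where
  -- The `3 + 11 * B` digits consist of three numbers, five blocks of length `2 * B`, and the `B`
  -- marks.
  P := g 0
  a := g 1
  θ := g 2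
  kap := fun i => if i < 2 * D.B then g (3 + i) else 2 * D.B
  chi := fun i => if i < 2 * D.B then g (3 + 2 * D.B + i) else 0
  fl := fun i => if i < 2 * D.B then g (3 + 4 * D.B + i) else 0
  us := fun i => if i < 2 * D.B then g (3 + 6 * D.B + i) else 0
  ds := fun i => if i < 2 * D.B then g (3 + 8 * D.B + i) else 0
  tau := fun b => if b < D.B then g (3 + 10 * D.B + b) else 0

variable {D}

/-- `Guess.Small` also fixes the values that no digit records, so decoding returns `G` itself. -/
theorem exists_guess_eq {G : Guess} (hG : G.Small D) : ∃ p : List ℕ, p.length = 3 + 11 * D.B ∧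
    (∀ i < p.length, p.getD i 0 <
      if i < 3 then (2 * D.n + 2) * (2 * D.n + 2) else 4 * D.B * D.B + 2 * D.B + 2) ∧
    D.guess (p.getD · 0) = G := by
  set f : ℕ → ℕ := fun i => if i = 0 then G.P else if i = 1 then G.a else if i = 2 then G.θ else
    if i < 3 + 2 * D.B then G.kap (i - 3) else
    if i < 3 + 4 * D.B then G.chi (i - (3 + 2 * D.B)) else
    if i < 3 + 6 * D.B then G.fl (i - (3 + 4 * D.B)) else
    if i < 3 + 8 * D.B then G.us (i - (3 + 6 * D.B)) else
    if i < 3 + 10 * D.B then G.ds (i - (3 + 8 * D.B)) else G.tau (i - (3 + 10 * D.B)) with hf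
  have hget : ∀ i < 3 + 11 * D.B, ((List.range (3 + 11 * D.B)).map f).getD i 0 = f i := by
    intro i hi
    rw [List.getD_eq_getElem _ _ (by simpa using hi)]
    simp
  refine ⟨(List.range (3 + 11 * D.B)).map f, by simp, fun i hi => ?_, ?_⟩
  · rw [hget i (by simpa using hi)]
    have h1 := hG.P
    have h2 := hG.a
    have h3 := hG.θ
    have h4 := hG.kap (i - 3)
    have h5 := hG.chi (i - (3 + 2 * D.B))
    have h6 := hG.fl (i - (3 + 4 * D.B))
    have h7 := hG.us (i - (3 + 6 * D.B))
    have h8 := hG.ds (i - (3 + 8 * D.B))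
    have h9 := hG.tau (i - (3 + 10 * D.B))
    unfold colors at h5
    by_cases hi3 : i < 3
    · rw [if_pos hi3]
      have : f i ≤ D.n * D.n + 2 * D.n + 1 := by
        simp only [hf]
        split_ifs <;> omega
      nlinarith
    · rw [if_neg hi3]
      simp only [hf]
      split_ifs <;> omega
  · have hr := hG.rest
    cases G with
    | mk P a θ kap chi fl us ds tau =>
    simp only [guess, Guess.mk.injEq]
    refine ⟨?_, ?_, ?_, ?_, ?_, ?_, ?_, ?_, ?_⟩
    · rw [hget _ (by omega)]; simp [hf]
    · rw [hget _ (by omega)]; simp [hf]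
    · rw [hget _ (by omega)]; simp [hf]
    · funext i
      split_ifs with hi
      · rw [hget _ (by omega)]
        simp only [hf]
        rw [if_neg (by omega), if_neg (by omega), if_neg (by omega), if_pos (by omega)]
        congr 1; omega
      · exact (hr i (by omega)).1.symm
    · funext i
      split_ifs with hi
      · rw [hget _ (by omega)]
        simp only [hf]
        rw [if_neg (by omega), if_neg (by omega), if_neg (by omega), if_neg (by omega),
          if_pos (by omega)]
        congr 1; omega
      · exact (hr i (by omega)).2.1.symm
    · funext i
      split_ifs with hi
      · rw [hget _ (by omega)]
        simp only [hf]
        rw [if_neg (by omega), if_neg (by omega), if_neg (by omega), if_neg (by omega),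
          if_neg (by omega), if_pos (by omega)]
        congr 1; omega
      · exact (hr i (by omega)).2.2.1.symm
    · funext i
      split_ifs with hi
      · rw [hget _ (by omega)]
        simp only [hf]
        rw [if_neg (by omega), if_neg (by omega), if_neg (by omega), if_neg (by omega),
          if_neg (by omega), if_neg (by omega), if_pos (by omega)]
        congr 1; omega
      · exact (hr i (by omega)).2.2.2.1.symm
    · funext i
      split_ifs with hi
      · rw [hget _ (by omega)]
        simp only [hf]
        rw [if_neg (by omega), if_neg (by omega), if_neg (by omega), if_neg (by omega),
          if_neg (by omega), if_neg (by omega), if_neg (by omega), if_pos (by omega)]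
        congr 1; omega
      · exact (hr i (by omega)).2.2.2.2.symm
    · funext i
      split_ifs with hi
      · rw [hget _ (by omega)]
        simp only [hf]
        rw [if_neg (by omega), if_neg (by omega), if_neg (by omega), if_neg (by omega),
          if_neg (by omega), if_neg (by omega), if_neg (by omega), if_neg (by omega)]
        congr 1; omega
      · exact (hG.tau_rest i (by omega)).symm

end Data

end ColumnOutliers


/-! ### The tests of the algorithm as terms -/

namespace WordRAM.Term

open Finset
open scoped Classical

/-- The value of `t` is not zero. -/
def Sat (μ ρ : ℕ → ℕ) (t : Term) : Prop := t.eval μ ρ ≠ 0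

/-- `¬ t` -/
def neg (t : Term) : Term := .sub (.const 1) t
/-- `a < b` -/
def less (a b : Term) : Term := .sub b a
/-- `a ≤ b` -/
def leq (a b : Term) : Term := neg (.sub a b)
/-- `a = b` -/
def equal (a b : Term) : Term := neg (.add (.sub a b) (.sub b a))
/-- `a ∧ b` -/
def conj (a b : Term) : Term := .mul a b
/-- `a ∨ b` -/
def disj (a b : Term) : Term := .add a b
/-- `a → b` -/
def impl (a b : Term) : Term := .add (neg a) b
/-- `∀ r < g, t` -/
def all (r g : ℕ) (t : Term) : Term := neg (.sum r g (neg t))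
/-- `∃ r < g, t` -/
def any (r g : ℕ) (t : Term) : Term := .sum r g t
/-- `if t then a else b` -/
def select (t a b : Term) : Term := .add (.mul (neg (neg t)) a) (.mul (neg t) b)
/-- `#{r < g | t}` -/
def count (r g : ℕ) (t : Term) : Term := .sum r g (neg (neg t))
/-- `a % b` -/
def rem (a b : Term) : Term := .sub a (.mul (.div a b) b)

variable {μ ρ : ℕ → ℕ} {a b t : Term}

theorem sat_neg : Sat μ ρ (neg t) ↔ ¬ Sat μ ρ t := by simp only [Sat, neg, eval]; omega

theorem sat_less : Sat μ ρ (less a b) ↔ a.eval μ ρ < b.eval μ ρ := by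
  simp only [Sat, less, eval]; omega

theorem sat_leq : Sat μ ρ (leq a b) ↔ a.eval μ ρ ≤ b.eval μ ρ := by
  simp only [Sat, leq, neg, eval]; omega

theorem sat_equal : Sat μ ρ (equal a b) ↔ a.eval μ ρ = b.eval μ ρ := by
  simp only [Sat, equal, neg, eval]; omega

theorem sat_conj : Sat μ ρ (conj a b) ↔ Sat μ ρ a ∧ Sat μ ρ b := by simp [Sat, conj, eval]

theorem sat_disj : Sat μ ρ (disj a b) ↔ Sat μ ρ a ∨ Sat μ ρ b := by
  simp only [Sat, disj, eval]; omega

theorem sat_impl : Sat μ ρ (impl a b) ↔ (Sat μ ρ a → Sat μ ρ b) := by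
  simp only [Sat, impl, neg, eval]; omega

theorem sat_any {r g : ℕ} :
    Sat μ ρ (any r g t) ↔ ∃ i < ρ g, Sat μ (Function.update ρ r i) t := by
  simp [Sat, any, eval]

theorem sat_all {r g : ℕ} :
    Sat μ ρ (all r g t) ↔ ∀ i < ρ g, Sat μ (Function.update ρ r i) t := by
  have h := sat_any (μ := μ) (ρ := ρ) (t := neg t) (r := r) (g := g)
  simp only [sat_neg] at h
  change Sat μ ρ (neg (any r g (neg t))) ↔ _
  rw [sat_neg, h]
  push Not
  rfl

theorem eval_select : (select t a b).eval μ ρ = if Sat μ ρ t then a.eval μ ρ else b.eval μ ρ := by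
  simp only [Sat, select, neg, eval]
  by_cases h : t.eval μ ρ = 0
  · simp [h]
  · rw [show 1 - t.eval μ ρ = 0 by omega]; simp [h]

theorem eval_count {r g : ℕ} :
    (count r g t).eval μ ρ = #{i ∈ range (ρ g) | Sat μ (Function.update ρ r i) t} := by
  rw [card_filter]
  simp only [count, neg, eval, Sat]
  refine sum_congr rfl fun i _ => ?_
  by_cases h : t.eval μ (Function.update ρ r i) = 0
  · simp [h]
  · simp only [ne_eq, h, not_false_eq_true, if_true]; omega

theorem eval_rem : (rem a b).eval μ ρ = a.eval μ ρ % b.eval μ ρ := by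
  simp only [rem, eval]
  rw [mul_comm]
  exact (Nat.mod_eq_sub_mul_div).symm

end WordRAM.Term

/-! ### The memory layout, and the tests as terms. -/

namespace ColumnOutliers

open Finset WordRAM WordRAM.Term
open scoped Classical

/-- The registers and the memory describe the data `D`, the guess with the digits `g` and the
candidate with the digits `h`; the length of the candidate is `ρ q + c`. -/
structure Env (D : Data) (g h : ℕ → ℕ) (q c : ℕ) (μ ρ : ℕ → ℕ) : Prop where
  n : ρ 1 = D.n
  m : ρ 2 = D.m
  B : ρ 3 = D.B
  slots : ρ 4 = 2 * D.B
  gains : ρ 5 = 2 * D.n + 1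
  k : ρ 8 = D.k
  l : ρ 9 = D.l
  sig : ρ 10 = D.sig
  A : ∀ r < D.m, ∀ j < D.n, μ (6 + (j * D.m + r)) = D.A r j
  A_rest : ∀ r j, ¬ (r < D.m ∧ j < D.n) → D.A r j = 0
  al : ∀ v < D.sig, μ (6 + (D.n * D.m + v)) = D.al v
  al_rest : ∀ v, ¬ v < D.sig → D.al v = 0
  g : ∀ i < 3 + 11 * D.B, μ (ρ 11 + i) = g i
  -- Cells beyond the current length may contain old digits; reading them as 0 matches `getD` on the
  -- list of digits.
  h : ∀ i, (if i < ρ q + c then μ (ρ 12 + i) else 0) = h i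
  q_lt : q < 32

/-- The entry in row `r` and column `j`. -/
def tEntry (r j : Term) : Term :=
  select (conj (less r (.reg 2)) (less j (.reg 1)))
    (.load (.add (.const 6) (.add (.mul j (.reg 2)) r))) (.const 0)

/-- The letter with number `v`. -/
def tLetter (v : Term) : Term := select (less v (.reg 10))
  (.load (.add (.const 6) (.add (.mul (.reg 1) (.reg 2)) v))) (.const 0)

/-- The digit of the guess with number `d * B + t + 3`. -/
def tDigit (d : ℕ) (t : Term) : Term :=
  .load (.add (.reg 11) (.add (.add (.const 3) (.mul (.const d) (.reg 3))) t))

/-- An entry of the guess for slot `i`. -/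
def tSlot (d : ℕ) (i : Term) : Term := select (less i (.reg 4)) (tDigit d i) (.const 0)

def tKap (i : Term) : Term := select (less i (.reg 4)) (tDigit 0 i) (.reg 4)
def tChi (i : Term) : Term := tSlot 2 i
def tFl (i : Term) : Term := tSlot 4 i
def tUs (i : Term) : Term := tSlot 6 i
def tDs (i : Term) : Term := tSlot 8 i
def tTau (b : Term) : Term := select (less b (.reg 3)) (tDigit 10 b) (.const 0)

/-- The digit of the candidate with number `i`. -/
def tCand (q c : ℕ) (i : Term) : Term :=
  select (less i (.add (.reg q) (.const c))) (.load (.add (.reg 12) i)) (.const 0)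

/-- Bound variables live in the registers from 33 to 47, and nested terms use different ones. The
side conditions of the form `j ∉ [40, 41, 42]` in the lemmas about these terms exclude capture. -/
def tSame (i j : ℕ) : Term := all 40 2 (equal (tEntry (.reg 40) (.reg i)) (tEntry (.reg 40) (.reg j)))
def tRep (j : ℕ) : Term := all 41 1 (impl (less (.reg 41) (.reg j)) (neg (tSame 41 j)))
def tMult (j : ℕ) : Term := count 42 1 (tSame 42 j)
def tLarge (j : ℕ) : Term := conj (tRep j) (leq (.load (.add (.reg 11) (.const 2)))
  (.add (.mul (tMult j) (.reg 1)) (.reg j)))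
def tUsed (i : Term) : Term := less (tKap i) (.reg 4)
def tOff (i : ℕ) : Term :=
  .sum 37 4 (select (conj (less (.reg 37) (.reg i)) (tUsed (.reg 37))) (tDs (.reg 37)) (.const 0))
def tMark (i a : ℕ) : Term := tTau (.add (tOff i) (.reg a))
def tInX (i j : ℕ) : Term := conj (tRep j) (conj
  (equal (rem (rem (.mul (.load (.add (.reg 11) (.const 1))) (.reg j))
    (.load (.add (.reg 11) (.const 0))))
    (.add (.mul (.mul (.const 4) (.reg 3)) (.reg 3)) (.const 1))) (tChi (.reg i)))
  (conj (conj (impl (tLarge j) (tFl (.reg i))) (impl (tFl (.reg i)) (tLarge j)))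
    (leq (tUs (.reg i)) (tMult j))))
def tGain (i j : ℕ) : Term := .sub
  (.add (.reg 1) (select (equal (tDs (.reg i)) (.const 0)) (tMult j) (tUs (.reg i))))
  (select (tFl (.reg i)) (tMult j) (.const 0))

def tConsistent : Term :=
  conj (all 33 4 (impl (tUsed (.reg 33)) (conj
    (equal (tKap (tKap (.reg 33))) (tKap (.reg 33)))
    (conj (leq (tDs (tKap (.reg 33))) (tDs (.reg 33))) (leq (.const 1) (tUs (.reg 33))))))) <|
  conj (leq (.sum 33 4 (select (tUsed (.reg 33)) (.mul (tUs (.reg 33)) (tDs (.reg 33))) (.const 0)))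
    (.reg 3)) <|
  conj (all 33 4 (all 34 4 (impl (tUsed (.reg 33)) (impl (tUsed (.reg 34))
    (impl (equal (tChi (.reg 33)) (tChi (.reg 34))) (equal (.reg 33) (.reg 34))))))) <|
  all 35 4 (impl (equal (tKap (.reg 35)) (.reg 35)) (all 36 3 (impl (less (.reg 36) (tDs (.reg 35)))
    (leq (.sum 33 4 (select (equal (tKap (.reg 33)) (.reg 35)) (tUs (.reg 33)) (.const 0)))
      (.mul (.const 2) (.sum 33 4 (select (conj (equal (tKap (.reg 33)) (.reg 35)) (tMark 33 36))
        (tUs (.reg 33)) (.const 0))))))))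

/-- The row that is changed in step `a` of the candidate. -/
def tRow (q c a : ℕ) : Term := .div (tCand q c (.add (.reg a) (.const 1))) (.reg 10)

def tGood (q c s t : ℕ) : Term :=
  conj (less (tCand q c (.const 0)) (.reg 1)) <|
  conj (all 43 3 (impl (less (.reg 43) (.reg t))
    (less (tCand q c (.add (.reg 43) (.const 1))) (.mul (.reg 2) (.reg 10))))) <|
  all 33 4 (impl (equal (tKap (.reg 33)) (.reg s)) (any 44 1 (conj (tInX 33 44) (conj
    (leq (count 45 2 (neg (equal (tEntry (.reg 45) (.reg 44))
      (tEntry (.reg 45) (tCand q c (.const 0)))))) (.add (tDs (.reg s)) (tDs (.reg 33))))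
    (all 43 3 (impl (less (.reg 43) (.reg t)) (impl (tMark 33 43)
      (neg (equal (tEntry (tRow q c 43) (.reg 44))
        (tEntry (tRow q c 43) (tCand q c (.const 0)))))))))))) 

def tDiffers (q c s r j : ℕ) : Term :=
  disj (any 43 3 (conj (less (.reg 43) (tDs (.reg s))) (conj (equal (tRow q c 43) (.reg r))
    (neg (equal (tLetter (rem (tCand q c (.add (.reg 43) (.const 1))) (.reg 10)))
      (tEntry (.reg r) (.reg j)))))))
  (conj (all 43 3 (impl (less (.reg 43) (tDs (.reg s))) (neg (equal (tRow q c 43) (.reg r)))))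
    (neg (equal (tEntry (.reg r) (tCand q c (.const 0))) (tEntry (.reg r) (.reg j)))))

def tTop (q c s i : ℕ) : Term := count 47 5 (any 44 1 (conj
  (conj (tInX i 44) (leq (count 46 2 (tDiffers q c s 46 44)) (tDs (.reg i))))
  (less (.reg 47) (tGain i 44))))

def tLeafVal (q c s : ℕ) : Term :=
  select (all 33 4 (impl (equal (tKap (.reg 33)) (.reg s))
    (neg (equal (tTop q c s 33) (.const 0)))))
  (.sum 33 4 (select (equal (tKap (.reg 33)) (.reg s)) (tTop q c s 33) (.const 0))) (.const 0)

def tAccepts (total : ℕ) : Term :=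
  conj (leq (.add (count 44 1 (tLarge 44)) (count 33 4 (equal (tKap (.reg 33)) (.reg 33))))
    (.add (.reg 8) (count 33 4 (conj (tUsed (.reg 33)) (tFl (.reg 33))))))
  (leq (.add (.reg 1) (.mul (.reg 1) (count 33 4 (tUsed (.reg 33)))))
    (.add (.add (.sum 44 1 (select (tLarge 44) (tMult 44) (.const 0))) (.reg total)) (.reg 9)))

/-! ### The terms express the combinatorial notions. -/

namespace Env

variable {D : Data} {g h : ℕ → ℕ} {q c : ℕ} {μ ρ : ℕ → ℕ} (E : Env D g h q c μ ρ)
include E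

/-- The environment concerns registers below 32 only, so it persists under the binding of variables.
-/
theorem update {r : ℕ} (hr : 32 ≤ r) (v : ℕ) : Env D g h q c μ (Function.update ρ r v) := by
  have key : ∀ i < 32, Function.update ρ r v i = ρ i := fun i hi =>
    Function.update_of_ne (by omega) _ _
  obtain ⟨h1, h2, h3, h4, h5, h6, h7, h8, h9, h10, h11, h12, h13, h14, h15⟩ := E
  constructor
  all_goals first | assumption | skip
  all_goals first | (rw [key _ (by omega)]; assumption) | skip
  · intro i; rw [key _ h15, key 12 (by omega)]; exact h14 i

theorem eval_entry (r j : Term) :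
    (tEntry r j).eval μ ρ = D.A (r.eval μ ρ) (j.eval μ ρ) := by
  simp only [tEntry, eval_select, sat_conj, sat_less, Term.eval, E.n, E.m]
  split_ifs with hc
  · exact E.A _ hc.1 _ hc.2
  · exact (E.A_rest _ _ hc).symm

theorem eval_letter (v : Term) : (tLetter v).eval μ ρ = D.al (v.eval μ ρ) := by
  simp only [tLetter, eval_select, sat_less, Term.eval, E.n, E.m, E.sig]
  split_ifs with hc
  · exact E.al _ hc
  · exact (E.al_rest _ hc).symm

theorem eval_digit (d : ℕ) (t : Term) (ht : d * D.B + t.eval μ ρ < 11 * D.B) :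
    (tDigit d t).eval μ ρ = g (3 + d * D.B + t.eval μ ρ) := by
  simp only [tDigit, Term.eval, E.B]
  exact E.g _ (by omega)

theorem eval_kap (i : Term) : (tKap i).eval μ ρ = (D.guess g).kap (i.eval μ ρ) := by
  simp only [tKap, eval_select, sat_less, Term.eval, E.slots, Data.guess]
  split_ifs with hc
  · rw [E.eval_digit _ _ (by omega)]; congr 1; omega
  · rfl

theorem eval_slot (d : ℕ) (hd : d ≤ 9) (i : Term) : (tSlot d i).eval μ ρ =
    if i.eval μ ρ < 2 * D.B then g (3 + d * D.B + i.eval μ ρ) else 0 := by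
  simp only [tSlot, eval_select, sat_less, Term.eval, E.slots]
  split_ifs with hc
  · have := Nat.mul_le_mul_right D.B hd
    exact E.eval_digit _ _ (by omega)
  · rfl

theorem eval_chi (i : Term) : (tChi i).eval μ ρ = (D.guess g).chi (i.eval μ ρ) :=
  E.eval_slot 2 (by omega) i

theorem eval_fl (i : Term) : (tFl i).eval μ ρ = (D.guess g).fl (i.eval μ ρ) :=
  E.eval_slot 4 (by omega) i

theorem eval_us (i : Term) : (tUs i).eval μ ρ = (D.guess g).us (i.eval μ ρ) :=
  E.eval_slot 6 (by omega) i

theorem eval_ds (i : Term) : (tDs i).eval μ ρ = (D.guess g).ds (i.eval μ ρ) :=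
  E.eval_slot 8 (by omega) i

theorem eval_tau (b : Term) : (tTau b).eval μ ρ = (D.guess g).tau (b.eval μ ρ) := by
  simp only [tTau, eval_select, sat_less, Term.eval, E.B, Data.guess]
  split_ifs with hc
  · exact E.eval_digit _ _ (by omega)
  · rfl

theorem eval_cand (i : Term) : (tCand q c i).eval μ ρ = h (i.eval μ ρ) := by
  simp only [tCand, eval_select, sat_less, Term.eval]
  exact E.h _

theorem sat_same {i j : ℕ} (hi : i ≠ 40) (hj : j ≠ 40) :
    Sat μ ρ (tSame i j) ↔ D.Same (ρ i) (ρ j) := by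
  simp only [tSame, sat_all, sat_equal, E.m]
  refine forall₂_congr fun r _ => ?_
  rw [(E.update (by omega) r).eval_entry, (E.update (by omega) r).eval_entry]
  simp [Term.eval, Function.update_of_ne hi, Function.update_of_ne hj]

theorem sat_rep {j : ℕ} (hj : j ∉ [40, 41]) : Sat μ ρ (tRep j) ↔ D.Rep (ρ j) := by
  simp only [List.mem_cons, List.not_mem_nil, or_false, not_or] at hj
  simp only [tRep, sat_all, sat_impl, sat_neg, sat_less, E.n]
  refine forall₂_congr fun i _ => ?_
  rw [(E.update (by omega) i).sat_same (by omega) hj.1]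
  simp [Term.eval, Function.update_of_ne hj.2]

theorem eval_mult {j : ℕ} (hj : j ∉ [40, 42]) : (tMult j).eval μ ρ = D.mult (ρ j) := by
  simp only [List.mem_cons, List.not_mem_nil, or_false, not_or] at hj
  simp only [tMult, eval_count, E.n]
  unfold Data.mult
  congr 1
  refine filter_congr fun i _ => ?_
  rw [(E.update (by omega) i).sat_same (by omega) hj.1]
  simp [Function.update_of_ne hj.2]

theorem eval_digit_lt {d : ℕ} (hd : d < 3) :
    Term.eval μ (.load (.add (.reg 11) (.const d))) ρ = g d := E.g d (by omega)

theorem sat_large {j : ℕ} (hj : j ∉ [40, 41, 42]) :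
    Sat μ ρ (tLarge j) ↔ D.Large (D.guess g) (ρ j) := by
  simp only [List.mem_cons, List.not_mem_nil, or_false, not_or] at hj
  rw [tLarge, sat_conj, sat_leq, E.sat_rep (by simp [hj]), E.eval_digit_lt (by omega)]
  simp only [Term.eval]
  rw [E.eval_mult (by simp [hj]), E.n]
  rfl

theorem sat_used (i : Term) : Sat μ ρ (tUsed i) ↔ D.Used (D.guess g) (i.eval μ ρ) := by
  rw [tUsed, sat_less, E.eval_kap]
  simp only [Term.eval, E.slots]
  rfl

theorem eval_off {i : ℕ} (hi : i ≠ 37) : (tOff i).eval μ ρ = D.off (D.guess g) (ρ i) := by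
  simp only [tOff, Term.eval, E.slots]
  refine sum_congr rfl fun x _ => ?_
  have E' := E.update (r := 37) (by omega) x
  rw [eval_select, E'.eval_ds]
  refine if_congr ?_ (by simp [Term.eval]) rfl
  rw [sat_conj, sat_less, E'.sat_used]
  simp [Term.eval, Function.update_of_ne hi]

theorem sat_mark {i a : ℕ} (hi : i ≠ 37) :
    Sat μ ρ (tMark i a) ↔ D.Mark (D.guess g) (ρ i) (ρ a) := by
  rw [Sat, tMark, E.eval_tau]
  simp only [Term.eval]
  rw [E.eval_off hi]
  rfl

theorem sat_fl (i : Term) : Sat μ ρ (tFl i) ↔ (D.guess g).fl (i.eval μ ρ) ≠ 0 := by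
  rw [Sat, E.eval_fl]

theorem sat_inX {i j : ℕ} (hj : j ∉ [40, 41, 42]) :
    Sat μ ρ (tInX i j) ↔ D.InX (D.guess g) (ρ i) (ρ j) := by
  have hj' := hj
  simp only [List.mem_cons, List.not_mem_nil, or_false, not_or] at hj
  rw [tInX, sat_conj, sat_conj, sat_conj, sat_conj, sat_impl, sat_impl, sat_leq, sat_equal,
    E.sat_rep (by simp [hj]), E.sat_large hj', E.sat_fl, E.eval_us, E.eval_mult (by simp [hj]),
    E.eval_chi, eval_rem, eval_rem, E.eval_digit_lt (by omega)]
  simp only [Term.eval]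
  rw [E.B, E.g 1 (by omega), ← iff_iff_implies_and_implies]
  rfl

theorem eval_gain {i j : ℕ} (hj : j ∉ [40, 42]) :
    (tGain i j).eval μ ρ = D.gain (D.guess g) (ρ i) (ρ j) := by
  simp only [tGain, Term.eval, eval_select]
  rw [E.eval_mult hj, E.eval_us, E.n]
  unfold Data.gain
  refine congrArg₂ _ (congrArg _ (if_congr ?_ rfl rfl)) (if_congr (E.sat_fl _) rfl rfl)
  rw [sat_equal, E.eval_ds]
  rfl

theorem sat_consistent : Sat μ ρ tConsistent ↔ D.Consistent (D.guess g) := by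
  have E1 := fun i => E.update (r := 33) (by omega) i
  have E2 := fun i j => (E1 i).update (r := 34) (by omega) j
  have E3 := fun s => E.update (r := 35) (by omega) s
  have E4 := fun s a => (E3 s).update (r := 36) (by omega) a
  have E5 := fun s a i => (E4 s a).update (r := 33) (by omega) i
  simp only [tConsistent, sat_conj, sat_all, sat_impl, sat_leq, sat_equal, sat_less,
    (E1 _).sat_used, (E2 _ _).sat_used, (E1 _).eval_kap, (E3 _).eval_kap, (E5 _ _ _).eval_kap, (E1 _).eval_ds,
    (E1 _).eval_us, (E2 _ _).eval_chi, (E4 _ _).eval_ds, Term.eval, eval_select,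
    (E5 _ _ _).eval_us, (E5 _ _ _).sat_mark (i := 33) (a := 36) (by omega),
    Function.update_self, E.slots, E.B, (E1 _).slots, (E3 _).B, (E4 _ _).slots,
    Function.update_of_ne (show (33 : ℕ) ≠ 34 by omega),
    Function.update_of_ne (show (35 : ℕ) ≠ 33 by omega),
    Function.update_of_ne (show (35 : ℕ) ≠ 36 by omega),
    Function.update_of_ne (show (36 : ℕ) ≠ 33 by omega)]
  constructor
  · rintro ⟨h1, h2, h3, h4⟩
    exact ⟨h1, h2, fun i hi j hj hu hu' => h3 i hi j hj hu hu', h4⟩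
  · rintro ⟨h1, h2, h3, h4⟩
    exact ⟨h1, h2, h3, h4⟩

theorem eval_row (a : ℕ) : (tRow q c a).eval μ ρ = h (ρ a + 1) / D.sig := by
  simp only [tRow, Term.eval, E.eval_cand, E.sig]

theorem sat_good {s t : ℕ} (hs : s < 32) (ht : t < 32) :
    Sat μ ρ (tGood q c s t) ↔ D.Good (D.guess g) (ρ s) (ρ t) h := by
  have E1 := fun i => E.update (r := 33) (by omega) i
  have E2 := fun i j => (E1 i).update (r := 44) (by omega) j
  have E3 := fun i j a => (E2 i j).update (r := 43) (by omega) a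
  have E4 := fun i j r => (E2 i j).update (r := 45) (by omega) r
  have E5 := fun a => E.update (r := 43) (by omega) a
  simp only [tGood, sat_conj, sat_all, sat_any, sat_impl, sat_leq, sat_equal, sat_less, sat_neg,
    E.eval_cand, (E5 _).eval_cand, (E1 _).eval_kap, (E2 _ _).sat_inX (i := 33) (j := 44) (by simp),
    (E4 _ _ _).eval_entry, (E3 _ _ _).eval_entry, eval_count, (E4 _ _ _).eval_cand,
    (E3 _ _ _).eval_cand, (E3 _ _ _).eval_row, (E2 _ _).eval_ds,
    (E3 _ _ _).sat_mark (i := 33) (a := 43) (by omega), Term.eval, E.n, E.B, E.slots,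
    (E1 _).n, (E2 _ _).m, (E2 _ _).B, (E5 _).m, (E5 _).sig, Function.update_self,
    Function.update_of_ne (show (33 : ℕ) ≠ 44 by omega),
    Function.update_of_ne (show (33 : ℕ) ≠ 43 by omega),
    Function.update_of_ne (show (44 : ℕ) ≠ 43 by omega),
    Function.update_of_ne (show (44 : ℕ) ≠ 45 by omega),
    Function.update_of_ne (show s ≠ 33 by omega), Function.update_of_ne (show s ≠ 44 by omega),
    Function.update_of_ne (show t ≠ 33 by omega), Function.update_of_ne (show t ≠ 44 by omega),
    Function.update_of_ne (show t ≠ 43 by omega)]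
  rfl

theorem sat_differs {s r j : ℕ} (hs : s ≠ 43) (hr : r ≠ 43) (hj : j ≠ 43) :
    Sat μ ρ (tDiffers q c s r j) ↔ D.Differs (D.guess g) (ρ s) h (ρ r) (ρ j) := by
  have E1 := fun a => E.update (r := 43) (by omega) a
  simp only [tDiffers, sat_disj, sat_conj, sat_all, sat_any, sat_impl, sat_equal, sat_less,
    sat_neg, (E1 _).eval_ds, (E1 _).eval_row, (E1 _).eval_letter, (E1 _).eval_entry, eval_rem,
    (E1 _).eval_cand, E.eval_entry, E.eval_cand, Term.eval, E.B, (E1 _).sig, Function.update_self,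
    Function.update_of_ne hs, Function.update_of_ne hr, Function.update_of_ne hj]
  rfl

theorem eval_top {s i : ℕ} (hs : s ∉ [43, 44, 46, 47]) (hi : i ∉ [44, 46, 47]) :
    (tTop q c s i).eval μ ρ = D.top (D.guess g) (ρ s) h (ρ i) := by
  simp only [List.mem_cons, List.not_mem_nil, or_false, not_or] at hs hi
  have E1 := fun v => E.update (r := 47) (by omega) v
  have E2 := fun v j => (E1 v).update (r := 44) (by omega) j
  have E3 := fun v j r => (E2 v j).update (r := 46) (by omega) r
  simp only [tTop, eval_count, E.gains, sat_any, (E1 _).n, sat_conj, sat_leq, sat_less,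
    (E2 _ _).m, (E2 _ _).eval_ds, Term.eval,
    (E2 _ _).sat_inX (i := i) (j := 44) (by simp), (E2 _ _).eval_gain (i := i) (j := 44) (by simp),
    (E3 _ _ _).sat_differs (s := s) (r := 46) (j := 44) hs.1 (by omega) (by omega),
    Function.update_self, Function.update_of_ne (show (44 : ℕ) ≠ 46 by omega),
    Function.update_of_ne (show (47 : ℕ) ≠ 44 by omega),
    Function.update_of_ne hs.2.1, Function.update_of_ne hs.2.2.1, Function.update_of_ne hs.2.2.2,
    Function.update_of_ne hi.1, Function.update_of_ne hi.2.2]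
  unfold Data.top Data.Fit
  congr!

theorem eval_leafVal {s : ℕ} (hs : s < 32) :
    (tLeafVal q c s).eval μ ρ = D.leafVal (D.guess g) (ρ s) h := by
  have E1 := fun i => E.update (r := 33) (by omega) i
  simp only [tLeafVal, eval_select, sat_all, sat_impl, sat_neg, sat_equal, (E1 _).eval_kap,
    (E1 _).eval_top (s := s) (i := 33) (by simp; omega) (by simp), Term.eval, E.slots,
    Function.update_self, Function.update_of_ne (show s ≠ 33 by omega)]
  rfl

theorem sat_accepts {total : ℕ} :
    Sat μ ρ (tAccepts total) ↔ D.Accepts (D.guess g) (ρ total) := by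
  have E1 := fun i => E.update (r := 33) (by omega) i
  have E2 := fun i => E.update (r := 44) (by omega) i
  simp only [tAccepts, sat_conj, sat_leq, eval_count, sat_equal, (E1 _).eval_kap, (E1 _).sat_used,
    (E1 _).sat_fl, (E2 _).sat_large (j := 44) (by simp), (E2 _).eval_mult (j := 44) (by simp),
    eval_select, Term.eval, E.n, E.k, E.l, E.slots, Function.update_self]
  rfl

end Env

theorem wf_consistent : tConsistent.WF := by decide
theorem wf_good : (tGood 19 1 23 19).WF := by decide
theorem wf_accepts : (tAccepts 25).WF := by decide

end ColumnOutliers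


/-! ### Loops, initialization and the input -/

namespace WordRAM

section
variable {W X R : ℕ}

theorem ends_while_count {r b T : ℕ} {p : Program} (Inv : ℕ → State → Prop)
    (htest : ∀ i s, Inv i s → s.reg r = b - i)
    (hbody : ∀ i < b, ∀ s, Inv i s → Ends W p s T (Inv (i + 1))) {s : State} (hs : Inv 0 s) :
    Ends W (.while r p) s (b * (T + 1) + 1) (Inv b) := by
  have key : ∀ d i s, i + d = b → Inv i s → Ends W (.while r p) s (d * (T + 1) + 1) (Inv b) := by
    intro d
    induction d with
    | zero =>
      intro i s hi hs
      have hib : i = b := by omega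
      subst hib
      exact ⟨1, by omega, s, .while_false (by rw [htest i s hs]; omega), hs⟩
    | succ d ih =>
      intro i s hi hs
      obtain ⟨τ, hτ, s1, hr1, hs1⟩ := hbody i (by omega) s hs
      obtain ⟨τ2, hτ2, s2, hr2, hs2⟩ := ih (i + 1) s1 (by omega) hs1
      refine ⟨τ + τ2 + 1, ?_, s2, .while_true (by rw [htest i s hs]; omega) hr1 hr2, hs2⟩
      have : (d + 1) * (T + 1) = d * (T + 1) + (T + 1) := by ring
      omega
  exact key b 0 s (by omega) hs

/-- Assign the values of terms to registers. -/
def assigns : List (ℕ × Term) → Program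
  | [] => .skip
  | a :: l => .seq (assign a.1 a.2) (assigns l)

/-- The initial assignments. The terms refer to the memory and to register `0` only. -/
theorem ends_assigns (l : List (ℕ × Term)) (s : State) (hs : Bounded X R s)
    (hfit : ∀ a ∈ l, a.2.Fits W X ∧ 1 ≤ a.1 ∧ a.1 < 64)
    (hclosed : ∀ a ∈ l, ∀ ρ ρ' : ℕ → ℕ, ρ 0 = ρ' 0 → a.2.eval s.mem ρ = a.2.eval s.mem ρ')
    (hX : ∀ a ∈ l, a.2.eval s.mem s.reg ≤ X) (hR : ∀ a ∈ l, a.1 ≤ 6 → a.2.eval s.mem s.reg ≤ R)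
    (hnd : (l.map Prod.fst).Nodup) :
    Ends W (assigns l) s ((l.map fun a => a.2.time R + 2).sum) fun s' =>
      s'.mem = s.mem ∧ Bounded X R s' ∧ (∀ a ∈ l, s'.reg a.1 = a.2.eval s.mem s.reg) ∧
      ∀ q < 64, (∀ a ∈ l, a.1 ≠ q) → s'.reg q = s.reg q := by
  induction l generalizing s with
  | nil => exact ends_skip ⟨rfl, hs, by simp, fun _ _ _ => rfl⟩
  | cons a l ih =>
    have ha := hfit a (by simp)
    rw [List.map_cons, List.nodup_cons] at hnd
    rw [List.map_cons, List.sum_cons]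
    refine (ends_assign ha.1 ha.2.2 hs).seq fun s1 h1 => ?_
    have hm1 : s1.mem = s.mem := h1.2
    have hq1 : ∀ q < 64, q ≠ a.1 → s1.reg q = s.reg q := fun q hq e => by
      rw [h1.1 q hq]; simp [Function.update_of_ne e]
    have ha1 : s1.reg a.1 = a.2.eval s.mem s.reg := by rw [h1.1 _ ha.2.2]; simp
    have h0 : s1.reg 0 = s.reg 0 := hq1 0 (by omega) (by omega)
    have hb1 : Bounded X R s1 := by
      refine ⟨fun q hq => ?_, fun b => by rw [hm1]; exact hs.mem b, fun q hq hq' => ?_⟩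
      · by_cases e : q = a.1
        · subst e; rw [ha1]; exact hX a (by simp)
        · rw [hq1 q hq e]; exact hs.reg q hq
      · by_cases e : q = a.1
        · subst e; rw [ha1]; exact hR a (by simp) hq'
        · rw [hq1 q (by omega) e]; exact hs.loop q hq hq'
    have hv : ∀ b ∈ l, b.2.eval s1.mem s1.reg = b.2.eval s.mem s.reg := fun b hb => by
      rw [hm1]; exact hclosed b (by simp [hb]) _ _ h0
    refine (ih s1 hb1 (fun b hb => hfit b (by simp [hb]))
      (fun b hb => by rw [hm1]; exact hclosed b (by simp [hb]))
      (fun b hb => by rw [hv b hb]; exact hX b (by simp [hb]))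
      (fun b hb => by rw [hv b hb]; exact hR b (by simp [hb])) hnd.2).mono le_rfl ?_
    rintro s2 ⟨hm2, hb2, hl2, hq2⟩
    refine ⟨hm2.trans hm1, hb2, fun b hb => ?_, fun q hq hne => ?_⟩
    · rcases List.mem_cons.1 hb with rfl | hb
      · rw [hq2 _ ha.2.2 fun c hc e => hnd.1 (List.mem_map.2 ⟨c, hc, e⟩), ha1]
      · rw [hl2 b hb, hv b hb]
    · rw [hq2 q hq fun b hb => hne b (by simp [hb]), hq1 q hq fun e => hne a (by simp) e.symm]

end

theorem getD_le_foldr_max (l : List ℕ) (i : ℕ) : l.getD i 0 ≤ l.foldr max 0 := by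
  induction l generalizing i with
  | nil => simp
  | cons a l ih =>
    rcases i with - | i
    · simp
    · simpa using Or.inr (ih i)

end WordRAM

/-! ### The input in memory. -/

namespace ColumnOutliers

open Finset WordRAM WordRAM.Term

theorem getD_flatMap_finRange {n m : ℕ} (f : Fin n → Fin m → ℕ) (l : List (Fin n)) (t : List ℕ)
    (j : ℕ) (hj : j < l.length) (r : Fin m) :
    (l.flatMap (fun j => (List.finRange m).map (f j)) ++ t).getD (j * m + r) 0 = f l[j] r := by
  induction l generalizing j with
  | nil => simp at hj
  | cons a l ih =>
    rcases j with - | j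
    · rw [List.flatMap_cons, List.append_assoc, List.getD_append _ _ _ _ (by simp)]
      rw [List.getD_eq_getElem _ _ (by simp)]
      simp
    · rw [List.flatMap_cons, List.append_assoc, List.getD_append_right _ _ _ _ (by simp; nlinarith)]
      simp only [List.length_map, List.length_finRange, List.getElem_cons_succ]
      rw [← ih j (by simpa using hj)]
      congr 1
      rw [add_mul, one_mul]
      omega

namespace Instance

variable (x : Instance)

theorem length_flatMap_entries :
    ((List.finRange x.n).flatMap (fun j => (List.finRange x.m).map fun i => x.A i j)).length =
      x.n * x.m := by
  rw [List.length_flatMap]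
  simp

theorem encode_eq : x.encode = x.m :: x.n :: x.k :: x.B :: x.l :: #x.alphabet ::
    ((List.finRange x.n).flatMap (fun j => (List.finRange x.m).map fun i => x.A i j) ++
      x.alphabet.sort (· ≤ ·)) := by
  simp [encode]

theorem length_encode : x.encode.length = 6 + x.n * x.m + #x.alphabet := by
  rw [encode_eq]
  simp only [List.length_cons, List.length_append, length_flatMap_entries, length_sort]
  omega

theorem encode_entry {r j : ℕ} (hr : r < x.m) (hj : j < x.n) :
    x.encode.getD (6 + (j * x.m + r)) 0 = x.toData.A r j := by
  rw [encode_eq, add_comm]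
  have := getD_flatMap_finRange (fun j i => x.A i j) (List.finRange x.n)
    (x.alphabet.sort (· ≤ ·)) j (by simpa using hj) ⟨r, hr⟩
  simp only [List.getD_cons_succ]
  refine this.trans ?_
  simp [toData, hr, hj]

theorem encode_letter {v : ℕ} :
    x.encode.getD (6 + (x.n * x.m + v)) 0 = x.toData.al v := by
  rw [encode_eq, add_comm]
  simp only [List.getD_cons_succ]
  rw [List.getD_append_right _ _ _ _ (by rw [length_flatMap_entries]; omega),
    length_flatMap_entries, Nat.add_sub_cancel_left]
  rfl

end Instance

end ColumnOutliers


/-! ### The algorithm -/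

namespace ColumnOutliers

open Finset WordRAM WordRAM.Term
open scoped Classical

/-- A bound for the first three digits of a guess. -/
def Data.wide (D : Data) : ℕ := (2 * D.n + 2) * (2 * D.n + 2)

/-- A bound for the other digits of a guess. -/
def Data.narrow (D : Data) : ℕ := 4 * D.B * D.B + 2 * D.B + 2

/-- The registers that do not change after the initialization. -/
def fixedRegs : List ℕ := [1, 2, 3, 4, 5, 8, 9, 10, 11, 12, 13, 14, 15, 29, 30]

/-- The contents of the registers and of the memory after the initialization. -/
structure Setting (D : Data) (N : ℕ) (μ₀ ρ₀ : ℕ → ℕ) : Prop where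
  n : ρ₀ 1 = D.n
  m : ρ₀ 2 = D.m
  B : ρ₀ 3 = D.B
  slots : ρ₀ 4 = 2 * D.B
  gains : ρ₀ 5 = 2 * D.n + 1
  k : ρ₀ 8 = D.k
  l : ρ₀ 9 = D.l
  sig : ρ₀ 10 = D.sig
  base₁ : ρ₀ 11 = N
  base₂ : ρ₀ 12 = N + (3 + 11 * D.B)
  digits₁ : ρ₀ 13 = D.wide + D.narrow
  len₁ : ρ₀ 14 = 3 + 11 * D.B
  digits₂ : ρ₀ 15 = D.n + D.m * D.sig
  wide : ρ₀ 29 = D.wide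
  narrow : ρ₀ 30 = D.narrow
  length : N = 6 + D.n * D.m + D.sig
  A : ∀ r < D.m, ∀ j < D.n, μ₀ (6 + (j * D.m + r)) = D.A r j
  A_rest : ∀ r j, ¬ (r < D.m ∧ j < D.n) → D.A r j = 0
  al : ∀ v < D.sig, μ₀ (6 + (D.n * D.m + v)) = D.al v
  al_rest : ∀ v, ¬ v < D.sig → D.al v = 0

/-- The state agrees with the state after the initialization. -/
structure Frame (N X R : ℕ) (μ₀ ρ₀ : ℕ → ℕ) (s : State) : Prop where
  bounded : Bounded X R s
  reg : ∀ q ∈ fixedRegs, s.reg q = ρ₀ q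
  mem : ∀ a < N, s.mem a = μ₀ a

/-- `X` is large enough. -/
structure Room (D : Data) (N X : ℕ) : Prop where
  two_le : 2 ≤ X
  base : N + (3 + 11 * D.B) ≤ X
  digits₁ : D.wide + D.narrow ≤ X
  digits₂ : D.n + D.m * D.sig ≤ X
  -- Room for the sum of the best gains: `2 * B` clusters, each with `2 * B` slots of gain at most
  -- `2 * n + 1`.
  total : 2 * D.B * (2 * D.B * (2 * D.n + 1)) ≤ X

theorem Room.len_le {D : Data} {N X : ℕ} (h : Room D N X) : 2 + D.B ≤ X := by
  have h1 := h.digits₁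
  have : 2 + D.B ≤ D.narrow := by unfold Data.narrow; nlinarith [Nat.zero_le (D.B * D.B)]
  omega

variable {D : Data} {N W X R : ℕ} {μ₀ ρ₀ : ℕ → ℕ} {s s' : State}

theorem Frame.of_eq (hs : Frame N X R μ₀ ρ₀ s) (hr : ∀ q ∈ fixedRegs, s'.reg q = s.reg q)
    (hm : ∀ a < N, s'.mem a = s.mem a) (hb : Bounded X R s') : Frame N X R μ₀ ρ₀ s' :=
  ⟨hb, fun q hq => (hr q hq).trans (hs.reg q hq), fun a ha => (hm a ha).trans (hs.mem a ha)⟩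

theorem lt_of_mem_fixedRegs {q : ℕ} (hq : q ∈ fixedRegs) : q < 64 := by
  simp only [fixedRegs, List.mem_cons, List.not_mem_nil, or_false] at hq; omega

theorem Frame.agrees (hs : Frame N X R μ₀ ρ₀ s) (h : s.Agrees s') : Frame N X R μ₀ ρ₀ s' :=
  hs.of_eq (fun q hq => h.1 q (lt_of_mem_fixedRegs hq)) (fun a _ => by rw [h.2])
    (hs.bounded.of_agrees h)

/-- The states `s` and `s'` differ at most in register `r`, which contains `v` in `s'`. -/
structure Updates (r v : ℕ) (s s' : State) : Prop where
  eq : s'.reg r = v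
  other : ∀ q < 64, q ≠ r → s'.reg q = s.reg q
  mem : s'.mem = s.mem

theorem Frame.ends_assign {r : ℕ} {t : Term} (hs : Frame N X R μ₀ ρ₀ s) (ht : t.Fits W X)
    (hr : 7 ≤ r ∧ r < 64 ∧ r ∉ fixedRegs) (hv : t.eval s.mem s.reg ≤ X) {T : ℕ}
    (hT : t.time R + 2 ≤ T) :
    Ends W (assign r t) s T fun s' =>
      Frame N X R μ₀ ρ₀ s' ∧ Updates r (t.eval s.mem s.reg) s s' := by
  refine (WordRAM.ends_assign ht hr.2.1 hs.bounded).mono hT fun s' h => ?_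
  have ho : ∀ q < 64, q ≠ r → s'.reg q = s.reg q := fun q hq e => by
    rw [h.1 q hq]; simp [Function.update_of_ne e]
  refine ⟨hs.of_eq (fun q hq => ho q (lt_of_mem_fixedRegs hq) fun e => hr.2.2 (e ▸ hq))
    (fun a _ => by rw [h.2]; rfl) ((hs.bounded.set hr.1 hv).of_agrees h), ?_, ho, h.2⟩
  rw [h.1 r hr.2.1]; simp

theorem Holds.of_mem {p : List ℕ} {b : ℕ} (h : Holds s b p) (hm : s'.mem = s.mem) :
    Holds s' b p := fun i hi => by rw [hm]; exact h i hi

theorem Frame.env (hs : Frame N X R μ₀ ρ₀ s) (S : Setting D N μ₀ ρ₀) {g : List ℕ}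
    (hlen : g.length = 3 + 11 * D.B) (hg : Holds s N g) {h : ℕ → ℕ} {q c : ℕ} (hq : q < 32)
    (hh : ∀ i, (if i < s.reg q + c then s.mem (s.reg 12 + i) else 0) = h i) :
    Env D (g.getD · 0) h q c s.mem s.reg := by
  have f : ∀ q ∈ fixedRegs, s.reg q = ρ₀ q := hs.reg
  refine ⟨?_, ?_, ?_, ?_, ?_, ?_, ?_, ?_, fun r hr j hj => ?_, S.A_rest, fun v hv => ?_,
    S.al_rest, fun i hi => ?_, hh, hq⟩
  · rw [f 1 (by simp [fixedRegs]), S.n]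
  · rw [f 2 (by simp [fixedRegs]), S.m]
  · rw [f 3 (by simp [fixedRegs]), S.B]
  · rw [f 4 (by simp [fixedRegs]), S.slots]
  · rw [f 5 (by simp [fixedRegs]), S.gains]
  · rw [f 8 (by simp [fixedRegs]), S.k]
  · rw [f 9 (by simp [fixedRegs]), S.l]
  · rw [f 10 (by simp [fixedRegs]), S.sig]
  · rw [hs.mem _ ?_, S.A r hr j hj]
    have h1 := Nat.mul_le_mul_right D.m (show j + 1 ≤ D.n from hj)
    have := S.length
    rw [add_mul] at h1
    omega
  · rw [hs.mem _ ?_, S.al v hv]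
    have := S.length
    omega
  · rw [f 11 (by simp [fixedRegs]), S.base₁]
    exact hg i (by omega)

/-- The term for the new value of the best gain. -/
def tBest : Term := .add (.reg 24) (.sub (tLeafVal 16 0 23) (.reg 24))

/-- The search for the center of the cluster of slot `reg 23`. -/
def centerSearch : Program := backtrack 19 20 22 16 15 12 (tGood 19 1 23 19) (assign 24 tBest)

/-- The processing of slot `reg 23`. -/
def slotBody : Program :=
  .seq (cond (equal (tKap (.reg 23)) (.reg 23))
    -- Register 24 holds the best gain of the cluster and 25 the running total. Register 26 stays 1
    -- as long as every cluster has had a positive gain; 0 means that no center was found.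
    (.seq (assign 24 (.const 0)) <| .seq (assign 16 (.add (.const 1) (tDs (.reg 23)))) <|
      .seq centerSearch <| .seq (assign 25 (.add (.reg 25) (.reg 24)))
        (assign 26 (.mul (.reg 26) (neg (neg (.reg 24)))))) .skip) <|
  .seq (assign 23 (.add (.reg 23) (.const 1))) (assign 28 (.sub (.reg 4) (.reg 23)))

/-- The processing of a guess. -/
def guessLeaf : Program :=
  cond tConsistent
    (.seq (assign 23 (.const 0)) <| .seq (assign 25 (.const 0)) <| .seq (assign 26 (.const 1)) <|
      .seq (assign 28 (.reg 4)) <| .seq (.while 28 slotBody) <|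
      cond (conj (.reg 26) (tAccepts 25)) (assign 27 (.const 1)) .skip) .skip

/-- The test of the last digit of a guess. -/
def tDigitTest : Term := less (.load (.add (.reg 11) (.reg 17)))
  (select (less (.reg 17) (.const 3)) (.reg 29) (.reg 30))

/-- The search for a guess. -/
def guessSearch : Program := backtrack 17 18 21 14 13 11 tDigitTest guessLeaf

/-- A bound for the degrees of the terms. -/
def maxDeg : ℕ :=
  (tGood 19 1 23 19).deg + tBest.deg + tConsistent.deg + (tAccepts 25).deg + tDigitTest.deg + 200

theorem wf_best : tBest.WF := by decide
theorem wf_digitTest : tDigitTest.WF := by decide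

theorem fits_of_le {t : Term} (hX : 2 ≤ X) (hW : X ^ maxDeg < W) (ht : t.WF)
    (hd : t.deg ≤ maxDeg) : t.Fits W X :=
  ⟨hX, ht, (Nat.pow_le_pow_right (by omega) hd).trans_lt hW⟩

/-- The prefix `p` of a candidate is to be pursued. -/
def GoodPrefix (D : Data) (G : Guess) (sl : ℕ) (p : List ℕ) : Prop :=
  D.Good G sl (p.length - 1) (p.getD · 0)

/-- The largest value on a list. -/
def best (v : List ℕ → ℕ) (L : List (List ℕ)) : ℕ := L.foldl (fun b p => max b (v p)) 0

theorem best_append (v : List ℕ → ℕ) (L : List (List ℕ)) (p : List ℕ) :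
    best v (L ++ [p]) = max (best v L) (v p) := by simp [best]

theorem le_best (v : List ℕ → ℕ) (L : List (List ℕ)) {p : List ℕ} (hp : p ∈ L) :
    v p ≤ best v L := by
  induction L using List.reverseRecOn with
  | nil => simp at hp
  | append_singleton L q ih =>
    rw [best_append]
    simp only [List.mem_append, List.mem_singleton] at hp
    rcases hp with hp | rfl
    · exact (ih hp).trans (le_max_left _ _)
    · exact le_max_right _ _

theorem exists_eq_best (v : List ℕ → ℕ) (L : List (List ℕ)) (h : best v L ≠ 0) :
    ∃ p ∈ L, v p = best v L := by
  induction L using List.reverseRecOn with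
  | nil => simp [best] at h
  | append_singleton L q ih =>
    rw [best_append] at h ⊢
    rcases le_total (best v L) (v q) with hle | hle
    · exact ⟨q, by simp, (max_eq_right hle).symm⟩
    · rw [max_eq_left hle] at h ⊢
      obtain ⟨p, hp, e⟩ := ih h
      exact ⟨p, by simp [hp], e⟩

/-- The largest gain for the cluster of slot `sl`. -/
noncomputable def bestGain (D : Data) (G : Guess) (sl : ℕ) : ℕ :=
  best (fun p => D.leafVal G sl (p.getD · 0))
    (leaves (GoodPrefix D G sl) (D.n + D.m * D.sig) (1 + G.ds sl) [])

theorem leafVal_le (G : Guess) (sl : ℕ) (h : ℕ → ℕ) :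
    D.leafVal G sl h ≤ 2 * D.B * (2 * D.n + 1) := by
  unfold Data.leafVal
  split_ifs
  · calc _ ≤ ∑ i ∈ range (2 * D.B), (2 * D.n + 1) := sum_le_sum fun i _ => by
          split_ifs
          · exact (card_filter_le _ _).trans (by simp)
          · exact Nat.zero_le _
      _ = _ := by simp
  · exact Nat.zero_le _

theorem bestGain_le (G : Guess) (sl : ℕ) : bestGain D G sl ≤ 2 * D.B * (2 * D.n + 1) := by
  by_cases h : bestGain D G sl = 0
  · rw [h]; exact Nat.zero_le _
  · obtain ⟨p, -, e⟩ := exists_eq_best _ _ h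
    rw [bestGain, ← e]
    exact leafVal_le _ _ _

/-- The invariant of the search for a center; `ρ` contains the registers at the beginning. -/
structure CenterInv (D : Data) (N X R : ℕ) (μ₀ ρ₀ : ℕ → ℕ) (g : List ℕ) (sl : ℕ) (ρ : ℕ → ℕ)
    (L : List (List ℕ)) (s : State) : Prop where
  frame : Frame N X R μ₀ ρ₀ s
  guess : Holds s N g
  len : s.reg 16 = 1 + (D.guess (g.getD · 0)).ds sl
  slot : s.reg 23 = sl
  keep : ∀ q ∈ [17, 18, 21, 25, 26, 27], s.reg q = ρ q
  best : s.reg 24 = best (fun p => D.leafVal (D.guess (g.getD · 0)) sl (p.getD · 0)) L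

theorem cand_eq {p : List ℕ} {b k : ℕ} (hb : s.reg 12 = b) (hp : Holds s b p) (hk : p.length = k)
    (i : ℕ) : (if i < k then s.mem (s.reg 12 + i) else 0) = p.getD i 0 := by
  split_ifs with h
  · rw [hb, hp i (by omega)]
  · rw [List.getD_eq_default _ _ (by omega)]

theorem centerSpec (S : Setting D N μ₀ ρ₀) (hR : Room D N X) (hW : X ^ maxDeg < W) {g : List ℕ}
    (hg : g.length = 3 + 11 * D.B) (hG : D.Consistent (D.guess (g.getD · 0))) {sl : ℕ}
    (hsl : sl < 2 * D.B) (hlead : (D.guess (g.getD · 0)).kap sl = sl) (ρ : ℕ → ℕ) :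
    BacktrackSpec W X R 19 20 22 16 15 12 (tGood 19 1 23 19) (assign 24 tBest)
      (1 + (D.guess (g.getD · 0)).ds sl) (D.n + D.m * D.sig) (N + (3 + 11 * D.B))
      (tBest.time R + 2) (GoodPrefix D (D.guess (g.getD · 0)) sl)
      (CenterInv D N X R μ₀ ρ₀ g sl ρ) where
  large := (Nat.pow_le_pow_right (by have := hR.two_le; omega)
    (by unfold maxDeg; omega)).trans_lt hW
  two_le := hR.two_le
  wf := wf_good
  regs := by decide
  len_pos := by omega
  len_le := by
    have := hG.ds_le hsl (show (D.guess (g.getD · 0)).kap sl < _ by omega)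
    have := hR.len_le
    omega
  digit_le := hR.digits₂
  bounded L s hs := ⟨hs.frame.bounded, hs.len,
    by rw [hs.frame.reg 15 (by simp [fixedRegs]), S.digits₂],
    by rw [hs.frame.reg 12 (by simp [fixedRegs]), S.base₂]⟩
  stable L s s' hs hr hm hb := by
    refine ⟨hs.frame.of_eq (fun q hq => hr q (lt_of_mem_fixedRegs hq) ?_ ?_ ?_)
      (fun a ha => hm a (by omega)) hb, fun i hi => ?_, ?_, ?_, fun q hq => ?_, ?_⟩
    · rintro rfl; simp [fixedRegs] at hq
    · rintro rfl; simp [fixedRegs] at hq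
    · rintro rfl; simp [fixedRegs] at hq
    · rw [hm _ (by omega)]; exact hs.guess i hi
    · rw [hr 16 (by omega) (by omega) (by omega) (by omega), hs.len]
    · rw [hr 23 (by omega) (by omega) (by omega) (by omega), hs.slot]
    · rw [hr q, hs.keep q hq]
      all_goals simp only [List.mem_cons, List.not_mem_nil, or_false] at hq; omega
    · rw [hr 24 (by omega) (by omega) (by omega) (by omega), hs.best]
  -- A prefix of `reg 19 + 1` digits consists of the leading column and `reg 19` changes, so the
  -- depth register serves both as length and as number of changes.
  test L s p hs hp hlen hle := by
    have E := hs.frame.env S hg hs.guess (h := (p.getD · 0)) (q := 19) (c := 1) (by omega)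
      (cand_eq (by rw [hs.frame.reg 12 (by simp [fixedRegs]), S.base₂]) hp hlen)
    refine (E.sat_good (s := 23) (t := 19) (by omega) (by omega)).trans ?_
    rw [hs.slot, GoodPrefix, hlen, Nat.add_sub_cancel]
  leaf L s p hs hp hlen hval := by
    have E := hs.frame.env S hg hs.guess (h := (p.getD · 0)) (q := 16) (c := 0) (by omega)
      (cand_eq (by rw [hs.frame.reg 12 (by simp [fixedRegs]), S.base₂]) hp
        (by rw [hs.len]; exact hlen))
    -- With truncated subtraction, `b + (v - b)` is the maximum of `b` and `v`.
    have hval : tBest.eval s.mem s.reg =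
        max (s.reg 24) (D.leafVal (D.guess (g.getD · 0)) sl (p.getD · 0)) := by
      simp only [tBest, Term.eval]
      rw [E.eval_leafVal (s := 23) (by omega), hs.slot]
      omega
    have hle : tBest.eval s.mem s.reg ≤ X := by
      rw [hval]
      refine max_le (hs.frame.bounded.reg 24 (by omega)) ((leafVal_le _ _ _).trans ?_)
      refine le_trans ?_ hR.total
      exact Nat.le_mul_of_pos_left _ (by omega)
    refine (hs.frame.ends_assign (fits_of_le hR.two_le hW wf_best (by unfold maxDeg; omega))
      ⟨by omega, by omega, by simp [fixedRegs]⟩ hle le_rfl).mono le_rfl ?_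
    rintro s' ⟨hf, hu⟩
    have ho := hu.other
    refine ⟨⟨hf, Holds.of_mem hs.guess hu.mem, ?_, ?_, fun q hq => ?_, ?_⟩,
      Holds.of_mem hp hu.mem, ho 19 (by omega) (by omega), ho 20 (by omega) (by omega),
      ho 22 (by omega) (by omega)⟩
    · rw [ho 16 (by omega) (by omega), hs.len]
    · rw [ho 23 (by omega) (by omega), hs.slot]
    · rw [ho q, hs.keep q hq]
      all_goals simp only [List.mem_cons, List.not_mem_nil, or_false] at hq; omega
    · rw [hu.eq, hval, best_append, hs.best]

/-- The invariant of the loop over the slots; `ρ` contains the registers at the beginning. -/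
structure SlotInv (D : Data) (N X R : ℕ) (μ₀ ρ₀ : ℕ → ℕ) (g : List ℕ) (ρ : ℕ → ℕ) (i : ℕ)
    (s : State) : Prop where
  frame : Frame N X R μ₀ ρ₀ s
  guess : Holds s N g
  slot : s.reg 23 = i
  left : s.reg 28 = 2 * D.B - i
  keep : ∀ q ∈ [17, 18, 21, 27], s.reg q = ρ q
  total : s.reg 25 = ∑ sl ∈ range i, if (D.guess (g.getD · 0)).kap sl = sl then
    bestGain D (D.guess (g.getD · 0)) sl else 0
  ok : s.reg 26 = if ∀ sl < i, (D.guess (g.getD · 0)).kap sl = sl →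
    bestGain D (D.guess (g.getD · 0)) sl ≠ 0 then 1 else 0

/-- A bound for the time to process a slot. -/
def slotTime (D : Data) (R : ℕ) : ℕ :=
  ((D.n + D.m) * ((D.B + 1) * (D.n * (D.n * (2 * D.B) ^ D.B) ^ 2 * D.sig ^ D.B)) + 1) *
    (2 * (tGood 19 1 23 19).time R + 122 + (tBest.time R + 2)) + 500

theorem ends_slotBody (S : Setting D N μ₀ ρ₀) (hR : Room D N X) (hW : X ^ maxDeg < W)
    (hn : 1 ≤ D.n) (hsig : 1 ≤ D.sig) {g : List ℕ}
    (hg : g.length = 3 + 11 * D.B) (hG : D.Consistent (D.guess (g.getD · 0))) (ρ : ℕ → ℕ) (i : ℕ)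
    (hi : i < 2 * D.B) (hs : SlotInv D N X R μ₀ ρ₀ g ρ i s) :
    Ends W slotBody s (slotTime D R) (SlotInv D N X R μ₀ ρ₀ g ρ (i + 1)) := by
  set G := D.guess (g.getD · 0) with hGdef
  have h2 := hR.two_le
  have hlen := hR.len_le
  have hBX : 2 * D.B ≤ X := by
    have := hR.base; omega
  have fit : ∀ {t : Term}, t.WF → t.deg ≤ 200 → t.Fits W X := fun ht hd =>
    fits_of_le h2 hW ht (hd.trans (by unfold maxDeg; omega))
  have env : ∀ {s : State}, Frame N X R μ₀ ρ₀ s → Holds s N g →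
      Env D (g.getD · 0) (fun i => if i < s.reg 0 + 0 then s.mem (s.reg 12 + i) else 0) 0 0
        s.mem s.reg := fun hf hh => hf.env S hg hh (by omega) fun _ => rfl
  -- The step to the next slot, common to leading and other slots.
  have tail : ∀ s : State, Frame N X R μ₀ ρ₀ s → Holds s N g → s.reg 23 = i →
      (∀ q ∈ [17, 18, 21, 27], s.reg q = ρ q) →
      (s.reg 25 = ∑ sl ∈ range (i + 1), if G.kap sl = sl then bestGain D G sl else 0) →
      (s.reg 26 = if ∀ sl < i + 1, G.kap sl = sl → bestGain D G sl ≠ 0 then 1 else 0) →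
      Ends W (.seq (assign 23 (.add (.reg 23) (.const 1))) (assign 28 (.sub (.reg 4) (.reg 23))))
        s 20 (SlotInv D N X R μ₀ ρ₀ g ρ (i + 1)) := by
    intro s hf hh h23 hk h25 h26
    have e1 : Term.eval s.mem (.add (.reg 23) (.const 1)) s.reg = i + 1 := by simp [Term.eval, h23]
    refine ((hf.ends_assign (t := .add (.reg 23) (.const 1)) (T := 10) (fit (by decide) (by decide))
      ⟨by omega, by omega, by decide⟩ (by rw [e1]; omega) (by simp [Term.time])).seq (T₂ := 10) ?_)
    rintro s1 ⟨hf1, hu1⟩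
    rw [e1] at hu1
    have e2 : Term.eval s1.mem (.sub (.reg 4) (.reg 23)) s1.reg = 2 * D.B - (i + 1) := by
      simp only [Term.eval]
      rw [hf1.reg 4 (by simp [fixedRegs]), S.slots, hu1.eq]
    refine (hf1.ends_assign (t := .sub (.reg 4) (.reg 23)) (fit (by decide) (by decide))
      ⟨by omega, by omega, by decide⟩ (by rw [e2]; omega) (by simp [Term.time])).mono le_rfl ?_
    rintro s2 ⟨hf2, hu2⟩
    rw [e2] at hu2
    have key : ∀ q < 64, q ≠ 23 → q ≠ 28 → s2.reg q = s.reg q := fun q hq h1 h2 => by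
      rw [hu2.other q hq h2, hu1.other q hq h1]
    refine ⟨hf2, Holds.of_mem hh (hu2.mem.trans hu1.mem), ?_, hu2.eq, fun q hq => ?_, ?_, ?_⟩
    · rw [hu2.other 23 (by omega) (by omega), hu1.eq]
    · rw [key q, hk q hq]
      all_goals simp only [List.mem_cons, List.not_mem_nil, or_false] at hq; omega
    · rw [key 25 (by omega) (by omega) (by omega), h25]
    · rw [key 26 (by omega) (by omega) (by omega), h26]
  have hcond : Sat s.mem s.reg (equal (tKap (.reg 23)) (.reg 23)) ↔ G.kap i = i := by
    rw [sat_equal, (env hs.frame hs.guess).eval_kap]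
    simp only [Term.eval]
    rw [hs.slot]
  set T := slotTime D R - 500 with hT
  have hT' : slotTime D R = T + 500 := by rw [hT, slotTime]; omega
  rw [hT']
  refine (Ends.seq (T₁ := T + 480) (T₂ := 20) (Q₁ := fun s => Frame N X R μ₀ ρ₀ s ∧ Holds s N g ∧
    s.reg 23 = i ∧ (∀ q ∈ [17, 18, 21, 27], s.reg q = ρ q) ∧
    (s.reg 25 = ∑ sl ∈ range (i + 1), if G.kap sl = sl then bestGain D G sl else 0) ∧
    s.reg 26 = if ∀ sl < i + 1, G.kap sl = sl → bestGain D G sl ≠ 0 then 1 else 0) ?_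
    fun s' hs' => tail s' hs'.1 hs'.2.1 hs'.2.2.1 hs'.2.2.2.1 hs'.2.2.2.2.1 hs'.2.2.2.2.2)
  refine (ends_cond (T := T + 100) (fit (by decide) (by decide)) hs.frame.bounded
    (fun h1 s1 ha1 => ?_) (fun h1 s1 ha1 => ?_)).mono
    (by simp [Term.time, equal, neg, tKap, select, tDigit, less]; omega) fun _ h => h
  · have hlead := hcond.1 h1
    have hf1 := hs.frame.agrees ha1
    refine ((hf1.ends_assign (t := .const 0) (T := 3) (fit (by decide) (by decide))
      ⟨by omega, by omega, by decide⟩ (by simp [Term.eval]) (by simp [Term.time])).seq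
      (T₂ := T + 97) ?_).mono (by omega) fun _ h => h
    rintro s2 ⟨hf2, hu2⟩
    have hg2 : Holds s2 N g := Holds.of_mem hs.guess (hu2.mem.trans ha1.2)
    have h23 : s2.reg 23 = i := by
      rw [hu2.other 23 (by omega) (by omega), ha1.1 23 (by omega), hs.slot]
    have e2 : Term.eval s2.mem (.add (.const 1) (tDs (.reg 23))) s2.reg = 1 + G.ds i := by
      rw [Term.eval, (env hf2 hg2).eval_ds]
      simp only [Term.eval]
      rw [h23]
    have hds := hG.ds_le hi (show G.kap i < _ by omega)
    refine ((hf2.ends_assign (t := .add (.const 1) (tDs (.reg 23))) (T := 77)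
      (fit (by decide) (by decide)) ⟨by omega, by omega, by decide⟩ (by rw [e2]; omega)
      (by simp [Term.time, neg, tDs, tSlot, select, tDigit, less])).seq
      (T₂ := T + 20) ?_).mono (by omega) fun _ h => h
    rintro s3 ⟨hf3, hu3⟩
    have key3 : ∀ q < 64, q ≠ 24 → q ≠ 16 → s3.reg q = s.reg q := fun q hq h1 h2 => by
      rw [hu3.other q hq h2, hu2.other q hq h1, ha1.1 q hq]
    have hi3 : CenterInv D N X R μ₀ ρ₀ g i s.reg [] s3 := by
      refine ⟨hf3, Holds.of_mem hg2 hu3.mem, by rw [hu3.eq, e2], ?_, fun q hq => key3 q ?_ ?_ ?_, ?_⟩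
      · rw [hu3.other 23 (by omega) (by omega), h23]
      all_goals try (simp only [List.mem_cons, List.not_mem_nil, or_false] at hq; omega)
      rw [hu3.other 24 (by omega) (by omega), hu2.eq]
      rfl
    refine (((centerSpec S hR hW hg hG hi hlead s.reg).ends_backtrack hi3).seq (T₂ := 20) ?_).mono
      ?_ fun _ h => h
    · rw [List.nil_append]
      intro s4 hs4
      have h24 : s4.reg 24 = bestGain D G i := hs4.best
      have h25 : s4.reg 25 = s.reg 25 := hs4.keep 25 (by simp)
      have e5 : Term.eval s4.mem (.add (.reg 25) (.reg 24)) s4.reg =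
          ∑ sl ∈ range (i + 1), if G.kap sl = sl then bestGain D G sl else 0 := by
        simp only [Term.eval]
        rw [h24, h25, hs.total, sum_range_succ, if_pos hlead]
      have e5X : Term.eval s4.mem (.add (.reg 25) (.reg 24)) s4.reg ≤ X := by
        rw [e5]
        refine le_trans ?_ hR.total
        calc _ ≤ ∑ sl ∈ range (i + 1), 2 * D.B * (2 * D.n + 1) := sum_le_sum fun sl _ => by
              split_ifs
              · exact bestGain_le _ _
              · exact Nat.zero_le _
          _ ≤ _ := by
              rw [sum_const, card_range, smul_eq_mul]
              exact Nat.mul_le_mul_right _ (by omega)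
      refine ((hs4.frame.ends_assign (t := .add (.reg 25) (.reg 24)) (T := 7)
        (fit (by decide) (by decide)) ⟨by omega, by omega, by decide⟩ e5X
        (by simp [Term.time])).seq (T₂ := 13) ?_)
      rintro s5 ⟨hf5, hu5⟩
      have e6 : Term.eval s5.mem (.mul (.reg 26) (neg (neg (.reg 24)))) s5.reg =
          if ∀ sl < i + 1, G.kap sl = sl → bestGain D G sl ≠ 0 then 1 else 0 := by
        simp only [Term.eval, neg]
        rw [hu5.other 26 (by omega) (by omega), hu5.other 24 (by omega) (by omega), h24,
          hs4.keep 26 (by simp), hs.ok]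
        have : (∀ sl < i + 1, G.kap sl = sl → bestGain D G sl ≠ 0) ↔
            (∀ sl < i, G.kap sl = sl → bestGain D G sl ≠ 0) ∧ bestGain D G i ≠ 0 := by
          constructor
          · exact fun h => ⟨fun sl hsl => h sl (by omega), h i (by omega) hlead⟩
          · rintro ⟨h1, h2⟩ sl hsl hk
            rcases Nat.lt_succ_iff_lt_or_eq.1 hsl with h | rfl
            · exact h1 sl h hk
            · exact h2
        rw [if_congr this rfl rfl]
        by_cases hb : bestGain D G i = 0
        · simp [hb]
        · rw [show 1 - (1 - bestGain D G i) = 1 by omega, mul_one]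
          exact if_congr ⟨fun h => ⟨h, hb⟩, fun h => h.1⟩ rfl rfl
      refine (hf5.ends_assign (t := .mul (.reg 26) (neg (neg (.reg 24))))
        (fit (by decide) (by decide)) ⟨by omega, by omega, by decide⟩
        (by rw [e6]; split_ifs <;> omega) (by simp [Term.time, neg])).mono le_rfl ?_
      rintro s6 ⟨hf6, hu6⟩
      have key6 : ∀ q < 64, q ≠ 25 → q ≠ 26 → s6.reg q = s4.reg q := fun q hq h1 h2 => by
        rw [hu6.other q hq h2, hu5.other q hq h1]
      refine ⟨hf6, Holds.of_mem hs4.guess (hu6.mem.trans hu5.mem), ?_, fun q hq => ?_, ?_, ?_⟩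
      · rw [key6 23 (by omega) (by omega) (by omega), hs4.slot]
      · simp only [List.mem_cons, List.not_mem_nil, or_false] at hq
        rw [key6 q (by omega) (by omega) (by omega), hs4.keep q (by simp; omega),
          hs.keep q (by simp; omega)]
      · rw [hu6.other 25 (by omega) (by omega), hu5.eq, e5]
      · rw [hu6.eq, e6]
    · have h1 := Data.nodes_good_le hG hn hsig hi hlead
      have h2 := Nat.mul_le_mul_right (2 * (tGood 19 1 23 19).time R + 122 + (tBest.time R + 2))
        (Nat.add_le_add_right h1 1)
      have h3 : T = ((D.n + D.m) * ((D.B + 1) * (D.n * (D.n * (2 * D.B) ^ D.B) ^ 2 *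
          D.sig ^ D.B)) + 1) *
            (2 * (tGood 19 1 23 19).time R + 122 + (tBest.time R + 2)) := by
        rw [hT, slotTime, Nat.add_sub_cancel]
      rw [h3]
      exact Nat.add_le_add_right h2 20
  · have hlead : ¬ G.kap i = i := fun h => hcond.2 h h1
    refine (ends_skip ⟨hs.frame.agrees ha1, Holds.of_mem hs.guess ha1.2, ?_, fun q hq => ?_, ?_,
      ?_⟩).mono (Nat.zero_le _) fun _ h => h
    · rw [ha1.1 23 (by omega), hs.slot]
    · rw [ha1.1 q, hs.keep q hq]
      simp only [List.mem_cons, List.not_mem_nil, or_false] at hq; omega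
    · rw [ha1.1 25 (by omega), hs.total, sum_range_succ, if_neg hlead, add_zero]
    · rw [ha1.1 26 (by omega), hs.ok]
      refine if_congr ⟨fun h sl hsl hk => ?_, fun h sl hsl => h sl (by omega)⟩ rfl rfl
      rcases Nat.lt_succ_iff_lt_or_eq.1 hsl with h' | rfl
      · exact h sl h' hk
      · exact absurd hk hlead

end ColumnOutliers


/-! ### Correctness of the algorithm -/

namespace ColumnOutliers

open Finset WordRAM WordRAM.Term
open scoped Classical

variable {D : Data} {N W X R : ℕ} {μ₀ ρ₀ : ℕ → ℕ} {s s' : State}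

/-! ### Candidates depend on finitely many digits. -/

namespace Data

variable {G : Guess} {sl t : ℕ} {h h' : ℕ → ℕ}

/-- Together with `leafVal_congr` this allows passing from a candidate given as a function to the
list of digits that the search produces. -/
theorem Good.congr (hg : D.Good G sl t h) (he : ∀ b ≤ t, h b = h' b) : D.Good G sl t h' := by
  obtain ⟨h1, h2, h3⟩ := hg
  have h0 := he 0 (by omega)
  refine ⟨h0 ▸ h1, fun a ha hat => he (a + 1) hat ▸ h2 a ha hat, fun i hi his => ?_⟩
  obtain ⟨j, hj, hx, hd, hm⟩ := h3 i hi his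
  refine ⟨j, hj, hx, h0 ▸ hd, fun a ha hat hma => ?_⟩
  rw [← h0, ← he (a + 1) hat]
  exact hm a ha hat hma

theorem leafVal_congr (he : ∀ b ≤ G.ds sl, h b = h' b) :
    D.leafVal G sl h = D.leafVal G sl h' := by
  have key : D.Differs G sl h = D.Differs G sl h' := by
    funext r j
    have h0 := he 0 (by omega)
    unfold Differs
    rw [h0]
    refine propext (or_congr (exists_congr fun a => and_congr_right fun _ =>
      and_congr_right fun ha => by rw [he (a + 1) ha]) (and_congr_left fun _ =>
        forall_congr' fun a => forall_congr' fun _ => forall_congr' fun ha => by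
          rw [he (a + 1) ha]))
  have key2 : D.Fit G sl h = D.Fit G sl h' := by
    funext i j
    simp only [Fit, key]
  have key3 : D.top G sl h = D.top G sl h' := by
    funext i
    simp only [top, key2]
  simp only [leafVal, key3]

end Data

/-- The guess with the digits `g` is accepted. -/
def Accepted (D : Data) (g : List ℕ) : Prop :=
  D.Consistent (D.guess (g.getD · 0)) ∧
  (∀ sl < 2 * D.B, (D.guess (g.getD · 0)).kap sl = sl →
    bestGain D (D.guess (g.getD · 0)) sl ≠ 0) ∧
  D.Accepts (D.guess (g.getD · 0)) (∑ sl ∈ range (2 * D.B),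
    if (D.guess (g.getD · 0)).kap sl = sl then bestGain D (D.guess (g.getD · 0)) sl else 0)

/-- The last digit of `p` is admissible. -/
def DigitOK (D : Data) (p : List ℕ) : Prop :=
  p.getD (p.length - 1) 0 < if p.length - 1 < 3 then D.wide else D.narrow

/-- A nonzero best gain is attained at some leaf, and this leaf is a full candidate that passes
`Good`; these candidates describe the centers. -/
theorem core_of_accepted (hal : ∀ j < D.n, ∀ r < D.m, ∃ v < D.sig, D.A r j = D.al v)
    {g : List ℕ} (hg : Accepted D g) : D.Core := by
  obtain ⟨hG, hb, hacc⟩ := hg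
  set G := D.guess (g.getD · 0)
  have hlead : ∀ sl ∈ D.leaders G, sl < 2 * D.B ∧ G.kap sl = sl := fun sl hsl => by
    obtain ⟨h1, h2⟩ := mem_filter.1 hsl
    exact ⟨mem_range.1 h1, h2⟩
  have hex : ∀ sl ∈ D.leaders G, ∃ p : List ℕ, D.Good G sl (G.ds sl) (p.getD · 0) ∧
      D.leafVal G sl (p.getD · 0) = bestGain D G sl := by
    intro sl hsl
    obtain ⟨p, hp, e⟩ := exists_eq_best _ _ (hb sl (hlead sl hsl).1 (hlead sl hsl).2)
    obtain ⟨-, h1, h2, -⟩ := mem_leaves.1 hp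
    simp only [List.length_nil, zero_add] at h1 h2
    have h3 := h2 _ (by omega) le_rfl
    rw [List.take_length, GoodPrefix, h1, Nat.add_sub_cancel_left] at h3
    exact ⟨p, h3, e⟩
  choose! p hp1 hp2 using hex
  refine Data.core_of_accepts hal hG (fun sl b => (p sl).getD b 0) hp1 (fun sl hsl => ?_) ?_
  · rw [hp2 sl hsl]
    exact hb sl (hlead sl hsl).1 (hlead sl hsl).2
  · rw [sum_congr rfl hp2, Data.leaders, sum_filter]
    exact hacc

/-- All prefixes of the intended candidate pass the test, so it is among the leaves and the best
gain is at least its gain. Acceptance is monotone in the total gain, so better candidates do no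
harm. -/
theorem exists_accepted (hn : 0 < D.n)
    (hal : ∀ j < D.n, ∀ r < D.m, ∃ v < D.sig, D.A r j = D.al v) (h : D.Core) :
    ∃ g ∈ leaves (DigitOK D) (D.wide + D.narrow) (3 + 11 * D.B) [], Accepted D g := by
  obtain ⟨π⟩ := Data.exists_plan hal h
  obtain ⟨G, hsmall, hG, h, hh, hacc⟩ := Data.exists_guess hn π
  obtain ⟨g, hlen, hdig, hgG⟩ := Data.exists_guess_eq hsmall
  refine ⟨g, mem_leaves.2 ⟨List.nil_prefix, by simpa using hlen, fun i h1 h2 => ?_, ?_⟩, ?_⟩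
  · simp only [List.length_nil] at h1
    have h3 := hdig (i - 1) (by omega)
    unfold DigitOK Data.wide Data.narrow
    rw [List.length_take, min_eq_left h2, List.getD_eq_getElem _ _ (by simp; omega),
      List.getElem_take, ← List.getD_eq_getElem _ 0]
    exact h3
  · intro y hy
    simp only [List.length_nil, List.drop_zero] at hy
    obtain ⟨i, hi, rfl⟩ := List.mem_iff_getElem.1 hy
    have h3 := hdig i hi
    rw [List.getD_eq_getElem _ _ hi] at h3
    unfold Data.wide Data.narrow
    split_ifs at h3 <;> omega
  · have hbest : ∀ sl ∈ D.leaders G, D.leafVal G sl (h sl) ≤ bestGain D G sl := by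
      intro sl hsl
      obtain ⟨h1, h2⟩ := mem_filter.1 hsl
      have h1 := mem_range.1 h1
      obtain ⟨hgood, -⟩ := hh sl hsl
      have hds := hG.ds_le h1 (show G.kap sl < _ by omega)
      set q := (List.range (1 + G.ds sl)).map (h sl) with hq
      have hql : q.length = 1 + G.ds sl := by simp [hq]
      have hqg : ∀ b ≤ G.ds sl, h sl b = q.getD b 0 := fun b hb => by
        rw [List.getD_eq_getElem _ _ (by omega)]
        simp [hq]
      rw [Data.leafVal_congr hqg]
      refine le_best (fun p => D.leafVal G sl (p.getD · 0)) _ (mem_leaves.2 ⟨List.nil_prefix,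
        by simpa using hql, fun i h3 h4 => ?_, fun y hy => ?_⟩)
      · simp only [List.length_nil] at h3
        rw [GoodPrefix, List.length_take, min_eq_left h4]
        refine (hgood (i - 1) (by omega)).congr fun b hb => ?_
        rw [hqg b (by omega), List.getD_eq_getElem _ _ (by omega),
          List.getD_eq_getElem _ _ (by simp; omega), List.getElem_take]
      · simp only [List.length_nil, List.drop_zero, hq, List.mem_map, List.mem_range] at hy
        obtain ⟨b, hb, rfl⟩ := hy
        obtain ⟨h5, h6, -⟩ := hgood _ le_rfl
        rcases b with - | b
        · omega
        · have := h6 b (by omega) (by omega)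
          omega
    unfold Accepted
    rw [hgG]
    refine ⟨hG, fun sl hsl hk => ?_, ?_⟩
    · have hm : sl ∈ D.leaders G := mem_filter.2 ⟨mem_range.2 hsl, hk⟩
      have h1 := hbest sl hm
      have h2 := (hh sl hm).2
      omega
    · rw [← sum_filter]
      exact hacc.mono (sum_le_sum hbest)

/-- A bound for the time to process a guess. -/
def guessTime (D : Data) (R : ℕ) : ℕ :=
  tConsistent.time R + 1 + (20 + (2 * D.B * (slotTime D R + 1) + 1) + ((tAccepts 25).time R + 10))

theorem ends_guessLeaf (S : Setting D N μ₀ ρ₀) (hR : Room D N X) (hW : X ^ maxDeg < W)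
    (hn : 1 ≤ D.n) (hsig : 1 ≤ D.sig) {g : List ℕ} (hg : g.length = 3 + 11 * D.B)
    (hf : Frame N X R μ₀ ρ₀ s) (hh : Holds s N g) :
    Ends W guessLeaf s (guessTime D R) fun s' => Frame N X R μ₀ ρ₀ s' ∧ Holds s' N g ∧
      (∀ q ∈ [17, 18, 21], s'.reg q = s.reg q) ∧
      s'.reg 27 = if Accepted D g then 1 else s.reg 27 := by
  set G := D.guess (g.getD · 0) with hGdef
  have h2 := hR.two_le
  have hBX : 2 * D.B ≤ X := by
    have := hR.base; omega
  have fit : ∀ {t : Term}, t.WF → t.deg ≤ 200 → t.Fits W X := fun ht hd =>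
    fits_of_le h2 hW ht (hd.trans (by unfold maxDeg; omega))
  have env : ∀ {s : State}, Frame N X R μ₀ ρ₀ s → Holds s N g →
      Env D (g.getD · 0) (fun i => if i < s.reg 0 + 0 then s.mem (s.reg 12 + i) else 0) 0 0
        s.mem s.reg := fun hf hh => hf.env S hg hh (by omega) fun _ => rfl
  have hcons : Sat s.mem s.reg tConsistent ↔ D.Consistent G := (env hf hh).sat_consistent
  refine ends_cond (fits_of_le h2 hW wf_consistent (by unfold maxDeg; omega)) hf.bounded
    (fun h1 s1 ha1 => ?_) (fun h1 s1 ha1 => ?_)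
  · have hG := hcons.1 h1
    have hf1 := hf.agrees ha1
    refine Ends.mono (T := 3 + (3 + (3 + (4 + ((2 * D.B * (slotTime D R + 1) + 1) +
      ((tAccepts 25).time R + 10)))))) (Q := fun s' => Frame N X R μ₀ ρ₀ s' ∧ Holds s' N g ∧
      (∀ q ∈ [17, 18, 21], s'.reg q = s.reg q) ∧
      s'.reg 27 = if Accepted D g then 1 else s.reg 27) ?_ (by omega) fun _ h => h
    refine (hf1.ends_assign (t := .const 0) (fit (by decide) (by decide))
      ⟨by omega, by omega, by decide⟩ (by simp [Term.eval]) (by simp [Term.time])).seq ?_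
    rintro s2 ⟨hf2, hu2⟩
    refine (hf2.ends_assign (t := .const 0) (fit (by decide) (by decide))
      ⟨by omega, by omega, by decide⟩ (by simp [Term.eval]) (by simp [Term.time])).seq ?_
    rintro s3 ⟨hf3, hu3⟩
    refine (hf3.ends_assign (t := .const 1) (fit (by decide) (by decide))
      ⟨by omega, by omega, by decide⟩ (by simp [Term.eval]; omega) (by simp [Term.time])).seq ?_
    rintro s4 ⟨hf4, hu4⟩
    have e4 : Term.eval s4.mem (.reg 4) s4.reg = 2 * D.B := by
      simp only [Term.eval]
      rw [hf4.reg 4 (by simp [fixedRegs]), S.slots]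
    refine (hf4.ends_assign (t := .reg 4) (fit (by decide) (by decide))
      ⟨by omega, by omega, by decide⟩ (by rw [e4]; exact hBX) (by simp [Term.time])).seq ?_
    rintro s5 ⟨hf5, hu5⟩
    have key5 : ∀ q < 64, q ≠ 23 → q ≠ 25 → q ≠ 26 → q ≠ 28 → s5.reg q = s.reg q := by
      intro q hq h1 h2 h3 h4
      rw [hu5.other q hq h4, hu4.other q hq h3, hu3.other q hq h2, hu2.other q hq h1, ha1.1 q hq]
    have hi5 : SlotInv D N X R μ₀ ρ₀ g s.reg 0 s5 := by
      refine ⟨hf5, Holds.of_mem hh ?_, ?_, ?_, fun q hq => ?_, ?_, ?_⟩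
      · rw [hu5.mem, hu4.mem, hu3.mem, hu2.mem, ha1.2]
      · rw [hu5.other 23 (by omega) (by omega), hu4.other 23 (by omega) (by omega),
          hu3.other 23 (by omega) (by omega), hu2.eq]
        rfl
      · rw [hu5.eq, e4]; rfl
      · simp only [List.mem_cons, List.not_mem_nil, or_false] at hq
        exact key5 q (by omega) (by omega) (by omega) (by omega) (by omega)
      · rw [hu5.other 25 (by omega) (by omega), hu4.other 25 (by omega) (by omega), hu3.eq]
        simp [Term.eval]
      · rw [hu5.other 26 (by omega) (by omega), hu4.eq]
        simp [Term.eval]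
    refine (ends_while_count (SlotInv D N X R μ₀ ρ₀ g s.reg) (fun i s hs => hs.left)
      (fun i hi s' hs' => ends_slotBody S hR hW hn hsig hg hG s.reg i hi hs') hi5).seq ?_
    intro s6 hs6
    have hacc : Sat s6.mem s6.reg (conj (.reg 26) (tAccepts 25)) ↔ Accepted D g := by
      rw [sat_conj, (env hs6.frame hs6.guess).sat_accepts, hs6.total]
      simp only [Sat, Term.eval]
      rw [hs6.ok]
      unfold Accepted
      constructor
      · rintro ⟨h1, h2⟩
        refine ⟨hG, ?_, h2⟩
        by_contra hne
        rw [if_neg hne] at h1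
        exact h1 rfl
      · rintro ⟨-, h1, h2⟩
        rw [if_pos h1]
        exact ⟨one_ne_zero, h2⟩
    refine (ends_cond (T := 5) (fits_of_le h2 hW (t := conj (.reg 26) (tAccepts 25))
      (by simp [conj, Term.WF, wf_accepts]) (by simp only [conj, Term.deg]; unfold maxDeg; omega))
      hs6.frame.bounded (fun h7 s7 ha7 => ?_) (fun h7 s7 ha7 => ?_)).mono
      (by simp [conj, Term.time]; omega) fun _ h => h
    · have hf7 := hs6.frame.agrees ha7
      refine (hf7.ends_assign (t := .const 1) (fit (by decide) (by decide))
        ⟨by omega, by omega, by decide⟩ (by simp [Term.eval]; omega) (by simp [Term.time])).mono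
        le_rfl ?_
      rintro s8 ⟨hf8, hu8⟩
      refine ⟨hf8, Holds.of_mem hs6.guess (hu8.mem.trans ha7.2), fun q hq => ?_, ?_⟩
      · simp only [List.mem_cons, List.not_mem_nil, or_false] at hq
        rw [hu8.other q (by omega) (by omega), ha7.1 q (by omega), hs6.keep q (by simp; omega)]
      · rw [hu8.eq, if_pos (hacc.1 h7)]; rfl
    · refine (ends_skip ⟨hs6.frame.agrees ha7, Holds.of_mem hs6.guess ha7.2, fun q hq => ?_,
        ?_⟩).mono (Nat.zero_le _) fun _ h => h
      · simp only [List.mem_cons, List.not_mem_nil, or_false] at hq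
        rw [ha7.1 q (by omega), hs6.keep q (by simp; omega)]
      · rw [ha7.1 27 (by omega), if_neg fun h => hacc.2 h h7, hs6.keep 27 (by simp)]
  · refine (ends_skip ⟨hf.agrees ha1, Holds.of_mem hh ha1.2, fun q hq => ?_, ?_⟩).mono
      (Nat.zero_le _) fun _ h => h
    · simp only [List.mem_cons, List.not_mem_nil, or_false] at hq
      rw [ha1.1 q (by omega)]
    · rw [ha1.1 27 (by omega), if_neg fun h => hcons.2 h.1 h1]

/-- The invariant of the search for a guess. -/
structure GuessInv (D : Data) (N X R : ℕ) (μ₀ ρ₀ : ℕ → ℕ) (L : List (List ℕ)) (s : State) :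
    Prop where
  frame : Frame N X R μ₀ ρ₀ s
  answer : s.reg 27 = if ∃ g ∈ L, Accepted D g then 1 else 0

theorem guessSpec (S : Setting D N μ₀ ρ₀) (hR : Room D N X) (hW : X ^ maxDeg < W)
    (hn : 1 ≤ D.n) (hsig : 1 ≤ D.sig) :
    BacktrackSpec W X R 17 18 21 14 13 11 tDigitTest guessLeaf
      (3 + 11 * D.B) (D.wide + D.narrow) N (guessTime D R) (DigitOK D)
      (GuessInv D N X R μ₀ ρ₀) where
  large := (Nat.pow_le_pow_right (by have := hR.two_le; omega)
    (by unfold maxDeg; omega)).trans_lt hW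
  two_le := hR.two_le
  wf := wf_digitTest
  regs := by decide
  len_pos := by omega
  len_le := by have := hR.base; omega
  digit_le := hR.digits₁
  bounded L s hs := ⟨hs.frame.bounded,
    by rw [hs.frame.reg 14 (by simp [fixedRegs]), S.len₁],
    by rw [hs.frame.reg 13 (by simp [fixedRegs]), S.digits₁],
    by rw [hs.frame.reg 11 (by simp [fixedRegs]), S.base₁]⟩
  stable L s s' hs hr hm hb := by
    refine ⟨hs.frame.of_eq (fun q hq => hr q (lt_of_mem_fixedRegs hq) ?_ ?_ ?_)
      (fun a ha => hm a (by omega)) hb, ?_⟩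
    · rintro rfl; simp [fixedRegs] at hq
    · rintro rfl; simp [fixedRegs] at hq
    · rintro rfl; simp [fixedRegs] at hq
    · rw [hr 27 (by omega) (by omega) (by omega) (by omega), hs.answer]
  test L s p hs hp hlen hle := by
    change Sat s.mem s.reg tDigitTest ↔ _
    simp only [tDigitTest, sat_less, eval_select, Term.eval]
    rw [hs.frame.reg 11 (by simp [fixedRegs]), S.base₁, hs.frame.reg 29 (by simp [fixedRegs]),
      S.wide, hs.frame.reg 30 (by simp [fixedRegs]), S.narrow, hp _ (by omega), DigitOK, hlen,
      Nat.add_sub_cancel]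
  leaf L s g hs hg hlen _ := by
    refine (ends_guessLeaf S hR hW hn hsig hlen hs.frame hg).mono le_rfl ?_
    rintro s' ⟨hf, hh, hk, ha⟩
    refine ⟨⟨hf, ?_⟩, hh, hk 17 (by simp), hk 18 (by simp), hk 21 (by simp)⟩
    rw [ha, hs.answer]
    by_cases h1 : Accepted D g
    · rw [if_pos h1, if_pos ⟨g, by simp, h1⟩]
    · rw [if_neg h1]
      refine if_congr ⟨fun ⟨p, hp, hA⟩ => ⟨p, by simp [hp], hA⟩, fun ⟨p, hp, hA⟩ => ?_⟩ rfl rfl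
      simp only [List.mem_append, List.mem_singleton] at hp
      rcases hp with hp | rfl
      · exact ⟨p, hp, hA⟩
      · exact absurd hA h1

/-- The content of memory cell `i`. -/
def tMem (i : ℕ) : Term := .load (.const i)

def tWide : Term := .mul (.add (.mul (.const 2) (tMem 1)) (.const 2))
  (.add (.mul (.const 2) (tMem 1)) (.const 2))

def tNarrow : Term := .add (.add (.mul (.mul (.const 4) (tMem 3)) (tMem 3))
  (.mul (.const 2) (tMem 3))) (.const 2)

def tLen : Term := .add (.const 3) (.mul (.const 11) (tMem 3))

/-- The initial assignments. -/
def setup : List (ℕ × Term) :=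
  [(1, tMem 1), (2, tMem 0), (3, tMem 3), (4, .mul (.const 2) (tMem 3)),
    (5, .add (.mul (.const 2) (tMem 1)) (.const 1)), (8, tMem 2), (9, tMem 4), (10, tMem 5),
    (11, .reg 0), (12, .add (.reg 0) tLen), (13, .add tWide tNarrow), (14, tLen),
    (15, .add (tMem 1) (.mul (tMem 0) (tMem 5))), (29, tWide), (30, tNarrow)]

/-- The algorithm. -/
def algorithm : Program :=
  -- The second factor of the product is the condition `k ≤ n` of `Instance.isYes_iff`.
  .seq (assigns setup) <| .seq guessSearch <| assign 0 (.mul (.reg 27) (leq (.reg 8) (.reg 1)))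

/-- A bound for the running time. -/
def totalTime (D : Data) (R : ℕ) : ℕ :=
  1000 + ((D.wide + D.narrow) * ((3 + 11 * D.B) * (D.wide ^ 3 * D.narrow ^ (3 + 11 * D.B))) + 1) *
    (2 * tDigitTest.time R + 122 + guessTime D R)

/-- Two separate bounds are used: `X` exceeds every number that occurs in a variable and matters for
overflow, while `R` has to exceed only the loop bounds and matters for time. -/
theorem ends_algorithm (x : Instance) (hR : Room x.toData x.encode.length X)
    (hW : X ^ maxDeg < W) (hX : ∀ i, x.encode.getD i 0 ≤ X)
    (hX' : 2 * x.n + 1 ≤ X) (hRn : 2 * x.n + 1 ≤ R) (hRm : x.m ≤ R) (hRB : 2 * x.B ≤ R) :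
    Ends W algorithm (init x.encode) (totalTime x.toData R) fun s' =>
      s'.reg 0 = if x.IsYes then 1 else 0 := by
  set D := x.toData with hD
  set N := x.encode.length with hN
  have h2 := hR.two_le
  have fit : ∀ {t : Term}, t.WF → t.deg ≤ 200 → t.Fits W X := fun ht hd =>
    fits_of_le h2 hW ht (hd.trans (by unfold maxDeg; omega))
  have hbase := hR.base
  have hd1 := hR.digits₁
  have hd2 := hR.digits₂
  have eDn : D.n = x.n := rfl
  have eDm : D.m = x.m := rfl
  have eDB : D.B = x.B := rfl
  have m0 : (init x.encode).mem 0 = D.m := by simp [init, Instance.encode_eq, eDm]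
  have m1 : (init x.encode).mem 1 = D.n := by simp [init, Instance.encode_eq, eDn]
  have m2 : (init x.encode).mem 2 = D.k := by simp [init, Instance.encode_eq]; rfl
  have m3 : (init x.encode).mem 3 = D.B := by simp [init, Instance.encode_eq, eDB]
  have m4 : (init x.encode).mem 4 = D.l := by simp [init, Instance.encode_eq]; rfl
  have m5 : (init x.encode).mem 5 = D.sig := by simp [init, Instance.encode_eq]; rfl
  have r0 : (init x.encode).reg 0 = N := rfl
  have hbd : Bounded X R (init x.encode) := by
    refine ⟨fun r _ => ?_, hX, fun r h1 _ => ?_⟩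
    · simp only [init]
      split_ifs <;> omega
    · simp only [init]
      split_ifs <;> omega
  have hmX : ∀ i, (init x.encode).mem i ≤ X := hX
  have hkX : D.k ≤ X := m2 ▸ hmX 2
  have hlX : D.l ≤ X := m4 ▸ hmX 4
  have hsX : D.sig ≤ X := m5 ▸ hmX 5
  have hmX' : D.m ≤ X := m0 ▸ hmX 0
  have hset := ends_assigns (W := W) setup (init x.encode) hbd
    (by
      simp only [setup, List.mem_cons, List.not_mem_nil, or_false, forall_eq_or_imp, forall_eq]
      refine ⟨?_, ?_, ?_, ?_, ?_, ?_, ?_, ?_, ?_, ?_, ?_, ?_, ?_, ?_, ?_⟩ <;>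
        exact ⟨fit (by decide) (by decide), by omega, by omega⟩)
    (by
      simp only [setup, List.mem_cons, List.not_mem_nil, or_false, forall_eq_or_imp, forall_eq,
        Term.eval, tMem, tWide, tNarrow, tLen]
      simp)
    (by
      simp only [setup, List.mem_cons, List.not_mem_nil, or_false, forall_eq_or_imp, forall_eq,
        Term.eval, tMem, tWide, tNarrow, tLen, m0, m1, m2, m3, m4, m5, r0]
      simp only [Data.wide, Data.narrow] at hd1
      refine ⟨?_, ?_, ?_, ?_, ?_, ?_, ?_, ?_, ?_, ?_, ?_, ?_, ?_, ?_, ?_⟩ <;> omega)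
    (by
      simp only [setup, List.mem_cons, List.not_mem_nil, or_false, forall_eq_or_imp, forall_eq,
        Term.eval, tMem, tWide, tNarrow, tLen, m0, m1, m2, m3, m4, m5, r0]
      refine ⟨?_, ?_, ?_, ?_, ?_, ?_, ?_, ?_, ?_, ?_, ?_, ?_, ?_, ?_, ?_⟩ <;> omega)
    (by decide)
  have hsig : 1 ≤ D.sig := Finset.card_pos.2 ⟨_, x.A_mem ⟨0, x.m_pos⟩ ⟨0, x.n_pos⟩⟩
  have hal : ∀ j < D.n, ∀ r < D.m, ∃ v < D.sig, D.A r j = D.al v := by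
    intro j hj r hr
    rw [← x.mem_alphabet_iff]
    have := x.toData_A ⟨r, hr⟩ ⟨j, hj⟩
    simp only at this
    rw [this]
    exact x.A_mem _ _
  refine (hset.seq (T₂ := (nodes (DigitOK D) (D.wide + D.narrow) (3 + 11 * D.B) [] + 1) *
    (2 * tDigitTest.time R + 122 + guessTime D R) + 20) fun s1 h1 => ?_).mono ?_ fun _ h => h
  · obtain ⟨hm1, hb1, hv1, hq1⟩ := h1
    simp only [setup, List.mem_cons, List.not_mem_nil, or_false, forall_eq_or_imp, forall_eq,
      Term.eval, tMem, tWide, tNarrow, tLen, m0, m1, m2, m3, m4, m5, r0] at hv1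
    have S : Setting D N (init x.encode).mem s1.reg := by
      obtain ⟨v1, v2, v3, v4, v5, v6, v7, v8, v9, v10, v11, v12, v13, v14, v15⟩ := hv1
      refine ⟨v1, v2, v3, v4, v5, v6, v7, v8, v9, v10, v11, v12, v13, v14, v15, ?_, ?_, ?_, ?_, ?_⟩
      · rw [hN, x.length_encode]; rfl
      · exact fun r hr j hj => x.encode_entry hr hj
      · intro r j hrj
        simp only [hD, Instance.toData]
        exact dif_neg hrj
      · exact fun v _ => x.encode_letter
      · intro v hv
        exact List.getD_eq_default _ _ (by simpa [hD, Instance.toData] using hv)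
    have hi1 : GuessInv D N X R (init x.encode).mem s1.reg [] s1 := by
      refine ⟨⟨hb1, fun _ _ => rfl, fun a _ => by rw [hm1]⟩, ?_⟩
      rw [hq1 27 (by omega) (by
        simp only [setup, List.mem_cons, List.not_mem_nil, or_false, forall_eq_or_imp, forall_eq]
        omega)]
      simp [init]
    refine ((guessSpec S hR hW x.n_pos hsig).ends_backtrack hi1).seq fun s2 hs2 => ?_
    refine (ends_assign (t := .mul (.reg 27) (leq (.reg 8) (.reg 1))) (fit (by decide) (by decide))
      (by omega) hs2.frame.bounded).mono (by simp [Term.time, leq, neg]) fun s3 h3 => ?_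
    rw [h3.1 0 (by omega)]
    simp only [State.set_reg, Function.update_self, Term.eval, leq, neg]
    rw [hs2.answer, hs2.frame.reg 8 (by simp [fixedRegs]), hs2.frame.reg 1 (by simp [fixedRegs]),
      S.k, S.n, List.nil_append]
    have hcore : (∃ g ∈ leaves (DigitOK D) (D.wide + D.narrow) (3 + 11 * D.B) [], Accepted D g) ↔
        D.Core := ⟨fun ⟨g, _, hg⟩ => core_of_accepted hal hg, exists_accepted x.n_pos hal⟩
    rw [if_congr hcore rfl rfl, if_congr x.isYes_iff rfl rfl]
    have ek : D.k = x.k := rfl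
    by_cases hc : D.Core
    · by_cases hk : x.k ≤ x.n
      · rw [if_pos hc, if_pos ⟨hk, hc⟩, ek, eDn]; omega
      · rw [if_pos hc, if_neg fun h => hk h.1, ek, eDn]; omega
    · rw [if_neg hc, if_neg fun h => hc h.2, zero_mul]
  · have h1 := nodes_le_of_digits (Val := DigitOK D) (M := D.wide) (N := D.narrow)
      (by unfold Data.wide; nlinarith [Nat.zero_le D.n]) (by unfold Data.narrow; omega)
      (fun p y hp => by
        unfold DigitOK at hp
        simpa using hp) (D.wide + D.narrow) (3 + 11 * D.B)
    have h2 := Nat.mul_le_mul_right (2 * tDigitTest.time R + 122 + guessTime D R)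
      (Nat.add_le_add_right h1 1)
    have h3 : (setup.map fun a => a.2.time R + 2).sum ≤ 980 := by
      simp [setup, Term.time, tMem, tWide, tNarrow, tLen]
    unfold totalTime
    omega

end ColumnOutliers


/-! ### The running time -/

namespace ColumnOutliers

open Finset WordRAM WordRAM.Term

variable {D : Data} {R Z e : ℕ}

/-- A common bound for the evaluation times of the terms. -/
theorem exists_time_bound : ∃ e, ∀ R, 6 ≤ R →
    (tGood 19 1 23 19).time R ≤ R ^ e ∧ tBest.time R ≤ R ^ e ∧ tConsistent.time R ≤ R ^ e ∧
    (tAccepts 25).time R ≤ R ^ e ∧ tDigitTest.time R ≤ R ^ e := by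
  obtain ⟨e1, h1⟩ := (tGood 19 1 23 19).exists_time_le
  obtain ⟨e2, h2⟩ := tBest.exists_time_le
  obtain ⟨e3, h3⟩ := tConsistent.exists_time_le
  obtain ⟨e4, h4⟩ := (tAccepts 25).exists_time_le
  obtain ⟨e5, h5⟩ := tDigitTest.exists_time_le
  refine ⟨e1 + e2 + e3 + e4 + e5, fun R hR => ?_⟩
  have key : ∀ {a b : ℕ}, a ≤ b → R ^ a ≤ R ^ b := fun h => Nat.pow_le_pow_right (by omega) h
  exact ⟨(h1 R (by omega)).trans (key (by omega)), (h2 R (by omega)).trans (key (by omega)),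
    (h3 R (by omega)).trans (key (by omega)), (h4 R (by omega)).trans (key (by omega)),
    (h5 R (by omega)).trans (key (by omega))⟩

theorem slotTime_le (hR : 6 ≤ R) (hn : D.n + D.m ≤ R) (hB : D.B + 2 ≤ R) (hsig : 1 ≤ D.sig)
    (h1 : (tGood 19 1 23 19).time R ≤ R ^ e) (h2 : tBest.time R ≤ R ^ e) :
    slotTime D R ≤ R ^ (e + 10) * ((D.B + 2) ^ (4 * D.B) * D.sig ^ D.B) := by
  set P := (D.B + 2) ^ (4 * D.B) * D.sig ^ D.B with hP
  have hP1 : 1 ≤ P := Nat.mul_pos (pow_pos (by omega) _) (pow_pos (by omega) _)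
  have hRe : 1 ≤ R ^ e := Nat.one_le_pow _ _ (by omega)
  -- `2 * B ≤ (B + 2) ^ 2`. The base `B + 2` avoids the degenerate cases `B ≤ 1`.
  have hB2 : ((2 * D.B) ^ D.B) ^ 2 ≤ (D.B + 2) ^ (4 * D.B) := by
    rw [← pow_mul, show 4 * D.B = 2 * (D.B * 2) by ring, pow_mul (D.B + 2) 2]
    exact Nat.pow_le_pow_left (by nlinarith) _
  have hV : (D.n + D.m) * ((D.B + 1) * (D.n * (D.n * (2 * D.B) ^ D.B) ^ 2 * D.sig ^ D.B)) ≤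
      R ^ 5 * P := by
    calc _ = (D.n + D.m) * (D.B + 1) * (D.n * D.n ^ 2) * (((2 * D.B) ^ D.B) ^ 2 * D.sig ^ D.B) := by
          ring
      _ ≤ R * R * (R * R ^ 2) * P := by
          have hnR : D.n ≤ R := by omega
          refine Nat.mul_le_mul (Nat.mul_le_mul (Nat.mul_le_mul hn (by omega))
            (Nat.mul_le_mul hnR (Nat.pow_le_pow_left hnR 2))) (Nat.mul_le_mul_right _ hB2)
      _ = R ^ 5 * P := by ring
  have hR5 : 1 ≤ R ^ 5 * P := Nat.mul_pos (pow_pos (by omega) _) hP1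
  have hc : 2 * (tGood 19 1 23 19).time R + 122 + (tBest.time R + 2) ≤ 127 * R ^ e := by omega
  have h3 := Nat.mul_le_mul (Nat.add_le_add hV hR5) hc
  have hR4 : 1296 ≤ R ^ 4 := by
    calc 1296 = 6 ^ 4 := by norm_num
      _ ≤ R ^ 4 := Nat.pow_le_pow_left hR 4
  have hR1 : R ^ 4 ≤ R ^ 5 := Nat.pow_le_pow_right (by omega) (by omega)
  unfold slotTime
  calc _ ≤ (R ^ 5 * P + R ^ 5 * P) * (127 * R ^ e) + 500 :=
        Nat.add_le_add_right (le_trans (Nat.mul_le_mul_right _ (Nat.add_le_add_left hR5 _ |>.trans'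
          (Nat.add_le_add_right hV 1))) (Nat.mul_le_mul_left _ hc)) _
    _ ≤ 254 * (R ^ 5 * P * R ^ e) + 500 * (R ^ 5 * P * R ^ e) := by
        have : 1 ≤ R ^ 5 * P * R ^ e := Nat.mul_pos hR5 hRe
        nlinarith
    _ ≤ R ^ 4 * (R ^ 5 * P * R ^ e) := by rw [← add_mul]; exact Nat.mul_le_mul_right _ (by omega)
    _ = R ^ (e + 9) * P := by ring
    _ ≤ R ^ (e + 10) * P := Nat.mul_le_mul_right _ (Nat.pow_le_pow_right (by omega) (by omega))

theorem totalTime_le (hR : 6 ≤ R) (hn : D.n + D.m ≤ R) (hn1 : 1 ≤ D.n) (hB : D.B + 2 ≤ R)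
    (hB2 : 2 * D.B ≤ R) (hsig : 1 ≤ D.sig)
    (h1 : (tGood 19 1 23 19).time R ≤ R ^ e) (h2 : tBest.time R ≤ R ^ e)
    (h3 : tConsistent.time R ≤ R ^ e) (h4 : (tAccepts 25).time R ≤ R ^ e)
    (h5 : tDigitTest.time R ≤ R ^ e) :
    totalTime D R ≤ R ^ (e + 40) * ((D.B + 2) ^ (48 * (D.B + 1)) * D.sig ^ D.B) := by
  have hs := slotTime_le hR hn hB hsig h1 h2
  set P := (D.B + 2) ^ (4 * D.B) * D.sig ^ D.B with hP
  have hP1 : 1 ≤ P := Nat.mul_pos (pow_pos (by omega) _) (pow_pos (by omega) _)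
  have pos : ∀ k, 1 ≤ R ^ k := fun k => Nat.one_le_pow _ _ (by omega)
  have hR4 : 1296 ≤ R ^ 4 := by
    calc 1296 = 6 ^ 4 := by norm_num
      _ ≤ R ^ 4 := Nat.pow_le_pow_left hR 4
  have hA : 1 ≤ R ^ (e + 11) * P := Nat.mul_pos (pos _) hP1
  have he : R ^ e ≤ R ^ (e + 11) * P :=
    (Nat.pow_le_pow_right (by omega) (by omega)).trans (Nat.le_mul_of_pos_right _ hP1)
  have hslot : 2 * D.B * (slotTime D R + 1) ≤ 2 * (R ^ (e + 11) * P) := by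
    calc _ ≤ R * (R ^ (e + 10) * P + R ^ (e + 10) * P) :=
          Nat.mul_le_mul hB2 (Nat.add_le_add hs (Nat.mul_pos (pos _) hP1))
      _ = 2 * (R ^ (e + 11) * P) := by ring
  have hg : 2 * tDigitTest.time R + 122 + guessTime D R ≤ 200 * (R ^ (e + 11) * P) := by
    unfold guessTime
    omega
  set Y := (D.B + 2) ^ (4 * (3 + 11 * D.B)) with hY
  have hY1 : 1 ≤ Y := Nat.one_le_pow _ _ (by omega)
  have hwide : D.wide ≤ R ^ 4 := by
    have : 2 * D.n + 2 ≤ 4 * R := by omega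
    unfold Data.wide
    calc _ ≤ 4 * R * (4 * R) := Nat.mul_le_mul this this
      _ = 16 * R ^ 2 := by ring
      _ ≤ R ^ 2 * R ^ 2 := Nat.mul_le_mul_right _ (by nlinarith)
      _ = R ^ 4 := by ring
  have hnar : D.narrow ≤ (D.B + 2) ^ 4 := by
    unfold Data.narrow
    nlinarith [Nat.zero_le (D.B ^ 4), Nat.zero_le (D.B ^ 3), Nat.zero_le (D.B ^ 2)]
  have hnar' : D.narrow ≤ R ^ 4 := hnar.trans (Nat.pow_le_pow_left hB 4)
  have hpow : D.narrow ^ (3 + 11 * D.B) ≤ Y := by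
    rw [hY, pow_mul]
    exact Nat.pow_le_pow_left hnar _
  have hnodes : (D.wide + D.narrow) * ((3 + 11 * D.B) * (D.wide ^ 3 * D.narrow ^ (3 + 11 * D.B))) ≤
      22 * (R ^ 17 * Y) := by
    calc _ ≤ (R ^ 4 + R ^ 4) * (11 * R * ((R ^ 4) ^ 3 * Y)) := by
          gcongr
          omega
      _ = 22 * (R ^ 17 * Y) := by ring
  have hRY : 1 ≤ R ^ 17 * Y := Nat.mul_pos (pos _) hY1
  unfold totalTime
  calc _ ≤ 1000 + 23 * (R ^ 17 * Y) * (200 * (R ^ (e + 11) * P)) :=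
        Nat.add_le_add_left (Nat.mul_le_mul (by omega) hg) _
    _ ≤ 5600 * (R ^ 17 * Y * (R ^ (e + 11) * P)) := by
        have : 1 ≤ R ^ 17 * Y * (R ^ (e + 11) * P) := Nat.mul_pos hRY hA
        nlinarith
    _ ≤ (R ^ 4 * R ^ 4) * (R ^ 17 * Y * (R ^ (e + 11) * P)) :=
        Nat.mul_le_mul_right _ (by nlinarith)
    _ = R ^ (e + 36) * (((D.B + 2) ^ (4 * (3 + 11 * D.B)) * (D.B + 2) ^ (4 * D.B)) *
          D.sig ^ D.B) := by rw [hY, hP]; ring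
    -- The exponents of `B + 2` from the guesses and from the candidates add up to `4 * (3 + 11 * B)
    -- + 4 * B = 48 * B + 12`.
    _ ≤ R ^ (e + 40) * ((D.B + 2) ^ (48 * (D.B + 1)) * D.sig ^ D.B) := by
        rw [← pow_add]
        exact Nat.mul_le_mul (Nat.pow_le_pow_right (by omega) (by omega))
          (Nat.mul_le_mul_right _ (Nat.pow_le_pow_right (by omega) (by omega)))

/-- Each parameter is a word of the input and hence below `Y`. The required quantities are
polynomials in the parameters of degree at most 3, and since `Y ≥ 2` the sixth power also absorbs
the coefficients. -/
theorem room_pow (x : Instance) {Y : ℕ} (hY : Y = x.encode.length + x.encode.foldr max 0 + 2) :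
    Room x.toData x.encode.length (Y ^ 6) ∧ (∀ i, x.encode.getD i 0 ≤ Y ^ 6) ∧
      2 * x.n + 1 ≤ Y ^ 6 := by
  have hM : ∀ i, x.encode.getD i 0 + 2 ≤ Y := fun i => by
    have := getD_le_foldr_max x.encode i
    omega
  have hm : x.m + 2 ≤ Y := by simpa [Instance.encode_eq] using hM 0
  have hn : x.n + 2 ≤ Y := by simpa [Instance.encode_eq] using hM 1
  have hB : x.B + 2 ≤ Y := by simpa [Instance.encode_eq] using hM 3
  have hs : #x.alphabet + 2 ≤ Y := by simpa [Instance.encode_eq] using hM 5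
  have hY2 : 2 ≤ Y := by omega
  have p1 : Y ≤ Y ^ 6 := Nat.le_self_pow (by omega) Y
  have p3 : 8 ≤ Y ^ 3 := by
    calc 8 = 2 ^ 3 := by norm_num
      _ ≤ Y ^ 3 := Nat.pow_le_pow_left hY2 3
  have p4 : 16 ≤ Y ^ 4 := by
    calc 16 = 2 ^ 4 := by norm_num
      _ ≤ Y ^ 4 := Nat.pow_le_pow_left hY2 4
  have q1 : 8 * Y ^ 3 ≤ Y ^ 6 := by
    calc 8 * Y ^ 3 ≤ Y ^ 3 * Y ^ 3 := Nat.mul_le_mul_right _ p3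
      _ = Y ^ 6 := by ring
  have q2 : 16 * Y ^ 2 ≤ Y ^ 6 := by
    calc 16 * Y ^ 2 ≤ Y ^ 4 * Y ^ 2 := Nat.mul_le_mul_right _ p4
      _ = Y ^ 6 := by ring
  have q3 : 2 * Y ≤ Y ^ 2 := by nlinarith
  refine ⟨⟨hY2.trans p1, ?_, ?_, ?_, ?_⟩, fun i => (by have := hM i; omega : _ ≤ Y).trans p1,
    by omega⟩
  · change _ + (3 + 11 * x.B) ≤ _
    omega
  · unfold Data.wide Data.narrow
    change (2 * x.n + 2) * (2 * x.n + 2) + (4 * x.B * x.B + 2 * x.B + 2) ≤ _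
    have h1 : (2 * x.n + 2) * (2 * x.n + 2) ≤ 2 * Y * (2 * Y) :=
      Nat.mul_le_mul (by omega) (by omega)
    have h2 : x.B * x.B ≤ Y * Y := Nat.mul_le_mul (by omega) (by omega)
    nlinarith
  · change x.n + x.m * #x.alphabet ≤ _
    have h2 : x.m * #x.alphabet ≤ Y * Y := Nat.mul_le_mul (by omega) (by omega)
    nlinarith
  · change 2 * x.B * (2 * x.B * (2 * x.n + 1)) ≤ _
    calc _ ≤ 2 * Y * (2 * Y * (2 * Y)) :=
          Nat.mul_le_mul (by omega) (Nat.mul_le_mul (by omega) (by omega))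
      _ = 8 * Y ^ 3 := by ring
      _ ≤ _ := q1

/-- For `B ≥ 2` use `B + 2 ≤ B ^ 2` and `B + 1 ≤ 2 * B`. For `B ≤ 1` the exponent `B * log B`
vanishes, and the constant `3 ^ (2 * b)` takes over. -/
theorem pow_le_two_rpow (b B : ℕ) : (((B + 2) ^ (b * (B + 1)) : ℕ) : ℝ) ≤
    (3 ^ (2 * b) : ℕ) * (2 : ℝ) ^ (((4 * b : ℕ) : ℝ) * ((B : ℝ) * Real.logb 2 (B : ℝ))) := by
  rcases Nat.lt_or_ge B 2 with hB | hB
  · have h1 : (B : ℝ) * Real.logb 2 (B : ℝ) = 0 := by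
      interval_cases B <;> simp
    rw [h1, mul_zero, Real.rpow_zero, mul_one]
    norm_cast
    calc (B + 2) ^ (b * (B + 1)) ≤ 3 ^ (b * (B + 1)) := Nat.pow_le_pow_left (by omega) _
      _ ≤ 3 ^ (2 * b) := Nat.pow_le_pow_right (by omega) (by nlinarith)
  · have hB0 : (0 : ℝ) < B := by exact_mod_cast (by omega : 0 < B)
    have h1 : (2 : ℝ) ^ (((4 * b : ℕ) : ℝ) * ((B : ℝ) * Real.logb 2 (B : ℝ))) =
        ((B ^ (4 * b * B) : ℕ) : ℝ) := by
      rw [show ((4 * b : ℕ) : ℝ) * ((B : ℝ) * Real.logb 2 (B : ℝ)) =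
        Real.logb 2 (B : ℝ) * ((4 * b * B : ℕ) : ℝ) by push_cast; ring, Real.rpow_mul (by norm_num),
        Real.rpow_logb (by norm_num) (by norm_num) hB0, Real.rpow_natCast]
      push_cast
      rfl
    rw [h1]
    norm_cast
    calc (B + 2) ^ (b * (B + 1)) ≤ (B ^ 2) ^ (b * (B + 1)) := Nat.pow_le_pow_left (by nlinarith) _
      _ = B ^ (2 * (b * (B + 1))) := (pow_mul B 2 _).symm
      _ ≤ B ^ (4 * b * B) := Nat.pow_le_pow_right (by omega) (by nlinarith)
      _ ≤ 3 ^ (2 * b) * B ^ (4 * b * B) := Nat.le_mul_of_pos_left _ (pow_pos (by omega) _)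

end ColumnOutliers

/-! ### Collecting the constants. -/

theorem theorem6 :
    ∃ (P : WordRAM.Program) (c : ℕ), ∀ x : ColumnOutliers.Instance,
      ∃ (t : ℕ) (s : WordRAM.State),
        WordRAM.Runs (WordRAM.wordBound c x.encode) P (WordRAM.init x.encode) t s ∧
        (x.IsYes → s.reg 0 = 1) ∧ (¬ x.IsYes → s.reg 0 = 0) ∧
        (t : ℝ) ≤ c * (2 : ℝ) ^ ((c : ℝ) * ((x.B : ℝ) * Real.logb 2 (x.B : ℝ))) *
          (x.alphabet.card : ℝ) ^ x.B * ((x.n : ℝ) * (x.m : ℝ)) ^ c := by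
  obtain ⟨e, he⟩ := ColumnOutliers.exists_time_bound
  obtain ⟨a, ha⟩ : ∃ a, a = e + 40 := ⟨_, rfl⟩
  obtain ⟨b, hb⟩ : ∃ b, b = a + 48 := ⟨_, rfl⟩
  -- One constant serves as leading factor, as factor in the exponent of 2, as exponent of `n * m`
  -- and as word length. The strict last condition makes the word bound exceed `(Y ^ 6) ^ maxDeg`.
  obtain ⟨c, hc1', hc2', hc3, hc4⟩ : ∃ c, 3 ^ a * 3 ^ (2 * b) ≤ c ∧ 4 * b ≤ c ∧ a ≤ c ∧
      6 * ColumnOutliers.maxDeg < c := by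
    generalize ColumnOutliers.maxDeg = M
    generalize 3 ^ a * 3 ^ (2 * b) = K
    exact ⟨K + 4 * b + a + 6 * M + 1, by omega, by omega, by omega, by omega⟩
  refine ⟨ColumnOutliers.algorithm, c, fun x => ?_⟩
  have hn : 1 ≤ x.n := x.n_pos
  have hm : 1 ≤ x.m := x.m_pos
  have hnm : 1 ≤ x.n * x.m := Nat.mul_pos hn hm
  -- Dominates the loop bounds `2 * n + 1`, `m` and `2 * B`. In product form, powers of `R` split
  -- into a power of `n * m` and a power of `B + 2`.
  set R := 3 * (x.n * x.m) * (x.B + 2) with hR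
  have hR3 : 3 * (x.n * x.m) + (x.B + 2) ≤ R + 2 := by
    rw [hR]; nlinarith [Nat.mul_le_mul hnm (Nat.zero_le x.B)]
  have hRle : 3 * (x.n * x.m) * 2 ≤ R := Nat.mul_le_mul_left _ (by omega)
  have hRB : 3 * (x.B + 2) ≤ R := Nat.mul_le_mul_right _ (by omega)
  have hnn : x.n ≤ x.n * x.m := Nat.le_mul_of_pos_right _ hm
  have hmm : x.m ≤ x.n * x.m := Nat.le_mul_of_pos_left _ hn
  set Y := x.encode.length + x.encode.foldr max 0 + 2 with hY
  obtain ⟨hroom, hX, hX'⟩ := ColumnOutliers.room_pow x hY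
  have hsig : 1 ≤ x.alphabet.card :=
    Finset.card_pos.2 ⟨_, x.A_mem ⟨0, x.m_pos⟩ ⟨0, x.n_pos⟩⟩
  have hW : (Y ^ 6) ^ ColumnOutliers.maxDeg < WordRAM.wordBound c x.encode := by
    rw [WordRAM.wordBound, ← hY, ← pow_mul]
    exact Nat.pow_lt_pow_right (by omega) hc4
  obtain ⟨t, ht, s, hrun, hs⟩ := ColumnOutliers.ends_algorithm x (R := R) hroom hW hX hX'
    (by omega) (by omega) (by omega)
  refine ⟨t, s, hrun, fun h => by rw [hs, if_pos h], fun h => by rw [hs, if_neg h], ?_⟩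
  obtain ⟨h1, h2, h3, h4, h5⟩ := he R (by omega)
  have hT := ht.trans (ColumnOutliers.totalTime_le (D := x.toData) (R := R) (e := e) (by omega)
    (show x.n + x.m ≤ R by omega) hn (show x.B + 2 ≤ R by omega) (show 2 * x.B ≤ R by omega) hsig
    h1 h2 h3 h4 h5)
  have hnat : t ≤ 3 ^ a * (x.n * x.m) ^ a * ((x.B + 2) ^ (b * (x.B + 1)) *
      x.alphabet.card ^ x.B) := by
    refine hT.trans ?_
    rw [← ha]
    change R ^ a * ((x.B + 2) ^ (48 * (x.B + 1)) * x.alphabet.card ^ x.B) ≤ _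
    -- The factor `(B + 2) ^ a` of `R ^ a` joins the other power of `B + 2`; this is why `b = a +
    -- 48`.
    calc _ = 3 ^ a * (x.n * x.m) ^ a * ((x.B + 2) ^ (a + 48 * (x.B + 1)) *
          x.alphabet.card ^ x.B) := by rw [hR, mul_pow, mul_pow, pow_add]; ring
      _ ≤ _ := by
          refine Nat.mul_le_mul_left _ (Nat.mul_le_mul_right _ (Nat.pow_le_pow_right (by omega) ?_))
          rw [hb, add_mul]
          exact Nat.add_le_add_right (Nat.le_mul_of_pos_right _ (by omega)) _
  have hlog : 0 ≤ (x.B : ℝ) * Real.logb 2 (x.B : ℝ) := by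
    rcases Nat.eq_zero_or_pos x.B with h0 | h0
    · simp [h0]
    · exact mul_nonneg (Nat.cast_nonneg _)
        (Real.logb_nonneg (by norm_num) (by exact_mod_cast h0))
  have hpow := ColumnOutliers.pow_le_two_rpow b x.B
  have hnmR : (1 : ℝ) ≤ (x.n : ℝ) * x.m := by exact_mod_cast hnm
  have hc1 : ((3 ^ a : ℕ) : ℝ) * (3 ^ (2 * b) : ℕ) ≤ (c : ℝ) := by
    exact_mod_cast hc1'
  have hc2 : ((4 * b : ℕ) : ℝ) ≤ (c : ℝ) := by exact_mod_cast hc2'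
  calc (t : ℝ) ≤ ((3 ^ a * (x.n * x.m) ^ a * ((x.B + 2) ^ (b * (x.B + 1)) *
        x.alphabet.card ^ x.B) : ℕ) : ℝ) := by exact_mod_cast hnat
    _ = ((3 ^ a : ℕ) : ℝ) * (((x.B + 2) ^ (b * (x.B + 1)) : ℕ) : ℝ) *
        (x.alphabet.card : ℝ) ^ x.B * ((x.n : ℝ) * x.m) ^ a := by push_cast; ring
    _ ≤ ((3 ^ a : ℕ) : ℝ) * ((3 ^ (2 * b) : ℕ) *
          (2 : ℝ) ^ (((4 * b : ℕ) : ℝ) * ((x.B : ℝ) * Real.logb 2 (x.B : ℝ)))) *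
        (x.alphabet.card : ℝ) ^ x.B * ((x.n : ℝ) * x.m) ^ c := by
        gcongr
    _ ≤ _ := by
        rw [← mul_assoc]
        exact mul_le_mul_of_nonneg_right (mul_le_mul_of_nonneg_right (mul_le_mul hc1
          (Real.rpow_le_rpow_of_exponent_le one_le_two (mul_le_mul_of_nonneg_right hc2 hlog))
          (by positivity) (Nat.cast_nonneg _)) (by positivity)) (by positivity)
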